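/- On $L^2(\mathbb R^2)$, with points written $(x,u)$, let $U=\partial_u$ and let $G=-(\partial_x^2+x^2\partial_u^2)$ be the Grušin operator; $iU$ and $G$ also denote the closures of these operators from $C_c^\infty(\mathbb R^2)$, and $-iGU^{-1}=G(iU)^{-1}$ denotes the closure of the product of $G$ and $(iU)^{-1}$ on its natural domain. The Grušin fan is the closure in $\mathbb R^2$ of the union of the rays $\{(\epsilon\lambda,(2n+1)\lambda):\lambda>0\}$, $n\in\mathbb N_0$, $\epsilon=\pm1$. Let $$h_n(x)=(\sqrt\pi\,n!\,2^n)^{-1/2}\Big(\frac{d}{dx}-x\Big)^n e^{-x^2/2}$$ be the $n$-th Hermite function, and for $f$ in the Schwartz space $\mathcal S(\mathbb R^2)$, $\lambda>0$, let $$[\mathcal P_{\lambda,n,\epsilon}f](x,u)=\int_{\mathbb R^2}\frac{\lambda^{1/2}}{2\pi}\,e^{-i\epsilon\lambda(u-u')}\,h_n(\lambda^{1/2}x')\,h_n(\lambda^{1/2}x)\,f(x',u')\,dx'\,du'.$$ (i) There is a joint spectral measure $E$ of $(iU,G)$, that is, a projection-valued measure $E$ on $\mathbb R^2$ with $iU=\int\xi\,dE(\xi,\tau)$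 and $G=\int\tau\,dE(\xi,\tau)$, and every such $E$ is concentrated on the Grušin fan. For every bounded (Borel) measurable function $m:\text{fan}\to\mathbb C$, let $m(G,iU)=\int m\,dE$ (the first argument of $m$ refers to $iU$ and the second one to $G$). Then for every $f\in\mathcal S(\mathbb R^2)$ $$[m(G,iU)f](x,u)=\sum_{\epsilon=\pm1}\sum_{n=0}^\infty\int_0^\infty m(\epsilon\lambda,(2n+1)\lambda)\,[\mathcal P_{\lambda,n,\epsilon}f](x,u)\,d\lambda$$ for almost every $(x,u)$, where the integrals over $\lambda$ converge absolutely for every $(x,u)$, and the series over $(\epsilon,n)$ converges unconditionally for almost every $(x,u)$. (ii) The operator $-iGU^{-1}$ has a spectral measure $F$, that is, a projection-valued measure $F$ on $\mathbb R$ with $-iGU^{-1}=\int t\,dF(t)$. For every bounded (Borel) measurable function $m:\mathbb R\to\mathbb C$, the operator $m(-iGU^{-1})=\int m\,dF$ satisfies, for every $f\in\mathcal S(\mathbb R^2)$ and almost every $(x,u)$, $$[m(-iGU^{-1})f](x,u)=\sum_{\epsilon=\pm1}\sum_{n=0}^\infty m(\epsilon(2n+1))\,[\mathcal P_{n,\epsilon}f](x,u),\qquad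 [\mathcal P_{n,\epsilon}f](x,u)=\int_0^\infty[\mathcal P_{\lambda,n,\epsilon}f](x,u)\,d\lambda,$$ where the integrals over $\lambda$ converge absolutely for every $(x,u)$, and the series converges unconditionally for almost every $(x,u)$. -/

import Mathlib

open MeasureTheory Set
open scoped SchwartzMap LineDeriv ENNReal

/-! ### Projection-valued measures and spectral integrals -/

/-- A projection-valued measure (resolution of the identity) on the measurable space `X`, acting on
the Hilbert space `H`. Only its values on measurable sets are meaningful. -/
structure ProjMeasure (X : Type*) [MeasurableSpace X] (H : Type*) [NormedAddCommGroup H]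
    [InnerProductSpace ℂ H] [CompleteSpace H] where
  proj : Set X → H →L[ℂ] H
  isStarProjection_proj : ∀ s, MeasurableSet s → IsStarProjection (proj s)
  proj_univ : proj univ = 1
  proj_inter : ∀ s t, MeasurableSet s → MeasurableSet t → proj (s ∩ t) = proj s * proj t
  hasSum_proj : ∀ s : ℕ → Set X, (∀ n, MeasurableSet (s n)) → Pairwise (Function.onFun Disjoint s) →
    ∀ f : H, HasSum (fun n => proj (s n) f) (proj (⋃ n, s n) f)

namespace ProjMeasure

variable {X : Type*} [MeasurableSpace X] {H : Type*} [NormedAddCommGroup H]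
  [InnerProductSpace ℂ H] [CompleteSpace H]

theorem proj_empty_apply (E : ProjMeasure X H) (f : H) : E.proj ∅ f = 0 := by
  have h := E.hasSum_proj (fun _ => ∅) (fun _ => MeasurableSet.empty)
    (fun _ _ _ => disjoint_bot_left) f
  exact tendsto_nhds_unique tendsto_const_nhds h.summable.tendsto_atTop_zero

theorem inner_proj_self (E : ProjMeasure X H) {s : Set X} (hs : MeasurableSet s) (f : H) :
    inner ℂ f (E.proj s f) = ((‖E.proj s f‖ ^ 2 : ℝ) : ℂ) := by
  have hp := E.isStarProjection_proj s hs
  have hi : E.proj s (E.proj s f) = E.proj s f :=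
    congrArg (fun T : H →L[ℂ] H => T f) hp.isIdempotentElem
  have ha := ContinuousLinearMap.adjoint_inner_left (E.proj s) (E.proj s f) f
  rw [← ContinuousLinearMap.star_eq_adjoint, hp.isSelfAdjoint.star_eq, hi] at ha
  rw [← ha, inner_self_eq_norm_sq_to_K]
  norm_cast

/-- The scalar spectral measure `μ_f(s) = ‖E(s) f‖² = ⟨f, E(s) f⟩`. -/
noncomputable def scalarMeasure (E : ProjMeasure X H) (f : H) : Measure X :=
  Measure.ofMeasurable (fun s _ => ENNReal.ofReal (‖E.proj s f‖ ^ 2))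
    (by simp [E.proj_empty_apply f])
    (by
      intro s hs hd
      have h1 := (E.hasSum_proj s hs hd f).mapL (innerSL ℂ f)
      simp only [innerSL_apply_apply] at h1
      rw [E.inner_proj_self (MeasurableSet.iUnion hs)] at h1
      have h2 : HasSum (fun n => ((‖E.proj (s n) f‖ ^ 2 : ℝ) : ℂ))
          ((‖E.proj (⋃ n, s n) f‖ ^ 2 : ℝ) : ℂ) := by
        have h0 : (fun n => ((‖E.proj (s n) f‖ ^ 2 : ℝ) : ℂ)) =
            fun n => inner ℂ f (E.proj (s n) f) :=
          funext fun n => (E.inner_proj_self (hs n) f).symm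
        rw [h0]
        exact h1
      have h3 := Complex.hasSum_ofReal.mp h2
      rw [← h3.tsum_eq, ENNReal.ofReal_tsum_of_nonneg (fun n => by positivity) h3.summable])

theorem scalarMeasure_apply (E : ProjMeasure X H) (f : H) {s : Set X} (hs : MeasurableSet s) :
    E.scalarMeasure f s = ENNReal.ofReal (‖E.proj s f‖ ^ 2) :=
  Measure.ofMeasurable_apply s hs

/-- `T` is the bounded operator `∫ m dE` (for bounded measurable `m`): the operator with quadratic
form `⟨f, T f⟩ = ∫ m dμ_f`. There is at most one, see `IsIntegral.unique`. -/
def IsIntegral (E : ProjMeasure X H) (m : X → ℂ) (T : H →L[ℂ] H) : Prop :=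
  ∀ f : H, inner ℂ f (T f) = ∫ x, m x ∂E.scalarMeasure f

theorem IsIntegral.unique {E : ProjMeasure X H} {m : X → ℂ} {S T : H →L[ℂ] H}
    (hS : E.IsIntegral m S) (hT : E.IsIntegral m T) : S = T := by
  have h : ((S : H →ₗ[ℂ] H)) = (T : H →ₗ[ℂ] H) := by
    refine (ext_inner_map _ _).mp fun f => ?_
    have := (hS f).trans (hT f).symm
    rw [← inner_conj_symm, ← inner_conj_symm ((T : H →ₗ[ℂ] H) f) f]
    exact congrArg _ this
  exact ContinuousLinearMap.coe_injective h

/-- `A = ∫ a dE` as an unbounded operator, for a real measurable function `a`: the domain of `A`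
is `{f | ∫ a² dμ_f < ∞}`, and `⟨f, A f⟩ = ∫ a dμ_f` for every `f` in it. By polarization this
determines `A`, which is then self-adjoint. -/
def IsResolution (E : ProjMeasure X H) (a : X → ℝ) (A : H →ₗ.[ℂ] H) : Prop :=
  (∀ f : H, f ∈ A.domain ↔ Integrable (fun x => a x ^ 2) (E.scalarMeasure f)) ∧
  ∀ f : A.domain, inner ℂ (f : H) (A f) = ((∫ x, a x ∂E.scalarMeasure (f : H) : ℝ) : ℂ)

end ProjMeasure

/-- `F` is the spectral measure of the (self-adjoint) operator `A`. -/
def IsSpectralMeasure {H : Type*} [NormedAddCommGroup H] [InnerProductSpace ℂ H] [CompleteSpace H]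
    (A : H →ₗ.[ℂ] H) (F : ProjMeasure ℝ H) : Prop :=
  F.IsResolution (fun t => t) A

/-- `E` is the joint spectral measure of the (strongly commuting self-adjoint) operators `A`, `B`;
the first coordinate of `ℝ × ℝ` refers to `A` and the second one to `B`. -/
def IsJointSpectralMeasure {H : Type*} [NormedAddCommGroup H] [InnerProductSpace ℂ H]
    [CompleteSpace H] (A B : H →ₗ.[ℂ] H) (E : ProjMeasure (ℝ × ℝ) H) : Prop :=
  E.IsResolution Prod.fst A ∧ E.IsResolution Prod.snd B

/-- The product `A B` of unbounded operators on its natural domain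
`{f ∈ dom B | B f ∈ dom A}`. -/
def LinearPMap.mulNat {H : Type*} [AddCommGroup H] [Module ℂ H] (A B : H →ₗ.[ℂ] H) :
    H →ₗ.[ℂ] H :=
  A.comp (B.domRestrict ((A.domain.comap B.toFun).map B.domain.subtype)) (by
    rintro ⟨f, hf, hfB⟩
    obtain ⟨g, hg, rfl⟩ := hf
    exact hg)

/-! ### The operators `iU = i ∂_u` and `G = -(∂_x² + x² ∂_u²)` on `L²(ℝ²)` -/

/-- `L²(ℝ²)`; points of `ℝ × ℝ` are written `(x, u)`. -/
abbrev GrushinL2 : Type := Lp ℂ 2 (volume : Measure (ℝ × ℝ))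

/-- `C_c^∞(ℝ²)`, as the space of compactly supported Schwartz functions. -/
def testSpace : Submodule ℂ 𝓢(ℝ × ℝ, ℂ) where
  carrier := {f | HasCompactSupport f}
  add_mem' := fun hf hg => HasCompactSupport.add hf hg
  zero_mem' := HasCompactSupport.zero
  smul_mem' := fun c f hf => HasCompactSupport.mono hf fun p hp h0 => hp (by simp [h0])

/-- The embedding of `C_c^∞(ℝ²)` into `L²(ℝ²)`. -/
noncomputable def testEmbedding : testSpace →ₗ[ℂ] GrushinL2 :=
  (SchwartzMap.toLpCLM ℂ ℂ 2 (volume : Measure (ℝ × ℝ))).toLinearMap ∘ₗ testSpace.subtype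

theorem testEmbedding_injective : Function.Injective testEmbedding := fun _ _ h =>
  Subtype.ext (SchwartzMap.injective_toLp 2 (volume : Measure (ℝ × ℝ)) h)

/-- The unbounded operator on `L²(ℝ²)` with domain `C_c^∞(ℝ²)` induced by a differential operator
`D` (given on Schwartz functions). -/
noncomputable def minimalOperator (D : 𝓢(ℝ × ℝ, ℂ) →ₗ[ℂ] 𝓢(ℝ × ℝ, ℂ)) :
    GrushinL2 →ₗ.[ℂ] GrushinL2 where
  domain := LinearMap.range testEmbedding
  toFun := (SchwartzMap.toLpCLM ℂ ℂ 2 (volume : Measure (ℝ × ℝ))).toLinearMap ∘ₗ D ∘ₗ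
    testSpace.subtype ∘ₗ
      (LinearEquiv.ofInjective testEmbedding testEmbedding_injective).symm.toLinearMap

/-- `∂_x` on Schwartz functions. -/
noncomputable def partialX : 𝓢(ℝ × ℝ, ℂ) →ₗ[ℂ] 𝓢(ℝ × ℝ, ℂ) :=
  (LineDeriv.lineDerivOpCLM ℂ 𝓢(ℝ × ℝ, ℂ) ((1, 0) : ℝ × ℝ)).toLinearMap

/-- `U = ∂_u` on Schwartz functions. -/
noncomputable def partialU : 𝓢(ℝ × ℝ, ℂ) →ₗ[ℂ] 𝓢(ℝ × ℝ, ℂ) :=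
  (LineDeriv.lineDerivOpCLM ℂ 𝓢(ℝ × ℝ, ℂ) ((0, 1) : ℝ × ℝ)).toLinearMap

/-- Multiplication by `x²` on Schwartz functions. -/
noncomputable def mulXSq : 𝓢(ℝ × ℝ, ℂ) →ₗ[ℂ] 𝓢(ℝ × ℝ, ℂ) :=
  (SchwartzMap.smulLeftCLM ℂ (fun p : ℝ × ℝ => ((p.1 ^ 2 : ℝ) : ℂ))).toLinearMap

theorem mulXSq_apply (f : 𝓢(ℝ × ℝ, ℂ)) (p : ℝ × ℝ) : mulXSq f p = ((p.1 ^ 2 : ℝ) : ℂ) * f p := by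
  have h : (fun p : ℝ × ℝ => ((p.1 ^ 2 : ℝ) : ℂ)).HasTemperateGrowth := by
    have h1 : (fun p : ℝ × ℝ => (p.1 : ℂ)).HasTemperateGrowth :=
      (Complex.ofRealCLM.comp (ContinuousLinearMap.fst ℝ ℝ ℝ)).hasTemperateGrowth
    have h2 := h1.mul h1
    have h3 : (fun p : ℝ × ℝ => ((p.1 ^ 2 : ℝ) : ℂ)) = (fun p : ℝ × ℝ => (p.1 : ℂ)) * fun p => p.1 :=
      funext fun p => by simp [sq]
    rw [h3]
    exact h2
  exact SchwartzMap.smulLeftCLM_apply_apply h f p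

/-- The self-adjoint operator `iU`: the closure of `i ∂_u` on `C_c^∞(ℝ²)`. -/
noncomputable def iUOperator : GrushinL2 →ₗ.[ℂ] GrushinL2 :=
  (minimalOperator (Complex.I • partialU)).closure

/-- The self-adjoint Grušin operator `G`: the closure of `-(∂_x² + x² ∂_u²)` on `C_c^∞(ℝ²)`. -/
noncomputable def grushinOperator : GrushinL2 →ₗ.[ℂ] GrushinL2 :=
  (minimalOperator (-(partialX ∘ₗ partialX + mulXSq ∘ₗ partialU ∘ₗ partialU))).closure

/-- The self-adjoint operator `-i G U⁻¹ = G (iU)⁻¹`: the closure of the product of `G` and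
`(iU)⁻¹ = -i U⁻¹` on its natural domain. -/
noncomputable def grushinQuotient : GrushinL2 →ₗ.[ℂ] GrushinL2 :=
  (grushinOperator.mulNat iUOperator.inverse).closure

/-! ### The Grušin fan, Hermite functions and the operators `P_{λ,n,ε}` -/

/-- The value `±1` of `ε` as a real number. -/
def signVal (ε : ℤˣ) : ℝ := ((ε : ℤ) : ℝ)

/-- The ray `{(ελ, τ) | τ = (2n+1)λ, λ > 0}`. -/
def grushinRay (n : ℕ) (ε : ℤˣ) : Set (ℝ × ℝ) :=
  {p | ∃ l : ℝ, 0 < l ∧ p = (signVal ε * l, (2 * n + 1) * l)}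

/-- The Grušin fan: the closure of the union of all rays. -/
def grushinFan : Set (ℝ × ℝ) := closure (⋃ (n : ℕ) (ε : ℤˣ), grushinRay n ε)

/-- The normalized Hermite function `(√π n! 2ⁿ)^{-1/2} (d/dx - x)ⁿ e^{-x²/2}`. -/
noncomputable def hermiteFn (n : ℕ) (x : ℝ) : ℝ :=
  (√Real.pi * (n.factorial : ℝ) * 2 ^ n) ^ (-(1 / 2) : ℝ) *
    (fun (g : ℝ → ℝ) (y : ℝ) => deriv g y - y * g y)^[n] (fun y => Real.exp (-y ^ 2 / 2)) x

/-- The kernel `φ_{λ,n,ε}(x', u', x, u)`, with `q = (x', u')` and `p = (x, u)`. -/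
noncomputable def rayKernel (l : ℝ) (n : ℕ) (ε : ℤˣ) (q p : ℝ × ℝ) : ℂ :=
  ((√l / (2 * Real.pi) : ℝ) : ℂ) *
    Complex.exp (-(Complex.I * ((signVal ε * l * (p.2 - q.2) : ℝ) : ℂ))) *
    ((hermiteFn n (√l * q.1) * hermiteFn n (√l * p.1) : ℝ) : ℂ)

/-- `[P_{λ,n,ε} f](x, u)` with `p = (x, u)`. -/
noncomputable def rayOp (l : ℝ) (n : ℕ) (ε : ℤˣ) (f : 𝓢(ℝ × ℝ, ℂ)) (p : ℝ × ℝ) : ℂ :=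
  ∫ q : ℝ × ℝ, rayKernel l n ε q p * f q

/-- `[P_{n,ε} f](x, u) = ∫_0^∞ [P_{λ,n,ε} f](x, u) dλ` with `p = (x, u)`. -/
noncomputable def rayProj (n : ℕ) (ε : ℤˣ) (f : 𝓢(ℝ × ℝ, ℂ)) (p : ℝ × ℝ) : ℂ :=
  ∫ l in Ioi (0 : ℝ), rayOp l n ε f p

/-! The functions w(x, u) = λ^{1/4} (2π)^{-1/2} e^{-iελu} hₙ(λ^{1/2} x) satisfy iU w = ελ w and G w
= (2n+1)λ w, and the kernel of P_{λ,n,ε} is the rank-one kernel w(p) conj(w(q)). Everything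
therefore follows from one unitary, `rayTransform`, which sends f to its coefficients ∫ conj(w) f in
L² of the parameters (ε, n, λ), with counting measure in (ε, n) and Lebesgue measure in λ > 0. It is
isometric by Plancherel in u and Parseval for the Hermite basis in x. It is onto because the wave
packets ∫ ψ(λ) w dλ, with ψ smooth and compactly supported in (0, ∞), are Schwartz functions with
coefficient ψ on one ray and 0 on the others.

Integration by parts shows that the operators on test functions are restrictions of multiplication
by ελ and (2n+1)λ. Their closures are the full multiplication operators: dividing ψ by c - i, with c
the multiplier, gives another admissible amplitude, so the range of the closure minus i contains all
wave packets and is dense (`isMultiplication_closure`, `eq_zero_of_inner_sub_I`). The quotient has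
multiplier ε(2n+1), and division of ψ by ελ is equally harmless.

A multiplication operator has the spectral measure given by indicators of preimages (`pullbackPVM`).
Uniqueness is proved by hand: if f lies in the range of F([c₀-r, c₀+r]), then ‖(A-c₀)ⁿ f‖ ≤ rⁿ ‖f‖,
whereas (A-c₀)ⁿ multiplies by at least ρⁿ in modulus where |c-c₀| ≥ ρ > r. Hence the transform of f
vanishes there. Rectangles then determine the joint measure, and it lives on the fan because all
parameter values do.

For the pointwise formula, (1+G)² f is still a Schwartz function, which makes the coefficients of f
integrable over all parameters (`lintegral_enorm_rayCoeff_lt_top`). The weighted L¹ norms of w are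
bounded uniformly in the parameters, so Fubini's theorem gives an inversion integral that converges
absolutely for almost every point. Splitting it into rays gives the unconditionally convergent
series. -/

set_option linter.unusedSectionVars false

/-! ### Bounded multiplication operators on L² -/

section MultiplicationOperators

variable {K : Type*} [MeasurableSpace K] {ν : Measure K}

theorem memLp_bounded_mul {m : K → ℂ} (hm : Measurable m) {C : ℝ} (hC : ∀ k, ‖m k‖ ≤ C)
    (g : Lp ℂ 2 ν) : MemLp (fun k => m k * g k) 2 ν :=
  (Lp.memLp g).of_le_mul (hm.aestronglyMeasurable.mul (Lp.aestronglyMeasurable g))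
    (c := C) (Filter.Eventually.of_forall fun k => by
      rw [norm_mul]; exact mul_le_mul_of_nonneg_right (hC k) (norm_nonneg _))

/-- Multiplication by the bounded measurable function `m` on `L²(ν)` (and `0` for other `m`). -/
noncomputable def mulLp (ν : Measure K) (m : K → ℂ) : Lp ℂ 2 ν →L[ℂ] Lp ℂ 2 ν :=
  open Classical in
  if h : Measurable m ∧ ∃ C : ℝ, ∀ k, ‖m k‖ ≤ C then
    LinearMap.mkContinuous
      { toFun := fun g => (memLp_bounded_mul h.1 h.2.choose_spec g).toLp _
        map_add' := fun f g => by
          rw [← MemLp.toLp_add, MemLp.toLp_eq_toLp_iff]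
          filter_upwards [Lp.coeFn_add f g] with k hk
          rw [Pi.add_apply, hk, Pi.add_apply, mul_add]
        map_smul' := fun a f => by
          rw [RingHom.id_apply, ← MemLp.toLp_const_smul, MemLp.toLp_eq_toLp_iff]
          filter_upwards [Lp.coeFn_smul a f] with k hk
          simp [hk]; ring }
      h.2.choose
      (fun g => by
        refine Lp.norm_le_mul_norm_of_ae_le_mul ?_
        filter_upwards [(memLp_bounded_mul h.1 h.2.choose_spec g).coeFn_toLp] with k hk
        simp only [LinearMap.coe_mk, AddHom.coe_mk, hk, norm_mul]
        exact mul_le_mul_of_nonneg_right (h.2.choose_spec k) (norm_nonneg _))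
  else 0

theorem coeFn_mulLp {m : K → ℂ} (hm : Measurable m) {C : ℝ} (hC : ∀ k, ‖m k‖ ≤ C)
    (g : Lp ℂ 2 ν) : mulLp ν m g =ᵐ[ν] fun k => m k * g k := by
  have h : Measurable m ∧ ∃ C : ℝ, ∀ k, ‖m k‖ ≤ C := ⟨hm, C, hC⟩
  rw [mulLp, dif_pos h]
  exact (memLp_bounded_mul h.1 h.2.choose_spec g).coeFn_toLp

theorem measurable_indicator_one {s : Set K} (hs : MeasurableSet s) :
    Measurable (s.indicator (1 : K → ℂ)) := measurable_one.indicator hs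

theorem norm_indicator_one_le (s : Set K) (k : K) : ‖s.indicator (1 : K → ℂ) k‖ ≤ 1 := by
  by_cases h : k ∈ s <;> simp [h]

theorem coeFn_mulLp_indicator {s : Set K} (hs : MeasurableSet s) (g : Lp ℂ 2 ν) :
    mulLp ν (s.indicator 1) g =ᵐ[ν] s.indicator g := by
  filter_upwards [coeFn_mulLp (measurable_indicator_one hs) (norm_indicator_one_le s) g] with k hk
  rw [hk]
  by_cases h : k ∈ s <;> simp [h]

theorem inner_mulLp {m : K → ℂ} (hm : Measurable m) {C : ℝ} (hC : ∀ k, ‖m k‖ ≤ C)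
    (f g : Lp ℂ 2 ν) : inner ℂ f (mulLp ν m g) = ∫ k, m k * inner ℂ (f k) (g k) ∂ν := by
  rw [L2.inner_def]
  refine integral_congr_ae ?_
  filter_upwards [coeFn_mulLp hm hC g] with k hk
  rw [hk]
  simp; ring

theorem mulLp_isSelfAdjoint {s : Set K} (hs : MeasurableSet s) :
    IsSelfAdjoint (mulLp ν (s.indicator 1)) := by
  rw [ContinuousLinearMap.isSelfAdjoint_iff_isSymmetric]
  intro f g
  simp only [ContinuousLinearMap.coe_coe]
  rw [inner_mulLp (measurable_indicator_one hs) (norm_indicator_one_le s), L2.inner_def]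
  refine integral_congr_ae ?_
  filter_upwards [coeFn_mulLp_indicator hs f] with k hk
  rw [hk]
  by_cases h : k ∈ s <;> simp [h]

theorem mulLp_inter {s t : Set K} (hs : MeasurableSet s) (ht : MeasurableSet t) :
    mulLp ν ((s ∩ t).indicator 1) = mulLp ν (s.indicator 1) * mulLp ν (t.indicator 1) := by
  ext1 g
  refine Lp.ext ?_
  filter_upwards [coeFn_mulLp_indicator (hs.inter ht) g,
    coeFn_mulLp_indicator hs (mulLp ν (t.indicator 1) g), coeFn_mulLp_indicator ht g]
    with k h1 h2 h3
  rw [h1, mul_apply_eq_comp, h2, ← indicator_indicator]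
  by_cases h : k ∈ s <;> simp [h, h3]

theorem mulLp_univ : mulLp ν ((univ : Set K).indicator 1) = 1 := by
  ext1 g
  refine Lp.ext ?_
  filter_upwards [coeFn_mulLp_indicator MeasurableSet.univ g] with k h1
  rw [h1]; simp

theorem norm_mulLp_indicator_sq {s : Set K} (hs : MeasurableSet s) (g : Lp ℂ 2 ν) :
    ENNReal.ofReal (‖mulLp ν (s.indicator 1) g‖ ^ 2) = ∫⁻ k in s, ‖g k‖ₑ ^ 2 ∂ν := by
  have h1 : ENNReal.ofReal (‖mulLp ν (s.indicator 1) g‖ ^ 2) =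
      eLpNorm (mulLp ν (s.indicator 1) g) 2 ν ^ 2 := by
    rw [ENNReal.ofReal_pow (norm_nonneg _), Lp.norm_def, ENNReal.ofReal_toReal (Lp.eLpNorm_ne_top _)]
  rw [h1, eLpNorm_congr_ae (coeFn_mulLp_indicator hs g), eLpNorm_indicator_eq_eLpNorm_restrict hs,
    eLpNorm_eq_lintegral_rpow_enorm_toReal (by norm_num) (by norm_num)]
  simp only [ENNReal.toReal_ofNat, one_div]
  rw [← ENNReal.rpow_natCast, ← ENNReal.rpow_mul]
  simp

theorem lintegral_enorm_sq_lt_top (g : Lp ℂ 2 ν) : ∫⁻ k, ‖g k‖ₑ ^ 2 ∂ν < ∞ := by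
  have := norm_mulLp_indicator_sq (MeasurableSet.univ) g
  rw [Measure.restrict_univ] at this
  rw [← this]; exact ENNReal.ofReal_lt_top

/-- The finite measure `‖g‖² ν`. -/
noncomputable def sqMeasure (g : Lp ℂ 2 ν) : Measure K := ν.withDensity fun k => ‖g k‖ₑ ^ 2

instance (g : Lp ℂ 2 ν) : IsFiniteMeasure (sqMeasure g) :=
  isFiniteMeasure_withDensity (lintegral_enorm_sq_lt_top g).ne

theorem sqMeasure_apply {s : Set K} (hs : MeasurableSet s) (g : Lp ℂ 2 ν) :
    sqMeasure g s = ENNReal.ofReal (‖mulLp ν (s.indicator 1) g‖ ^ 2) := by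
  rw [norm_mulLp_indicator_sq hs, sqMeasure, withDensity_apply _ hs]

theorem integral_sqMeasure {F : Type*} [NormedAddCommGroup F] [NormedSpace ℝ F]
    (g : Lp ℂ 2 ν) (φ : K → F) : ∫ k, φ k ∂(sqMeasure g) = ∫ k, (‖g k‖ ^ 2) • φ k ∂ν := by
  rw [sqMeasure, integral_withDensity_eq_integral_toReal_smul₀
    ((Lp.aestronglyMeasurable g).enorm.pow_const 2) (Filter.Eventually.of_forall fun k => by simp)]
  simp

theorem integrable_sqMeasure {F : Type*} [NormedAddCommGroup F] [NormedSpace ℝ F]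
    (g : Lp ℂ 2 ν) (φ : K → F) :
    Integrable φ (sqMeasure g) ↔ Integrable (fun k => (‖g k‖ ^ 2) • φ k) ν := by
  rw [sqMeasure, integrable_withDensity_iff_integrable_smul₀'
    ((Lp.aestronglyMeasurable g).enorm.pow_const 2) (Filter.Eventually.of_forall fun k => by simp)]
  simp

end MultiplicationOperators

/-! ### Projection-valued measures from multiplication operators -/

section Pullback

variable {K : Type*} [MeasurableSpace K] {ν : Measure K}
  {H : Type*} [NormedAddCommGroup H] [InnerProductSpace ℂ H] [CompleteSpace H]
  (W : H ≃ₗᵢ[ℂ] Lp ℂ 2 ν)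

/-- The bounded operator on `H` that corresponds to multiplication by `m` under `W`. -/
noncomputable def mulOp (m : K → ℂ) : H →L[ℂ] H :=
  (W.symm : Lp ℂ 2 ν →L[ℂ] H) ∘L mulLp ν m ∘L (W : H →L[ℂ] Lp ℂ 2 ν)

theorem map_mulOp (m : K → ℂ) (f : H) : W (mulOp W m f) = mulLp ν m (W f) := by
  simp [mulOp]

theorem mulOp_inter {s t : Set K} (hs : MeasurableSet s) (ht : MeasurableSet t) :
    mulOp W ((s ∩ t).indicator 1) = mulOp W (s.indicator 1) * mulOp W (t.indicator 1) := by
  ext1 f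
  apply W.injective
  simp only [mul_apply_eq_comp, map_mulOp, mulLp_inter hs ht]

theorem mulOp_univ : mulOp W ((univ : Set K).indicator 1) = 1 := by
  ext1 f
  apply W.injective
  simp only [map_mulOp, mulLp_univ, one_apply_eq_self]

theorem mulOp_isStarProjection {s : Set K} (hs : MeasurableSet s) :
    IsStarProjection (mulOp W (s.indicator 1)) where
  isIdempotentElem := by
    rw [IsIdempotentElem, ← mulOp_inter W hs hs, inter_self]
  isSelfAdjoint := by
    rw [ContinuousLinearMap.isSelfAdjoint_iff_isSymmetric]
    intro f g
    have h := (ContinuousLinearMap.isSelfAdjoint_iff_isSymmetric.mp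
      (mulLp_isSelfAdjoint (ν := ν) hs)) (W f) (W g)
    simp only [ContinuousLinearMap.coe_coe] at h ⊢
    rw [← W.inner_map_map, ← W.inner_map_map f, map_mulOp, map_mulOp, h]

theorem norm_mulOp_sq {s : Set K} (hs : MeasurableSet s) (f : H) :
    ‖mulOp W (s.indicator 1) f‖ ^ 2 = (sqMeasure (W f)).real s := by
  rw [← W.norm_map, map_mulOp, measureReal_def, sqMeasure_apply hs,
    ENNReal.toReal_ofReal (by positivity)]

theorem mulOp_union {s t : Set K} (hs : MeasurableSet s) (ht : MeasurableSet t)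
    (hd : Disjoint s t) :
    mulOp W ((s ∪ t).indicator 1) = mulOp W (s.indicator 1) + mulOp W (t.indicator 1) := by
  ext1 f
  apply W.injective
  rw [add_apply, map_add, map_mulOp, map_mulOp, map_mulOp]
  refine Lp.ext ?_
  filter_upwards [coeFn_mulLp_indicator (hs.union ht) (W f), coeFn_mulLp_indicator hs (W f),
    coeFn_mulLp_indicator ht (W f), Lp.coeFn_add (mulLp ν (s.indicator 1) (W f))
      (mulLp ν (t.indicator 1) (W f))] with k h1 h2 h3 h4
  rw [h1, h4, Pi.add_apply, h2, h3, indicator_union_of_disjoint hd]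

theorem mulOp_biUnion {s : ℕ → Set K} (hs : ∀ n, MeasurableSet (s n))
    (hd : Pairwise (Function.onFun Disjoint s)) (F : Finset ℕ) (f : H) :
    mulOp W ((⋃ n ∈ F, s n).indicator 1) f = ∑ n ∈ F, mulOp W ((s n).indicator 1) f := by
  classical
  induction F using Finset.induction_on with
  | empty =>
    have h : ‖mulOp W ((∅ : Set K).indicator 1) f‖ ^ 2 = 0 := by
      rw [norm_mulOp_sq W MeasurableSet.empty]; simp
    simpa using h
  | insert a F ha ih =>
    rw [Finset.sum_insert ha, ← ih, Finset.set_biUnion_insert,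
      mulOp_union W (hs a) (F.measurableSet_biUnion fun n _ => hs n)]
    · rfl
    · rw [disjoint_iUnion₂_right]
      exact fun n hn => hd (fun h => ha (h ▸ hn))

/-- The squared norm of the remainder is the mass that the finite measure |Wf|² ν gives to the sets
not yet summed, so strong convergence reduces to countable additivity of that scalar measure. -/
theorem hasSum_mulOp {s : ℕ → Set K} (hs : ∀ n, MeasurableSet (s n))
    (hd : Pairwise (Function.onFun Disjoint s)) (f : H) :
    HasSum (fun n => mulOp W ((s n).indicator 1) f) (mulOp W ((⋃ n, s n).indicator 1) f) := by
  have hU := MeasurableSet.iUnion hs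
  have hF (F : Finset ℕ) : MeasurableSet (⋃ n ∈ F, s n) := F.measurableSet_biUnion fun n _ => hs n
  have hsub (F : Finset ℕ) : (⋃ n ∈ F, s n) ⊆ ⋃ n, s n := iUnion₂_subset fun n _ =>
    subset_iUnion s n
  have key (F : Finset ℕ) : ‖(∑ n ∈ F, mulOp W ((s n).indicator 1) f) -
      mulOp W ((⋃ n, s n).indicator 1) f‖ ^ 2 =
      (sqMeasure (W f)).real (⋃ n, s n) - ∑ n ∈ F, (sqMeasure (W f)).real (s n) := by
    have h1 : mulOp W ((⋃ n, s n).indicator 1) f = mulOp W ((⋃ n ∈ F, s n).indicator 1) f +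
        mulOp W (((⋃ n, s n) \ ⋃ n ∈ F, s n).indicator 1) f := by
      rw [← add_apply, ← mulOp_union W (hF F) (hU.diff (hF F))
        disjoint_sdiff_right, union_sdiff_cancel (hsub F)]
    rw [h1, ← mulOp_biUnion W hs hd, sub_add_cancel_left, norm_neg,
      norm_mulOp_sq W (hU.diff (hF F)), measureReal_sdiff (hsub F) (hF F),
      measureReal_biUnion_finset (fun i _ j _ hij => hd hij) (fun n _ => hs n)]
  have hlim : HasSum (fun n => (sqMeasure (W f)).real (s n)) ((sqMeasure (W f)).real (⋃ n, s n)) := by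
    have h := measure_iUnion (μ := sqMeasure (W f)) hd hs
    have h' : ∑' n, sqMeasure (W f) (s n) ≠ ∞ := h ▸ measure_ne_top _ _
    simp only [measureReal_def]
    rw [h, ENNReal.tsum_toReal_eq (ENNReal.ne_top_of_tsum_ne_top h')]
    exact ENNReal.hasSum_toReal h'
  rw [HasSum, tendsto_iff_norm_sub_tendsto_zero]
  have h2 : Filter.Tendsto (fun F : Finset ℕ => ‖(∑ n ∈ F, mulOp W ((s n).indicator 1) f) -
      mulOp W ((⋃ n, s n).indicator 1) f‖ ^ 2) Filter.atTop (nhds 0) := by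
    simp only [key]
    have := (tendsto_const_nhds (x := (sqMeasure (W f)).real (⋃ n, s n))
      (f := Filter.atTop)).sub hlim
    simpa using this
  have h3 := h2.sqrt
  simpa using h3

/-- The projection-valued measure of indicator functions of `a`, transported by `W`. -/
noncomputable def pullbackPVM {X : Type*} [MeasurableSpace X] {a : K → X} (ha : Measurable a) :
    ProjMeasure X H where
  proj s := mulOp W ((a ⁻¹' s).indicator 1)
  isStarProjection_proj s hs := mulOp_isStarProjection W (ha hs)
  proj_univ := by rw [preimage_univ, mulOp_univ]
  proj_inter s t hs ht := by rw [preimage_inter, mulOp_inter W (ha hs) (ha ht)]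
  hasSum_proj s hs hd f := by
    rw [preimage_iUnion]
    exact hasSum_mulOp W (fun n => ha (hs n)) (fun i j hij => (hd hij).preimage a) f

end Pullback

/-! ### Spectral integrals in the multiplication model -/

section PullbackSpectral

variable {K : Type*} [MeasurableSpace K] {ν : Measure K}
  {H : Type*} [NormedAddCommGroup H] [InnerProductSpace ℂ H] [CompleteSpace H]
  (W : H ≃ₗᵢ[ℂ] Lp ℂ 2 ν) {X : Type*} [MeasurableSpace X]

theorem scalarMeasure_pullbackPVM {a : K → X} (ha : Measurable a) (f : H) :
    (pullbackPVM W ha).scalarMeasure f = (sqMeasure (W f)).map a := by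
  ext s hs
  rw [ProjMeasure.scalarMeasure_apply _ _ hs, Measure.map_apply ha hs, sqMeasure_apply (ha hs),
    ← map_mulOp, W.norm_map]
  rfl

theorem pullbackPVM_isIntegral {a : K → X} (ha : Measurable a) {m : X → ℂ} (hm : Measurable m)
    {C : ℝ} (hC : ∀ x, ‖m x‖ ≤ C) : (pullbackPVM W ha).IsIntegral m (mulOp W (m ∘ a)) := by
  intro f
  rw [scalarMeasure_pullbackPVM, integral_map ha.aemeasurable hm.aestronglyMeasurable,
    integral_sqMeasure, ← W.inner_map_map, map_mulOp,
    inner_mulLp (hm.comp ha) (fun k => hC (a k))]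
  refine integral_congr_ae (Filter.Eventually.of_forall fun k => ?_)
  simp only [Function.comp_apply, inner_self_eq_norm_sq_to_K, Complex.real_smul]
  push_cast
  exact mul_comm _ _

/-- `A` corresponds under `W` to the (unbounded) operator of multiplication by `c`. -/
def IsMultiplication (c : K → ℝ) (A : H →ₗ.[ℂ] H) : Prop :=
  ∀ f g : H, (f, g) ∈ A.graph ↔ W g =ᵐ[ν] fun k => (c k : ℂ) * W f k

variable {W}

theorem IsMultiplication.apply {c : K → ℝ} {A : H →ₗ.[ℂ] H} (h : IsMultiplication W c A)
    (f : A.domain) : W (A f) =ᵐ[ν] fun k => (c k : ℂ) * W f k :=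
  (h f (A f)).1 (A.mem_graph f)

theorem aestronglyMeasurable_ofReal_mul {c : K → ℝ} (hc : Measurable c) (g : Lp ℂ 2 ν) :
    AEStronglyMeasurable (fun k => (c k : ℂ) * g k) ν :=
  (Complex.measurable_ofReal.comp hc).aestronglyMeasurable.mul (Lp.aestronglyMeasurable g)

theorem IsMultiplication.mem_domain_iff {c : K → ℝ} {A : H →ₗ.[ℂ] H} (h : IsMultiplication W c A)
    (f : H) : f ∈ A.domain ↔ MemLp (fun k => (c k : ℂ) * W f k) 2 ν := by
  rw [LinearPMap.mem_domain_iff]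
  constructor
  · rintro ⟨g, hg⟩
    exact (memLp_congr_ae ((h f g).1 hg)).1 (Lp.memLp _)
  · intro hf
    refine ⟨W.symm (hf.toLp _), (h _ _).2 ?_⟩
    rw [W.apply_symm_apply]
    exact hf.coeFn_toLp

/-- The scalar measure of f is the image of |Wf|² ν under a. The domain condition becomes b(a)·Wf ∈
L², which is the maximal domain of multiplication by b ∘ a. -/
theorem IsMultiplication.isResolution {b : X → ℝ} (hb : Measurable b) {a : K → X}
    (ha : Measurable a) {A : H →ₗ.[ℂ] H} (h : IsMultiplication W (b ∘ a) A) :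
    (pullbackPVM W ha).IsResolution b A := by
  constructor
  · intro f
    rw [h.mem_domain_iff, scalarMeasure_pullbackPVM,
      integrable_map_measure (hb.pow_const 2).aestronglyMeasurable ha.aemeasurable,
      integrable_sqMeasure,
      memLp_two_iff_integrable_sq_norm (aestronglyMeasurable_ofReal_mul (hb.comp ha) _)]
    refine integrable_congr (Filter.Eventually.of_forall fun k => ?_)
    simp only [Function.comp_apply, norm_mul, Complex.norm_real, smul_eq_mul, mul_pow,
      Real.norm_eq_abs, sq_abs]
    ring
  · intro f
    rw [scalarMeasure_pullbackPVM, integral_map ha.aemeasurable hb.aestronglyMeasurable,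
      integral_sqMeasure, ← W.inner_map_map, L2.inner_def, ← integral_complex_ofReal]
    refine integral_congr_ae ?_
    filter_upwards [h.apply f] with k hk
    rw [hk]
    simp only [Function.comp_apply, RCLike.inner_apply, smul_eq_mul]
    push_cast
    rw [mul_assoc, Complex.mul_conj, Complex.normSq_eq_norm_sq]
    push_cast
    ring

end PullbackSpectral

/-! ### General properties of projection-valued measures -/

namespace ProjMeasure

variable {H : Type*} [NormedAddCommGroup H] [InnerProductSpace ℂ H] [CompleteSpace H]
  {X : Type*} [MeasurableSpace X]

theorem proj_proj (E : ProjMeasure X H) {s t : Set X} (hs : MeasurableSet s)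
    (ht : MeasurableSet t) (f : H) : E.proj s (E.proj t f) = E.proj (s ∩ t) f := by
  rw [E.proj_inter s t hs ht]; rfl

/-- Countable additivity applied to s, t, ∅, ∅, … -/
theorem proj_union (E : ProjMeasure X H) {s t : Set X} (hs : MeasurableSet s)
    (ht : MeasurableSet t) (hd : Disjoint s t) (f : H) :
    E.proj (s ∪ t) f = E.proj s f + E.proj t f := by
  let u : ℕ → Set X := fun n => if n = 0 then s else if n = 1 then t else ∅
  have hu : ∀ n, MeasurableSet (u n) := fun n => by
    simp only [u]; split_ifs <;> simp [hs, ht]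
  have hU : ⋃ n, u n = s ∪ t := by
    ext x
    simp only [u, mem_iUnion, mem_union]
    constructor
    · rintro ⟨n, hn⟩
      split_ifs at hn
      exacts [Or.inl hn, Or.inr hn, hn.elim]
    · rintro (h | h)
      exacts [⟨0, by simpa using h⟩, ⟨1, by simpa using h⟩]
  have hdis : Pairwise (Function.onFun Disjoint u) := by
    intro i j hij
    simp only [Function.onFun, u]
    split_ifs <;> simp_all [hd.symm]
  have h1 := E.hasSum_proj u hu hdis f
  rw [hU] at h1
  have h2 : HasSum (fun n => E.proj (u n) f) (∑ n ∈ Finset.range 2, E.proj (u n) f) := by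
    refine hasSum_sum_of_ne_finset_zero fun n hn => ?_
    have : u n = ∅ := by
      simp only [Finset.mem_range, not_lt] at hn
      simp only [u]; rw [if_neg (by omega), if_neg (by omega)]
    rw [this, E.proj_empty_apply]
  rw [h1.unique h2, Finset.sum_range_succ, Finset.sum_range_one]
  simp [u]

theorem proj_compl (E : ProjMeasure X H) {s : Set X} (hs : MeasurableSet s) (f : H) :
    E.proj sᶜ f = f - E.proj s f := by
  have h := E.proj_union hs hs.compl disjoint_compl_right f
  rw [union_compl_self, E.proj_univ, one_apply_eq_self] at h
  rw [eq_sub_iff_add_eq', ← h]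

theorem inner_proj_left (E : ProjMeasure X H) {s : Set X} (hs : MeasurableSet s) (f g : H) :
    inner ℂ (E.proj s f) g = inner ℂ f (E.proj s g) := by
  have h := (E.isStarProjection_proj s hs).isSelfAdjoint
  exact ContinuousLinearMap.isSelfAdjoint_iff_isSymmetric.mp h f g

theorem scalarMeasure_univ (E : ProjMeasure X H) (f : H) :
    E.scalarMeasure f univ = ENNReal.ofReal (‖f‖ ^ 2) := by
  rw [E.scalarMeasure_apply f MeasurableSet.univ, E.proj_univ]; rfl

instance (E : ProjMeasure X H) (f : H) : IsFiniteMeasure (E.scalarMeasure f) :=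
  ⟨by rw [E.scalarMeasure_univ]; exact ENNReal.ofReal_lt_top⟩

theorem scalarMeasure_eq_of_proj_eq (E F : ProjMeasure X H)
    (h : ∀ s, MeasurableSet s → E.proj s = F.proj s) (f : H) :
    E.scalarMeasure f = F.scalarMeasure f := by
  ext s hs
  rw [E.scalarMeasure_apply f hs, F.scalarMeasure_apply f hs, h s hs]

/-- Two projection-valued measures that agree on a generating `π`-system agree. -/
theorem proj_eq_of_generateFrom (E F : ProjMeasure X H) {C : Set (Set X)}
    (hC : ‹MeasurableSpace X› = MeasurableSpace.generateFrom C) (hpi : IsPiSystem C)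
    (h : ∀ s ∈ C, E.proj s = F.proj s) {s : Set X} (hs : MeasurableSet s) :
    E.proj s = F.proj s := by
  induction s, hs using MeasurableSpace.induction_on_inter hC hpi with
  | empty => ext1 f; rw [E.proj_empty_apply, F.proj_empty_apply]
  | basic t ht => exact h t ht
  | compl t ht ih => ext1 f; rw [E.proj_compl ht, F.proj_compl ht, ih]
  | iUnion g hd hg ih =>
    ext1 f
    refine (E.hasSum_proj g hg hd f).unique ?_
    simp only [ih]
    exact F.hasSum_proj g hg hd f

/-- The image of a projection-valued measure under a measurable map. -/
noncomputable def map {Y : Type*} [MeasurableSpace Y] (E : ProjMeasure X H) {b : X → Y}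
    (hb : Measurable b) : ProjMeasure Y H where
  proj s := E.proj (b ⁻¹' s)
  isStarProjection_proj s hs := E.isStarProjection_proj _ (hb hs)
  proj_univ := by rw [preimage_univ, E.proj_univ]
  proj_inter s t hs ht := by rw [preimage_inter, E.proj_inter _ _ (hb hs) (hb ht)]
  hasSum_proj s hs hd f := by
    rw [preimage_iUnion]
    exact E.hasSum_proj _ (fun n => hb (hs n)) (fun i j hij => (hd hij).preimage b) f

theorem scalarMeasure_map {Y : Type*} [MeasurableSpace Y] (E : ProjMeasure X H) {b : X → Y}
    (hb : Measurable b) (f : H) : (E.map hb).scalarMeasure f = (E.scalarMeasure f).map b := by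
  ext s hs
  rw [scalarMeasure_apply _ _ hs, Measure.map_apply hb hs, scalarMeasure_apply _ _ (hb hs)]
  rfl

theorem IsResolution.map {E : ProjMeasure X H} {b : X → ℝ} (hb : Measurable b)
    {A : H →ₗ.[ℂ] H} (h : E.IsResolution b A) : IsSpectralMeasure A (E.map hb) := by
  constructor
  · intro f
    change _ ↔ Integrable (fun x : ℝ => x ^ 2) _
    rw [h.1, scalarMeasure_map,
      integrable_map_measure (measurable_id'.pow_const 2).aestronglyMeasurable hb.aemeasurable]
    rfl
  · intro f
    change _ = ((∫ x : ℝ, x ∂_ : ℝ) : ℂ)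
    rw [h.2, scalarMeasure_map, integral_map hb.aemeasurable measurable_id'.aestronglyMeasurable]

theorem tendsto_proj_iUnion (E : ProjMeasure X H) {s : ℕ → Set X} (hs : ∀ n, MeasurableSet (s n))
    (hm : Monotone s) (f : H) :
    Filter.Tendsto (fun n => E.proj (s n) f) Filter.atTop (nhds (E.proj (⋃ n, s n) f)) := by
  have h := E.hasSum_proj (disjointed s) (fun n => MeasurableSet.disjointed hs n)
    (disjoint_disjointed s) f
  rw [iUnion_disjointed] at h
  have h1 := (Filter.tendsto_add_atTop_iff_nat 1).2 h.tendsto_sum_nat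
  refine h1.congr fun n => ?_
  induction n with
  | zero => simp
  | succ n ih =>
    have hd : disjointed s (n + 1) = s (n + 1) \ s n := hm.disjointed_succ (not_isMax n)
    rw [Finset.sum_range_succ, ih, hd, ← E.proj_union (hs n)
      ((hs (n + 1)).diff (hs n)) disjoint_sdiff_right, union_sdiff_cancel (hm n.le_succ)]

end ProjMeasure

/-! ### Consequences of the quadratic-form definition of a spectral measure -/

namespace IsSpectralMeasure

variable {H : Type*} [NormedAddCommGroup H] [InnerProductSpace ℂ H] [CompleteSpace H]
  {A : H →ₗ.[ℂ] H} {F : ProjMeasure ℝ H}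

theorem integrable_id (hF : IsSpectralMeasure A F) {f : H} (hf : f ∈ A.domain) :
    Integrable (fun t : ℝ => t) (F.scalarMeasure f) := by
  have h := (hF.1 f).1 hf
  exact ((memLp_two_iff_integrable_sq measurable_id'.aestronglyMeasurable).2 h).integrable
    one_le_two

theorem ae_mem {S : Set ℝ} (hS : MeasurableSet S) {f : H} (hf : F.proj S f = f) :
    ∀ᵐ t ∂F.scalarMeasure f, t ∈ S := by
  rw [ae_iff]
  change F.scalarMeasure f Sᶜ = 0
  rw [F.scalarMeasure_apply f hS.compl, F.proj_compl hS, hf]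
  simp

theorem mem_domain (hF : IsSpectralMeasure A F) {S : Set ℝ} (hS : MeasurableSet S) {B : ℝ}
    (hB : ∀ t ∈ S, |t| ≤ B) {f : H} (hf : F.proj S f = f) : f ∈ A.domain := by
  refine (hF.1 f).2 (Integrable.of_bound (C := B ^ 2)
    (measurable_id'.pow_const 2).aestronglyMeasurable ?_)
  filter_upwards [ae_mem hS hf] with t ht
  rw [Real.norm_eq_abs, abs_pow]
  exact pow_le_pow_left₀ (abs_nonneg t) (hB t ht) 2

/-- Since E(s) commutes with E(S), the vectors E(s)f and E(s)g are orthogonal, and Pythagoras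
applies. -/
theorem _root_.ProjMeasure.scalarMeasure_add {X : Type*} [MeasurableSpace X] (E : ProjMeasure X H)
    {S : Set X} (hS : MeasurableSet S) {f g : H} (hf : E.proj S f = f) (hg : E.proj S g = 0) :
    E.scalarMeasure (f + g) = E.scalarMeasure f + E.scalarMeasure g := by
  ext s hs
  rw [Measure.add_apply, E.scalarMeasure_apply _ hs, E.scalarMeasure_apply _ hs,
    E.scalarMeasure_apply _ hs, ← ENNReal.ofReal_add (by positivity) (by positivity), map_add]
  congr 1
  have h : inner ℂ (E.proj s f) (E.proj s g) = 0 := by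
    rw [E.inner_proj_left hs, E.proj_proj hs hs, inter_self, ← hf, E.inner_proj_left hS,
      E.proj_proj hS hs, inter_comm, ← E.proj_proj hs hS, hg, map_zero, inner_zero_right]
  have := norm_add_sq_eq_norm_sq_add_norm_sq_of_inner_eq_zero _ _ h
  rw [sq, sq, sq, this]

/-- The quadratic form of A is additive on f + g because the scalar measures add. Expanding it
leaves only the cross terms. -/
theorem inner_apply_add (hF : IsSpectralMeasure A F) {S : Set ℝ} (hS : MeasurableSet S)
    (f g : A.domain) (hf : F.proj S f = f) (hg : F.proj S g = 0) :
    inner ℂ (f : H) (A g) + inner ℂ (g : H) (A f) = 0 := by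
  have h1 := hF.2 (f + g)
  have h2 : (∫ t : ℝ, t ∂F.scalarMeasure ((f + g : A.domain) : H)) =
      (∫ t : ℝ, t ∂F.scalarMeasure (f : H)) + ∫ t : ℝ, t ∂F.scalarMeasure (g : H) := by
    rw [Submodule.coe_add, F.scalarMeasure_add hS hf hg, integral_add_measure]
    exacts [hF.integrable_id f.2, hF.integrable_id g.2]
  rw [h2, Complex.ofReal_add, ← hF.2 f, ← hF.2 g, A.map_add, Submodule.coe_add, inner_add_left,
    inner_add_right, inner_add_right] at h1
  linear_combination h1

/-- Replacing g by i g changes the relative sign of the two cross terms, so each of them vanishes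
separately. -/
theorem inner_apply_eq_zero (hF : IsSpectralMeasure A F) {S : Set ℝ} (hS : MeasurableSet S)
    (f g : A.domain) (hf : F.proj S f = f) (hg : F.proj S g = 0) :
    inner ℂ (g : H) (A f) = 0 := by
  have h1 := hF.inner_apply_add hS f g hf hg
  have h2 := hF.inner_apply_add hS f (Complex.I • g) hf (by simp [hg])
  rw [A.map_smul, Submodule.coe_smul, inner_smul_left, inner_smul_right, Complex.conj_I] at h2
  have h3 : Complex.I * (2 * inner ℂ (g : H) (A f)) = 0 := by
    linear_combination Complex.I * h1 - h2
  simpa using h3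

/-- The range of F(S) is invariant under A. The vectors F([-N, N] ∩ Sᶜ)h lie in the domain and are
orthogonal to A f by the previous lemma; as N → ∞ they tend to F(Sᶜ)h for arbitrary h. -/
theorem proj_apply (hF : IsSpectralMeasure A F) {S : Set ℝ} (hS : MeasurableSet S)
    (f : A.domain) (hf : F.proj S f = f) : F.proj S (A f) = A f := by
  have hI (N : ℕ) : MeasurableSet (Icc (-(N : ℝ)) N ∩ Sᶜ) := measurableSet_Icc.inter hS.compl
  have hU : ⋃ N : ℕ, Icc (-(N : ℝ)) N ∩ Sᶜ = Sᶜ := by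
    rw [← iUnion_inter]
    refine inter_eq_right.2 fun t _ => mem_iUnion.2 ?_
    obtain ⟨N, hN⟩ := exists_nat_ge |t|
    exact ⟨N, abs_le.1 hN⟩
  have hmono : Monotone fun N : ℕ => Icc (-(N : ℝ)) N ∩ Sᶜ := fun M N hMN =>
    inter_subset_inter_left _ (Icc_subset_Icc (by simpa using hMN) (by simpa using hMN))
  have key (h : H) : inner ℂ (F.proj Sᶜ h) (A f) = 0 := by
    have hlim := F.tendsto_proj_iUnion hI hmono h
    rw [hU] at hlim
    have hlim2 := hlim.inner (𝕜 := ℂ) (tendsto_const_nhds (x := A f))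
    refine tendsto_nhds_unique hlim2 (tendsto_const_nhds.congr fun N => ?_)
    symm
    have hd : F.proj (Icc (-(N : ℝ)) N ∩ Sᶜ) h ∈ A.domain :=
      hF.mem_domain (hI N) (B := N) (fun t ht => abs_le.2 ht.1)
        (by rw [F.proj_proj (hI N) (hI N), inter_self])
    refine hF.inner_apply_eq_zero hS f ⟨_, hd⟩ hf ?_
    rw [F.proj_proj hS (hI N), inter_comm, inter_assoc, compl_inter_self, inter_empty,
      F.proj_empty_apply]
  have h0 : F.proj Sᶜ (A f) = 0 := by
    refine ext_inner_left ℂ fun h => ?_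
    rw [← F.inner_proj_left hS.compl, key, inner_zero_right]
  rw [F.proj_compl hS, sub_eq_zero] at h0
  exact h0.symm

theorem abs_inner_le (hF : IsSpectralMeasure A F) {c r : ℝ} (f : A.domain)
    (hf : F.proj (Icc (c - r) (c + r)) f = f) :
    |(inner ℂ (f : H) (A f - (c : ℂ) • (f : H))).re| ≤ r * ‖(f : H)‖ ^ 2 := by
  have hm : (F.scalarMeasure (f : H)).real univ = ‖(f : H)‖ ^ 2 := by
    rw [measureReal_def, F.scalarMeasure_univ, ENNReal.toReal_ofReal (by positivity)]
  have h1 : (inner ℂ (f : H) (A f - (c : ℂ) • (f : H))).re =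
      ∫ t : ℝ, (t - c) ∂F.scalarMeasure (f : H) := by
    rw [integral_sub (hF.integrable_id f.2) (integrable_const _), inner_sub_right, hF.2 f,
      inner_smul_right, inner_self_eq_norm_sq_to_K, integral_const, hm, smul_eq_mul]
    rw [Complex.sub_re, Complex.ofReal_re, ← RCLike.ofReal_pow, mul_comm (c : ℂ)]
    exact congrArg (_ - ·) ((Complex.re_mul_ofReal _ c).trans (by rw [RCLike.ofReal_pow]; norm_cast))
  rw [h1, ← hm, ← Real.norm_eq_abs]
  refine norm_integral_le_of_norm_le_const ?_
  filter_upwards [ae_mem measurableSet_Icc hf] with t ht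
  rw [Real.norm_eq_abs, abs_le]
  constructor <;> linarith [ht.1, ht.2]

/-- A symmetric operator whose quadratic form is bounded by r has norm at most r. The form is
compared at f + g and f - g, and the sum of squared norms is evaluated by the parallelogram law. -/
theorem norm_apply_sub_le (hF : IsSpectralMeasure A F) (hA : A.IsFormalAdjoint A) {c r : ℝ}
    (hr : 0 < r) (f : A.domain) (hf : F.proj (Icc (c - r) (c + r)) f = f) :
    ‖A f - (c : ℂ) • (f : H)‖ ≤ r * ‖(f : H)‖ := by
  have hS : MeasurableSet (Icc (c - r) (c + r)) := measurableSet_Icc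
  have hB : ∀ t ∈ Icc (c - r) (c + r), |t| ≤ |c| + r := fun t ht => by
    have h1 : |t - c| ≤ r := abs_le.2 ⟨by linarith [ht.1], by linarith [ht.2]⟩
    have h2 := abs_add_le c (t - c)
    rw [add_sub_cancel] at h2
    linarith
  set Bf := A f - (c : ℂ) • (f : H) with hBf
  have hg : F.proj (Icc (c - r) (c + r)) Bf = Bf := by
    rw [hBf, map_sub, map_smul, hf, hF.proj_apply hS f hf]
  have hgd : Bf ∈ A.domain := hF.mem_domain hS hB hg
  -- The factor r⁻¹ makes the cross term r⁻¹‖Bf‖² absorb half of itself from the right-hand side,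
  -- which leaves exactly ‖Bf‖² ≤ r²‖f‖².
  let g : A.domain := ((r⁻¹ : ℝ) : ℂ) • ⟨Bf, hgd⟩
  have hgS : F.proj (Icc (c - r) (c + r)) g = g := by
    simp only [g, Submodule.coe_smul, map_smul, hg]
  have h1 := hF.abs_inner_le (f + g) (by rw [Submodule.coe_add, map_add, hf, hgS])
  have h2 := hF.abs_inner_le (f - g) (by rw [Submodule.coe_sub, map_sub, hf, hgS])
  have h3 : (inner ℂ ((f + g : A.domain) : H) (A (f + g) - (c : ℂ) • ((f + g : A.domain) : H))).re -
      (inner ℂ ((f - g : A.domain) : H) (A (f - g) - (c : ℂ) • ((f - g : A.domain) : H))).re =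
      4 * (r⁻¹ * ‖Bf‖ ^ 2) := by
    have e1 : inner ℂ (g : H) Bf = ((r⁻¹ * ‖Bf‖ ^ 2 : ℝ) : ℂ) := by
      simp only [g, Submodule.coe_smul, inner_smul_left, Complex.conj_ofReal,
        inner_self_eq_norm_sq_to_K]
      push_cast; rfl
    have e2 : inner ℂ (f : H) (A g - (c : ℂ) • (g : H)) = ((r⁻¹ * ‖Bf‖ ^ 2 : ℝ) : ℂ) := by
      have hs := hA g f
      have : inner ℂ (f : H) (A g) = inner ℂ (A f) (g : H) := by
        rw [← inner_conj_symm, hs, inner_conj_symm]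
      rw [inner_sub_right, this, inner_smul_right]
      have e3 : inner ℂ Bf (g : H) = inner ℂ (A f) (g : H) - (c : ℂ) * inner ℂ (f : H) (g : H) := by
        rw [hBf, inner_sub_left, inner_smul_left, Complex.conj_ofReal]
      rw [← e3, ← inner_conj_symm, e1, Complex.conj_ofReal]
    have e4 : A (f + g) - (c : ℂ) • ((f + g : A.domain) : H) = Bf + (A g - (c : ℂ) • (g : H)) := by
      rw [A.map_add, Submodule.coe_add, smul_add, hBf]; abel
    have e5 : A (f - g) - (c : ℂ) • ((f - g : A.domain) : H) = Bf - (A g - (c : ℂ) • (g : H)) := by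
      rw [A.map_sub, Submodule.coe_sub, smul_sub, hBf]; abel
    have gen (x y v w : H) : (inner ℂ (x + y) (v + w)).re - (inner ℂ (x - y) (v - w)).re =
        2 * ((inner ℂ x w).re + (inner ℂ y v).re) := by
      simp only [inner_add_left, inner_sub_left, inner_add_right, inner_sub_right, Complex.add_re,
        Complex.sub_re]
      ring
    rw [e4, e5, Submodule.coe_add, Submodule.coe_sub, gen, e1, e2, Complex.ofReal_re]
    ring
  have hgn : ‖(g : H)‖ ^ 2 = r⁻¹ ^ 2 * ‖Bf‖ ^ 2 := by
    simp only [g, Submodule.coe_smul, norm_smul, Complex.norm_real, mul_pow, Real.norm_eq_abs,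
      sq_abs]
  have h4 : ‖((f + g : A.domain) : H)‖ ^ 2 + ‖((f - g : A.domain) : H)‖ ^ 2 =
      2 * (‖(f : H)‖ ^ 2 + r⁻¹ ^ 2 * ‖Bf‖ ^ 2) := by
    have := parallelogram_law_with_norm ℂ (f : H) (g : H)
    rw [Submodule.coe_add, Submodule.coe_sub, ← hgn]
    linarith
  have h5 : 4 * (r⁻¹ * ‖Bf‖ ^ 2) ≤ r * (2 * (‖(f : H)‖ ^ 2 + r⁻¹ ^ 2 * ‖Bf‖ ^ 2)) := by
    rw [← h3, ← h4]
    linarith [(abs_le.1 h1).2, (abs_le.1 h2).1]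
  have h6 : ‖Bf‖ ^ 2 ≤ (r * ‖(f : H)‖) ^ 2 := by
    have e : r * (2 * (‖(f : H)‖ ^ 2 + r⁻¹ ^ 2 * ‖Bf‖ ^ 2)) =
        2 * r * ‖(f : H)‖ ^ 2 + 2 * (r⁻¹ * ‖Bf‖ ^ 2) := by field_simp
    rw [e] at h5
    have h7 : r⁻¹ * ‖Bf‖ ^ 2 ≤ r * ‖(f : H)‖ ^ 2 := by linarith
    rw [inv_mul_le_iff₀ hr] at h7
    linarith
  exact le_of_sq_le_sq h6 (by positivity)

end IsSpectralMeasure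

/-! ### Uniqueness of the spectral measure of a multiplication operator -/

section Uniqueness

variable {K : Type*} [MeasurableSpace K] {ν : Measure K}
  {H : Type*} [NormedAddCommGroup H] [InnerProductSpace ℂ H] [CompleteSpace H]
  {W : H ≃ₗᵢ[ℂ] Lp ℂ 2 ν} {A : H →ₗ.[ℂ] H} {F : ProjMeasure ℝ H} {c : K → ℝ}

theorem IsMultiplication.isFormalAdjoint (h : IsMultiplication W c A) : A.IsFormalAdjoint A := by
  intro f g
  rw [← W.inner_map_map, ← W.inner_map_map, L2.inner_def, L2.inner_def]
  refine integral_congr_ae ?_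
  filter_upwards [h.apply f, h.apply g] with k h1 h2
  rw [h1, h2]
  simp; ring

/-- The witness is (A - c₀)ⁿ f. Each iterate stays in the range of the spectral projection, hence in
the domain, and each step costs at most a factor r. -/
theorem IsMultiplication.exists_iterate (h : IsMultiplication W c A) (hF : IsSpectralMeasure A F)
    {c₀ r : ℝ} (hr : 0 < r) {f : H} (hf : F.proj (Icc (c₀ - r) (c₀ + r)) f = f) (n : ℕ) :
    ∃ g : H, F.proj (Icc (c₀ - r) (c₀ + r)) g = g ∧ ‖g‖ ≤ r ^ n * ‖f‖ ∧
      W g =ᵐ[ν] fun k => ((c k - c₀ : ℝ) : ℂ) ^ n * W f k := by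
  have hS : MeasurableSet (Icc (c₀ - r) (c₀ + r)) := measurableSet_Icc
  have hB : ∀ t ∈ Icc (c₀ - r) (c₀ + r), |t| ≤ |c₀| + r := fun t ht => by
    have h1 : |t - c₀| ≤ r := abs_le.2 ⟨by linarith [ht.1], by linarith [ht.2]⟩
    have h2 := abs_add_le c₀ (t - c₀)
    rw [add_sub_cancel] at h2
    linarith
  induction n with
  | zero => exact ⟨f, hf, by simp, by simp⟩
  | succ n ih =>
    obtain ⟨g, hg, hn, hW⟩ := ih
    have hd := hF.mem_domain hS hB hg
    refine ⟨A ⟨g, hd⟩ - (c₀ : ℂ) • g, ?_, ?_, ?_⟩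
    · rw [map_sub, map_smul, hg, hF.proj_apply hS ⟨g, hd⟩ hg]
    · refine (hF.norm_apply_sub_le h.isFormalAdjoint hr ⟨g, hd⟩ hg).trans ?_
      rw [pow_succ', mul_assoc]
      exact mul_le_mul_of_nonneg_left hn hr.le
    · rw [map_sub, map_smul]
      filter_upwards [h.apply ⟨g, hd⟩, hW, Lp.coeFn_sub (W (A ⟨g, hd⟩)) ((c₀ : ℂ) • W g),
        Lp.coeFn_smul (c₀ : ℂ) (W g)] with k h1 h2 h3 h4
      rw [h3, Pi.sub_apply, h4, h1, Pi.smul_apply, h2, smul_eq_mul]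
      push_cast
      ring

/-- On the set where |c - c₀| ≥ ρ, the n-th iterate is at least ρⁿ|Wf|, while its norm is at most
rⁿ‖f‖. So the part of Wf on this set has norm at most (r/ρ)ⁿ‖f‖ for every n. -/
theorem IsMultiplication.mulOp_eq_zero (h : IsMultiplication W c A) (hc : Measurable c)
    (hF : IsSpectralMeasure A F) {c₀ r ρ : ℝ} (hr : 0 < r) (hρ : r < ρ) {f : H}
    (hf : F.proj (Icc (c₀ - r) (c₀ + r)) f = f) :
    mulOp W ({k | ρ ≤ |c k - c₀|}.indicator 1) f = 0 := by
  set T := {k | ρ ≤ |c k - c₀|} with hT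
  have hTm : MeasurableSet T := measurableSet_le measurable_const (hc.sub_const c₀).abs
  have key (n : ℕ) : ‖mulOp W (T.indicator 1) f‖ ≤ (r / ρ) ^ n * ‖f‖ := by
    obtain ⟨g, -, hn, hW⟩ := h.exists_iterate hF hr hf n
    have h1 : ‖((ρ ^ n : ℝ) : ℂ) • mulLp ν (T.indicator 1) (W f)‖ ≤ ‖W g‖ := by
      refine Lp.norm_le_norm_of_ae_le ?_
      filter_upwards [Lp.coeFn_smul ((ρ ^ n : ℝ) : ℂ) (mulLp ν (T.indicator 1) (W f)),
        coeFn_mulLp_indicator hTm (W f), hW] with k h1 h2 h3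
      rw [h1, Pi.smul_apply, h2, h3, norm_smul, norm_mul, norm_pow, Complex.norm_real,
        Complex.norm_real, Real.norm_eq_abs, Real.norm_eq_abs]
      by_cases hk : k ∈ T
      · rw [indicator_of_mem hk, abs_of_pos (pow_pos (hr.trans hρ) n)]
        exact mul_le_mul_of_nonneg_right (pow_le_pow_left₀ (hr.trans hρ).le hk n) (norm_nonneg _)
      · rw [indicator_of_notMem hk, norm_zero, mul_zero]
        positivity
    rw [norm_smul, Complex.norm_real, Real.norm_eq_abs, abs_of_pos (pow_pos (hr.trans hρ) n),
      ← map_mulOp, W.norm_map, W.norm_map] at h1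
    rw [div_pow, div_mul_eq_mul_div, le_div_iff₀ (pow_pos (hr.trans hρ) n)]
    linarith
  have hlim : Filter.Tendsto (fun n : ℕ => (r / ρ) ^ n * ‖f‖) Filter.atTop (nhds 0) := by
    have hρ0 : 0 < ρ := hr.trans hρ
    simpa using (tendsto_pow_atTop_nhds_zero_of_lt_one (by positivity)
      ((div_lt_one hρ0).2 hρ)).mul_const ‖f‖
  exact norm_le_zero_iff.1 (ge_of_tendsto' hlim key)

/-- The previous lemma for ρ = r + 1/(n+1) exhausts the complement of the closed interval. This
gives one inclusion of ranges, F(I) ≤ P(I), for nondegenerate closed intervals. -/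
theorem IsMultiplication.pullback_proj_Icc (h : IsMultiplication W c A) (hc : Measurable c)
    (hF : IsSpectralMeasure A F) {α β : ℝ} (hαβ : α < β) (f : H) :
    (pullbackPVM W hc).proj (Icc α β) (F.proj (Icc α β) f) = F.proj (Icc α β) f := by
  obtain ⟨c₀, r, hr, rfl, rfl⟩ : ∃ c₀ r : ℝ, 0 < r ∧ α = c₀ - r ∧ β = c₀ + r :=
    ⟨(α + β) / 2, (β - α) / 2, by linarith, by ring, by ring⟩
  set g := F.proj (Icc (c₀ - r) (c₀ + r)) f with hg
  have hgS : F.proj (Icc (c₀ - r) (c₀ + r)) g = g := by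
    rw [hg, F.proj_proj measurableSet_Icc measurableSet_Icc, inter_self]
  let T : ℕ → Set ℝ := fun n => {t | r + 1 / ((n : ℝ) + 1) ≤ |t - c₀|}
  have hT (n : ℕ) : MeasurableSet (T n) :=
    measurableSet_le measurable_const (measurable_id.sub_const c₀).abs
  have hmono : Monotone T := fun m n hmn t (ht : r + 1 / ((m : ℝ) + 1) ≤ |t - c₀|) =>
    (add_le_add_right (Nat.one_div_le_one_div hmn) r).trans ht
  have hU : ⋃ n, T n = (Icc (c₀ - r) (c₀ + r))ᶜ := by
    ext t
    simp only [T, mem_iUnion, mem_ofPred_eq, mem_compl_iff]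
    have e : t ∈ Icc (c₀ - r) (c₀ + r) ↔ |t - c₀| ≤ r := by
      rw [abs_le, mem_Icc]
      constructor <;> rintro ⟨h1, h2⟩ <;> constructor <;> linarith
    rw [e, not_le]
    constructor
    · rintro ⟨n, hn⟩
      have : (0 : ℝ) < 1 / ((n : ℝ) + 1) := by positivity
      linarith
    · intro ht
      obtain ⟨n, hn⟩ := exists_nat_one_div_lt (sub_pos.2 ht)
      exact ⟨n, by linarith⟩
  have hlim := (pullbackPVM W hc).tendsto_proj_iUnion hT hmono g
  rw [hU] at hlim
  have h0 : (pullbackPVM W hc).proj (Icc (c₀ - r) (c₀ + r))ᶜ g = 0 := by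
    refine tendsto_nhds_unique hlim (tendsto_const_nhds.congr fun n => ?_)
    exact (h.mulOp_eq_zero hc hF hr (lt_add_of_pos_right r (by positivity)) hgS).symm
  rw [ProjMeasure.proj_compl _ measurableSet_Icc, sub_eq_zero] at h0
  exact h0.symm

theorem IsMultiplication.pullback_proj_iUnion (h : IsMultiplication W c A) (hc : Measurable c)
    (hF : IsSpectralMeasure A F) {α β : ℕ → ℝ} (hαβ : ∀ n, α n < β n) (hα : Antitone α)
    (hβ : Monotone β) (f : H) :
    (pullbackPVM W hc).proj (⋃ n, Icc (α n) (β n)) (F.proj (⋃ n, Icc (α n) (β n)) f) =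
      F.proj (⋃ n, Icc (α n) (β n)) f := by
  have hU : MeasurableSet (⋃ n, Icc (α n) (β n)) := MeasurableSet.iUnion fun n => measurableSet_Icc
  have hlim := F.tendsto_proj_iUnion (fun n => measurableSet_Icc (a := α n) (b := β n))
    (fun m n hmn => Icc_subset_Icc (hα hmn) (hβ hmn)) f
  refine tendsto_nhds_unique
    ((((pullbackPVM W hc).proj (⋃ n, Icc (α n) (β n))).continuous.tendsto _).comp hlim)
    (hlim.congr fun n => ?_)
  simp only [Function.comp_apply]
  rw [← h.pullback_proj_Icc hc hF (hαβ n), ProjMeasure.proj_proj _ hU measurableSet_Icc,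
    inter_eq_right.2 (subset_iUnion (fun n => Icc (α n) (β n)) n)]

/-- The spectral measure of a multiplication operator is unique. -/
theorem IsMultiplication.spectralMeasure_unique (h : IsMultiplication W c A) (hc : Measurable c)
    (hF : IsSpectralMeasure A F) {s : Set ℝ} (hs : MeasurableSet s) :
    F.proj s = (pullbackPVM W hc).proj s := by
  refine F.proj_eq_of_generateFrom _ (borel_eq_generateFrom_Iic ℝ ▸ BorelSpace.measurable_eq)
    isPiSystem_Iic ?_ hs
  rintro _ ⟨a, rfl⟩
  ext1 f
  -- The inclusion of ranges is applied to `Iic a` and to its complement, each written as an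
  -- increasing union of intervals of positive length. Two inclusions for complementary sets force
  -- equality.
  have h1 := h.pullback_proj_iUnion hc hF (α := fun n : ℕ => a - 1 - n) (β := fun _ => a)
    (fun n => by linarith [(Nat.cast_nonneg n : (0 : ℝ) ≤ n)])
    (fun m n hmn => by
      have : (m : ℝ) ≤ n := by exact_mod_cast hmn
      simp only; linarith) monotone_const f
  have h2 := h.pullback_proj_iUnion hc hF (α := fun n : ℕ => a + 1 / ((n : ℝ) + 1))
    (β := fun n => a + 2 + n)
    (fun n => by
      have h3 := Nat.one_div_le_one_div (α := ℝ) (Nat.zero_le n)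
      have h4 := (Nat.cast_nonneg n : (0 : ℝ) ≤ n)
      norm_num at h3 ⊢
      linarith)
    (fun m n hmn => add_le_add_right (Nat.one_div_le_one_div hmn) a)
    (fun m n hmn => by
      have : (m : ℝ) ≤ n := by exact_mod_cast hmn
      simp only; linarith) f
  have e1 : ⋃ n : ℕ, Icc (a - 1 - n) a = Iic a := by
    ext t
    simp only [mem_iUnion, mem_Icc, mem_Iic]
    refine ⟨fun ⟨n, hn⟩ => hn.2, fun ht => ?_⟩
    obtain ⟨n, hn⟩ := exists_nat_ge (a - 1 - t)
    exact ⟨n, by linarith, ht⟩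
  have e2 : ⋃ n : ℕ, Icc (a + 1 / ((n : ℝ) + 1)) (a + 2 + n) = (Iic a)ᶜ := by
    ext t
    simp only [mem_iUnion, mem_Icc, compl_Iic, mem_Ioi]
    constructor
    · rintro ⟨n, hn, -⟩
      have : (0 : ℝ) < 1 / ((n : ℝ) + 1) := by positivity
      linarith
    · intro ht
      obtain ⟨n, hn⟩ := exists_nat_one_div_lt (sub_pos.2 ht)
      obtain ⟨N, hN⟩ := exists_nat_ge (t - a - 2)
      refine ⟨max n N, ?_, ?_⟩
      · have := Nat.one_div_le_one_div (α := ℝ) (le_max_left n N)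
        linarith
      · have : (N : ℝ) ≤ (max n N : ℕ) := by exact_mod_cast le_max_right n N
        linarith
  rw [e1] at h1
  rw [e2] at h2
  set P := pullbackPVM W hc
  have hm : MeasurableSet (Iic a) := measurableSet_Iic
  -- F((Iic a)ᶜ)f lies in the range of P((Iic a)ᶜ), so P(Iic a) annihilates it.
  have h3 : P.proj (Iic a) (F.proj (Iic a)ᶜ f) = 0 := by
    rw [← h2, P.proj_proj hm hm.compl, inter_compl_self, P.proj_empty_apply]
  rw [F.proj_compl hm, map_sub, h1, sub_eq_zero] at h3
  exact h3.symm

theorem IsMultiplication.resolution_unique {X : Type*} [MeasurableSpace X]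
    (h : IsMultiplication W c A) (hc : Measurable c) {E : ProjMeasure X H} {b : X → ℝ}
    (hb : Measurable b) (hE : E.IsResolution b A) {s : Set ℝ} (hs : MeasurableSet s) :
    E.proj (b ⁻¹' s) = mulOp W ((c ⁻¹' s).indicator 1) :=
  h.spectralMeasure_unique hc (hE.map hb) hs

/-- On a rectangle, E(s × t) = E(s × ℝ) E(ℝ × t), and both factors are values of the spectral
measures of A and B, which are already known. Rectangles form a generating π-system. -/
theorem IsMultiplication.jointSpectralMeasure_unique {B : H →ₗ.[ℂ] H} {d : K → ℝ}
    (hA : IsMultiplication W c A) (hc : Measurable c) (hB : IsMultiplication W d B)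
    (hd : Measurable d) {E : ProjMeasure (ℝ × ℝ) H} (hE : IsJointSpectralMeasure A B E)
    {s : Set (ℝ × ℝ)} (hs : MeasurableSet s) :
    E.proj s = (pullbackPVM W (hc.prodMk hd)).proj s := by
  refine E.proj_eq_of_generateFrom _ generateFrom_prod.symm isPiSystem_prod ?_ hs
  rintro _ ⟨s, hs, t, ht, rfl⟩
  simp only [prod_eq]
  rw [E.proj_inter _ _ (measurable_fst hs) (measurable_snd ht),
    hA.resolution_unique hc measurable_fst hE.1 hs, hB.resolution_unique hd measurable_snd hE.2 ht,
    ← mulOp_inter W (hc hs) (hd ht)]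
  rfl

end Uniqueness

/-! ### Closures, inverses and products of multiplication operators -/

section Closures

variable {K : Type*} [MeasurableSpace K] {ν : Measure K}
  {H : Type*} [NormedAddCommGroup H] [InnerProductSpace ℂ H] [CompleteSpace H]
  (W : H ≃ₗᵢ[ℂ] Lp ℂ 2 ν)

/-- The graph of the maximal operator of multiplication by `c`. -/
def multiplicationGraph (c : K → ℝ) : Submodule ℂ (H × H) where
  carrier := {p | W p.2 =ᵐ[ν] fun k => (c k : ℂ) * W p.1 k}
  add_mem' := by
    rintro ⟨f, g⟩ ⟨f', g'⟩ (h : W g =ᵐ[ν] _) (h' : W g' =ᵐ[ν] _)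
    change W (g + g') =ᵐ[ν] fun k => (c k : ℂ) * W (f + f') k
    rw [map_add, map_add]
    filter_upwards [h, h', Lp.coeFn_add (W f) (W f'), Lp.coeFn_add (W g) (W g')] with k h1 h2 h3 h4
    rw [h3, h4, Pi.add_apply, Pi.add_apply, h1, h2, mul_add]
  zero_mem' := by
    change W 0 =ᵐ[ν] fun k => (c k : ℂ) * W 0 k
    rw [map_zero]
    filter_upwards [Lp.coeFn_zero ℂ 2 ν] with k h1
    rw [h1]; simp
  smul_mem' := by
    rintro a ⟨f, g⟩ (h : W g =ᵐ[ν] _)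
    change W (a • g) =ᵐ[ν] fun k => (c k : ℂ) * W (a • f) k
    rw [map_smul, map_smul]
    filter_upwards [h, Lp.coeFn_smul a (W f), Lp.coeFn_smul a (W g)] with k h1 h3 h4
    rw [h3, h4, Pi.smul_apply, Pi.smul_apply, h1, smul_eq_mul, smul_eq_mul, mul_left_comm]

variable {W}

theorem mem_multiplicationGraph {c : K → ℝ} {f g : H} :
    (f, g) ∈ multiplicationGraph W c ↔ W g =ᵐ[ν] fun k => (c k : ℂ) * W f k := Iff.rfl

/-- Dividing g = c f by 1 + c² turns it into an equation between two bounded operators, whose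
solution set is closed. -/
theorem isClosed_multiplicationGraph {c : K → ℝ} (hc : Measurable c) :
    IsClosed (multiplicationGraph W c : Set (H × H)) := by
  let m₁ : K → ℂ := fun k => ((1 / (1 + c k ^ 2) : ℝ) : ℂ)
  let m₂ : K → ℂ := fun k => ((c k / (1 + c k ^ 2) : ℝ) : ℂ)
  have hm₁ : Measurable m₁ :=
    Complex.measurable_ofReal.comp (measurable_const.div (measurable_const.add (hc.pow_const 2)))
  have hm₂ : Measurable m₂ :=
    Complex.measurable_ofReal.comp (hc.div (measurable_const.add (hc.pow_const 2)))
  have hb₁ (k : K) : ‖m₁ k‖ ≤ 1 := by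
    simp only [m₁, Complex.norm_real, Real.norm_eq_abs]
    rw [abs_of_pos (by positivity), div_le_one (by positivity)]
    nlinarith [sq_nonneg (c k)]
  have hb₂ (k : K) : ‖m₂ k‖ ≤ 1 := by
    simp only [m₂, Complex.norm_real, Real.norm_eq_abs]
    rw [abs_div, abs_of_pos (a := 1 + c k ^ 2) (by positivity), div_le_one (by positivity)]
    nlinarith [sq_nonneg (|c k| - 1), sq_abs (c k)]
  have e : (multiplicationGraph W c : Set (H × H)) = {p | mulOp W m₁ p.2 = mulOp W m₂ p.1} := by
    ext ⟨f, g⟩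
    change W g =ᵐ[ν] _ ↔ mulOp W m₁ g = mulOp W m₂ f
    rw [← W.injective.eq_iff, map_mulOp, map_mulOp, Lp.ext_iff]
    have h1 := coeFn_mulLp hm₁ hb₁ (W g)
    have h2 := coeFn_mulLp hm₂ hb₂ (W f)
    have hne (k : K) : (1 + (c k : ℂ) ^ 2) ≠ 0 := by
      have : (0 : ℝ) < 1 + c k ^ 2 := by positivity
      exact_mod_cast this.ne'
    constructor
    · intro h
      filter_upwards [h, h1, h2] with k h3 h4 h5
      rw [h4, h5, h3]
      simp only [m₁, m₂]
      push_cast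
      ring
    · intro h
      filter_upwards [h, h1, h2] with k h3 h4 h5
      rw [h4, h5] at h3
      simp only [m₁, m₂] at h3
      push_cast at h3
      field_simp [hne k] at h3
      exact h3
  rw [e]
  exact isClosed_eq ((mulOp W m₁).continuous.comp continuous_snd)
    ((mulOp W m₂).continuous.comp continuous_fst)

/-- |c - i|² = c² + 1 dominates both 1 and c², so g - i f controls the whole graph norm. -/
theorem norm_le_of_mem_multiplicationGraph {c : K → ℝ} {f g : H}
    (h : (f, g) ∈ multiplicationGraph W c) :
    ‖f‖ ≤ ‖g - Complex.I • f‖ ∧ ‖g‖ ≤ ‖g - Complex.I • f‖ := by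
  have key : ∀ᵐ k ∂ν, ‖W (g - Complex.I • f) k‖ ^ 2 = (c k ^ 2 + 1) * ‖W f k‖ ^ 2 := by
    rw [map_sub, map_smul]
    filter_upwards [mem_multiplicationGraph.1 h, Lp.coeFn_sub (W g) (Complex.I • W f),
      Lp.coeFn_smul Complex.I (W f)] with k h1 h2 h3
    have h4 : Complex.normSq ((c k : ℂ) - Complex.I) = c k ^ 2 + 1 := by
      simp [Complex.normSq_apply]; ring
    rw [h2, Pi.sub_apply, h3, h1, Pi.smul_apply, smul_eq_mul, ← sub_mul, norm_mul, mul_pow,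
      ← Complex.normSq_eq_norm_sq, h4]
  constructor
  · rw [← W.norm_map, ← W.norm_map (g - _)]
    refine Lp.norm_le_norm_of_ae_le ?_
    filter_upwards [key] with k h1
    refine le_of_sq_le_sq ?_ (norm_nonneg _)
    rw [h1]
    nlinarith [sq_nonneg (c k), sq_nonneg ‖W f k‖, mul_nonneg (sq_nonneg (c k)) (sq_nonneg ‖W f k‖)]
  · rw [← W.norm_map, ← W.norm_map (g - _)]
    refine Lp.norm_le_norm_of_ae_le ?_
    filter_upwards [key, mem_multiplicationGraph.1 h] with k h1 h2
    refine le_of_sq_le_sq ?_ (norm_nonneg _)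
    rw [h1, h2, norm_mul, Complex.norm_real, mul_pow, Real.norm_eq_abs, sq_abs]
    nlinarith [sq_nonneg ‖W f k‖]

theorem eq_zero_of_mem_multiplicationGraph {c : K → ℝ} {g : H}
    (h : (0, g) ∈ multiplicationGraph W c) : g = 0 := by
  have h0 := mem_multiplicationGraph.1 h
  apply W.injective
  rw [map_zero] at h0 ⊢
  refine Lp.ext ?_
  filter_upwards [h0, Lp.coeFn_zero ℂ 2 ν] with k h1 h2
  rw [h1, h2]; simp

/-- Closability matters because the closure of a partial operator has the closed graph only in that
case; the maximal multiplication operator is a closed extension. -/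
theorem isClosable_of_graph_le {c : K → ℝ} (hc : Measurable c) {T : H →ₗ.[ℂ] H}
    (hT : T.graph ≤ multiplicationGraph W c) : T.IsClosable := by
  have hg : (multiplicationGraph W c).toLinearPMap.graph = multiplicationGraph W c := by
    refine Submodule.toLinearPMap_graph_eq _ fun x hx h0 => ?_
    obtain ⟨f, g⟩ := x
    have h0' : f = 0 := h0
    subst h0'
    exact eq_zero_of_mem_multiplicationGraph hx
  refine LinearPMap.isClosable_iff_exists_closed_extension.2
    ⟨(multiplicationGraph W c).toLinearPMap, ?_, ?_⟩
  · rw [LinearPMap.IsClosed, hg]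
    exact isClosed_multiplicationGraph hc
  · rw [← LinearPMap.le_graph_iff, hg]
    exact hT

/-- If `Γ` is a closed subspace of the graph of the operator of multiplication by `c` and
`{g - i f | (f, g) ∈ Γ}` is dense, then `Γ` is the whole graph. -/
theorem multiplicationGraph_le {c : K → ℝ} {Γ : Submodule ℂ (H × H)}
    (hΓM : Γ ≤ multiplicationGraph W c) (hΓc : IsClosed (Γ : Set (H × H)))
    (htot : ∀ g : H, (∀ v w, (v, w) ∈ Γ → inner ℂ g (w - Complex.I • v) = 0) → g = 0) :
    multiplicationGraph W c ≤ Γ := by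
  rintro ⟨f, g⟩ h
  let L : H × H →ₗ[ℂ] H := LinearMap.snd ℂ H H - Complex.I • LinearMap.fst ℂ H H
  have hL (v w : H) : L (v, w) = w - Complex.I • v := rfl
  have hR : (Γ.map L).topologicalClosure = ⊤ := by
    rw [Submodule.topologicalClosure_eq_top_iff, Submodule.eq_bot_iff]
    intro g hg
    refine htot g fun v w hvw => ?_
    rw [Submodule.mem_orthogonal'] at hg
    exact hg _ (Submodule.mem_map.2 ⟨(v, w), hvw, hL v w⟩)
  have hmem : g - Complex.I • f ∈ closure (Γ.map L : Set H) := by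
    rw [← Submodule.topologicalClosure_coe, hR]; trivial
  -- Approximating g - i f by w - i v already approximates (f, g) by (v, w), by the estimate of the
  -- graph norm.
  rw [← SetLike.mem_coe, ← hΓc.closure_eq, Metric.mem_closure_iff]
  intro ε hε
  obtain ⟨_, hx, hd⟩ := Metric.mem_closure_iff.1 hmem ε hε
  obtain ⟨⟨v, w⟩, hvw, rfl⟩ := Submodule.mem_map.1 hx
  refine ⟨(v, w), hvw, ?_⟩
  have hdiff : (f - v, g - w) ∈ multiplicationGraph W c :=
    (multiplicationGraph W c).sub_mem h (hΓM hvw)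
  have hn := norm_le_of_mem_multiplicationGraph hdiff
  have e : g - w - Complex.I • (f - v) = g - Complex.I • f - L (v, w) := by
    rw [hL, smul_sub]; abel
  rw [e, ← dist_eq_norm, ← dist_eq_norm, ← dist_eq_norm] at hn
  rw [Prod.dist_eq]
  exact max_lt (hn.1.trans_lt hd) (hn.2.trans_lt hd)

/-- If `T` is a restriction of the operator of multiplication by `c` and the range of `T̄ - i` is
dense, then the closure of `T` is the operator of multiplication by `c`. -/
theorem isMultiplication_closure {c : K → ℝ} (hc : Measurable c) {T : H →ₗ.[ℂ] H}
    (hT : T.graph ≤ multiplicationGraph W c)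
    (htot : ∀ g : H, (∀ v w, (v, w) ∈ T.graph.topologicalClosure →
      inner ℂ g (w - Complex.I • v) = 0) → g = 0) : IsMultiplication W c T.closure := by
  have h1 : T.graph.topologicalClosure ≤ multiplicationGraph W c :=
    Submodule.topologicalClosure_minimal _ hT (isClosed_multiplicationGraph hc)
  have h2 := multiplicationGraph_le h1 (Submodule.isClosed_topologicalClosure _) htot
  intro f g
  rw [← (isClosable_of_graph_le hc hT).graph_closure_eq_closure_graph, ← mem_multiplicationGraph]
  exact ⟨fun h => h1 h, fun h => h2 h⟩

theorem LinearPMap.mem_graph_mulNat (A B : H →ₗ.[ℂ] H) (f g : H) :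
    (f, g) ∈ (A.mulNat B).graph ↔ ∃ v, (f, v) ∈ B.graph ∧ (v, g) ∈ A.graph := by
  constructor
  · intro h
    obtain ⟨⟨x, hx⟩, rfl, h2⟩ := (LinearPMap.mem_graph_iff _).1 h
    have hx' := hx
    obtain ⟨hx1, hx2⟩ := hx'
    obtain ⟨y, hy, hyx⟩ := hx1
    have hyx' : (y : H) = x := hyx
    subst hyx'
    exact ⟨B y, B.mem_graph y, (LinearPMap.mem_graph_iff _).2 ⟨⟨B y, hy⟩, rfl, h2⟩⟩
  · rintro ⟨v, h1, h2⟩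
    obtain ⟨y, rfl, rfl⟩ := (LinearPMap.mem_graph_iff _).1 h1
    obtain ⟨z, hz, rfl⟩ := (LinearPMap.mem_graph_iff _).1 h2
    have hy : B y ∈ A.domain := by
      have hz' : (z : H) = B y := hz
      rw [← hz']; exact z.2
    have hzy : z = ⟨B y, hy⟩ := Subtype.ext hz
    subst hzy
    refine (LinearPMap.mem_graph_iff _).2 ⟨⟨y, ⟨⟨y, hy, rfl⟩, y.2⟩⟩, rfl, rfl⟩

/-- A multiplier that is nonzero almost everywhere gives an injective operator, and injectivity is
what identifies the graph of `inverse` with the flipped graph. -/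
theorem IsMultiplication.mem_graph_inverse {b : K → ℝ} (hb : ∀ᵐ k ∂ν, b k ≠ 0) {B : H →ₗ.[ℂ] H}
    (hB : IsMultiplication W b B) (f g : H) : (f, g) ∈ B.inverse.graph ↔ (g, f) ∈ B.graph := by
  have hker : LinearMap.ker B.toFun = ⊥ := by
    rw [LinearMap.ker_eq_bot']
    intro f hf
    have h := hB.apply f
    have hf' : B f = 0 := hf
    rw [hf', map_zero] at h
    apply Subtype.ext
    apply W.injective
    rw [Submodule.coe_zero, map_zero]
    refine Lp.ext ?_
    filter_upwards [h, hb, Lp.coeFn_zero ℂ 2 ν] with k h1 h2 h3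
    rw [h3, Pi.zero_apply] at h1 ⊢
    have h4 : (b k : ℂ) ≠ 0 := by exact_mod_cast h2
    simpa [h4] using h1.symm
  rw [LinearPMap.inverse_graph hker]
  simp

theorem IsMultiplication.graph_mulNat_inverse_le {a b c : K → ℝ} {A B : H →ₗ.[ℂ] H}
    (hA : IsMultiplication W a A) (hB : IsMultiplication W b B) (hb : ∀ᵐ k ∂ν, b k ≠ 0)
    (habc : ∀ k, a k = c k * b k) : (A.mulNat B.inverse).graph ≤ multiplicationGraph W c := by
  rintro ⟨f, g⟩ hfg
  obtain ⟨v, h1, h2⟩ := (LinearPMap.mem_graph_mulNat _ _ _ _).1 hfg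
  rw [hB.mem_graph_inverse hb, hB] at h1
  rw [hA] at h2
  rw [mem_multiplicationGraph]
  filter_upwards [h1, h2] with k h3 h4
  rw [h4, h3, habc]
  push_cast
  ring

end Closures

/-! ### Hermite functions: Gaussian bounds, orthogonality, differential equation -/

section HermiteFunctions

open Polynomial in
/-- The polynomials `qₙ` with `(d/dx - x)ⁿ e^{-x²/2} = qₙ(x) e^{-x²/2}`. -/
noncomputable def rodriguesPoly : ℕ → Polynomial ℝ
  | 0 => 1
  | n + 1 => derivative (rodriguesPoly n) - 2 * X * rodriguesPoly n

theorem rodriguesPoly_succ (n : ℕ) : rodriguesPoly (n + 1) =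
    Polynomial.derivative (rodriguesPoly n) - 2 * Polynomial.X * rodriguesPoly n := rfl

/-- These polynomials are (-1)ⁿ times the Hermite polynomials. For n = 0 the truncated index n - 1
is harmless because the factor n vanishes. -/
theorem derivative_rodriguesPoly (n : ℕ) : Polynomial.derivative (rodriguesPoly n) =
    Polynomial.C (-2 * (n : ℝ)) * rodriguesPoly (n - 1) := by
  induction n with
  | zero => simp [rodriguesPoly]
  | succ n ih =>
    have h : Polynomial.derivative (rodriguesPoly (n + 1)) =
        Polynomial.derivative (Polynomial.derivative (rodriguesPoly n)) -
          2 * rodriguesPoly n - 2 * Polynomial.X * Polynomial.derivative (rodriguesPoly n) := by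
      rw [rodriguesPoly_succ]
      simp
      ring
    rw [h]
    rcases n with _ | n
    · simpa [rodriguesPoly] using (map_ofNat Polynomial.C 2).symm
    · have h2 : Polynomial.derivative (Polynomial.derivative (rodriguesPoly (n + 1))) =
          Polynomial.C (-2 * ((n + 1 : ℕ) : ℝ)) * Polynomial.derivative (rodriguesPoly n) := by
        rw [ih]; simp
      have h3 := rodriguesPoly_succ n
      rw [h2, ih]
      simp only [Nat.add_sub_cancel] at *
      rw [h3]
      simp only [map_mul, map_neg, Nat.cast_add, Nat.cast_one, map_add, map_natCast, map_one,
        Polynomial.C_ofNat]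
      ring

/-- The function `p(x) e^{-x²/2}`. -/
noncomputable def polyGauss (p : Polynomial ℝ) (x : ℝ) : ℝ := p.eval x * Real.exp (-x ^ 2 / 2)

theorem hasDerivAt_polyGauss (p : Polynomial ℝ) (x : ℝ) :
    HasDerivAt (polyGauss p) (polyGauss (Polynomial.derivative p - Polynomial.X * p) x) x := by
  have h1 : HasDerivAt (fun y : ℝ => Real.exp (-y ^ 2 / 2)) (Real.exp (-x ^ 2 / 2) * (-x)) x := by
    have h2 : HasDerivAt (fun y : ℝ => -y ^ 2 / 2) (-x) x := by
      have h3 := ((hasDerivAt_pow 2 x).neg).div_const 2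
      refine h3.congr_deriv ?_
      simp; ring
    exact h2.exp
  refine ((p.hasDerivAt x).mul h1).congr_deriv ?_
  simp only [polyGauss, Polynomial.eval_sub, Polynomial.eval_mul, Polynomial.eval_X]
  ring

theorem continuous_polyGauss (p : Polynomial ℝ) : Continuous (polyGauss p) :=
  continuous_iff_continuousAt.2 fun x => (hasDerivAt_polyGauss p x).continuousAt

/-- The normalization constant of `hₙ`. -/
noncomputable def hermiteConst (n : ℕ) : ℝ := (√Real.pi * (n.factorial : ℝ) * 2 ^ n) ^ (-(1 / 2) : ℝ)

theorem hermiteFn_eq (n : ℕ) (x : ℝ) :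
    hermiteFn n x = polyGauss (Polynomial.C (hermiteConst n) * rodriguesPoly n) x := by
  have h : (fun (g : ℝ → ℝ) (y : ℝ) => deriv g y - y * g y)^[n]
      (fun y => Real.exp (-y ^ 2 / 2)) = polyGauss (rodriguesPoly n) := by
    induction n with
    | zero => ext y; simp [polyGauss, rodriguesPoly]
    | succ n ih =>
      rw [Function.iterate_succ_apply', ih]
      ext y
      rw [(hasDerivAt_polyGauss _ y).deriv, rodriguesPoly_succ]
      simp only [polyGauss, Polynomial.eval_sub, Polynomial.eval_mul, Polynomial.eval_X,
        Polynomial.eval_ofNat]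
      ring
  rw [hermiteFn, h]
  simp only [polyGauss, Polynomial.eval_mul, Polynomial.eval_C, hermiteConst]
  ring

theorem hermiteFn_eq' (n : ℕ) :
    hermiteFn n = polyGauss (Polynomial.C (hermiteConst n) * rodriguesPoly n) :=
  funext (hermiteFn_eq n)

/-- Uses tⁿ/n! ≤ eᵗ with t = b x², after |x|ⁿ ≤ 1 + x²ⁿ. The explicit bound is reused later with b
depending on a support. -/
theorem abs_pow_mul_exp_le {b : ℝ} (hb : 0 < b) (n : ℕ) (x : ℝ) :
    |x| ^ n * Real.exp (-b * x ^ 2) ≤ 1 + n.factorial / b ^ n := by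
  have h1 := Real.pow_div_factorial_le_exp (x := b * x ^ 2) (by positivity) n
  have h2 : Real.exp (-b * x ^ 2) ≤ 1 := Real.exp_le_one_iff.2 (by nlinarith [sq_nonneg x])
  have h3 : |x| ^ n ≤ 1 + (x ^ 2) ^ n := by
    have : (x ^ 2) ^ n = (|x| ^ n) ^ 2 := by rw [← sq_abs, ← pow_mul, ← pow_mul, mul_comm]
    rw [this]
    nlinarith [sq_nonneg (|x| ^ n - 1), pow_nonneg (abs_nonneg x) n]
  have h4 : (x ^ 2) ^ n * Real.exp (-b * x ^ 2) ≤ n.factorial / b ^ n := by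
    rw [neg_mul, Real.exp_neg, ← div_eq_mul_inv, div_le_div_iff₀ (Real.exp_pos _) (by positivity)]
    rw [mul_pow, div_le_iff₀ (by positivity)] at h1
    linarith
  calc |x| ^ n * Real.exp (-b * x ^ 2) ≤ (1 + (x ^ 2) ^ n) * Real.exp (-b * x ^ 2) :=
        mul_le_mul_of_nonneg_right h3 (Real.exp_pos _).le
    _ ≤ _ := by rw [add_mul, one_mul]; exact add_le_add h2 h4

/-- Half of the Gaussian absorbs each monomial, and the other half remains as the bound. -/
theorem exists_polyGauss_le (p : Polynomial ℝ) :
    ∃ C : ℝ, ∀ x, |polyGauss p x| ≤ C * Real.exp (-(1 / 4) * x ^ 2) := by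
  induction p using Polynomial.induction_on' with
  | add p q hp hq =>
    obtain ⟨C, hC⟩ := hp
    obtain ⟨D, hD⟩ := hq
    refine ⟨C + D, fun x => ?_⟩
    have : polyGauss (p + q) x = polyGauss p x + polyGauss q x := by
      simp only [polyGauss, Polynomial.eval_add]; ring
    rw [this, add_mul]
    exact (abs_add_le _ _).trans (add_le_add (hC x) (hD x))
  | monomial n a =>
    refine ⟨|a| * (1 + n.factorial / (1 / 4 : ℝ) ^ n), fun x => ?_⟩
    have h := abs_pow_mul_exp_le (b := 1 / 4) (by norm_num) n x
    have h2 : Real.exp (-x ^ 2 / 2) = Real.exp (-(1 / 4) * x ^ 2) * Real.exp (-(1 / 4) * x ^ 2) := by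
      rw [← Real.exp_add]; ring_nf
    rw [polyGauss, Polynomial.eval_monomial, abs_mul, abs_mul, abs_pow, Real.abs_exp, h2, mul_assoc,
      ← mul_assoc (|x| ^ n), mul_assoc (|a|)]
    gcongr

theorem integrable_polyGauss (p : Polynomial ℝ) : Integrable (polyGauss p) := by
  obtain ⟨C, hC⟩ := exists_polyGauss_le p
  exact ((integrable_exp_neg_mul_sq (by norm_num : (0 : ℝ) < 1 / 4)).const_mul C).mono'
    (continuous_polyGauss p).aestronglyMeasurable (Filter.Eventually.of_forall hC)

theorem exists_abs_polyGauss_le (p : Polynomial ℝ) : ∃ C : ℝ, ∀ x, |polyGauss p x| ≤ C := by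
  obtain ⟨C, hC⟩ := exists_polyGauss_le p
  refine ⟨C, fun x => (hC x).trans ?_⟩
  have h0 : 0 ≤ C := by
    have := (abs_nonneg _).trans (hC 0)
    simpa using this
  exact mul_le_of_le_one_right h0 (Real.exp_le_one_iff.2 (by nlinarith [sq_nonneg x]))

theorem integrable_polyGauss_mul (p q : Polynomial ℝ) :
    Integrable fun x => polyGauss p x * polyGauss q x := by
  obtain ⟨C, hC⟩ := exists_abs_polyGauss_le p
  exact (integrable_polyGauss q).bdd_mul (continuous_polyGauss p).aestronglyMeasurable
    (Filter.Eventually.of_forall hC)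

/-- The pairing `∫ p q e^{-x²} dx`. -/
noncomputable def gaussPairing (p q : Polynomial ℝ) : ℝ := ∫ x, polyGauss p x * polyGauss q x

theorem gaussPairing_comm (p q : Polynomial ℝ) : gaussPairing p q = gaussPairing q p := by
  simp only [gaussPairing, mul_comm]

theorem gaussPairing_C_mul (a : ℝ) (p q : Polynomial ℝ) :
    gaussPairing p (Polynomial.C a * q) = a * gaussPairing p q := by
  rw [gaussPairing, gaussPairing, ← integral_const_mul]
  congr 1; ext x
  simp only [polyGauss, Polynomial.eval_mul, Polynomial.eval_C]; ring

/-- The adjoint of d/dx - x is -(d/dx + x), which acts on p e^{-x²/2} by differentiating p.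
Orthogonality follows by induction, since differentiation lowers the degree. -/
theorem gaussPairing_rodrigues_succ (n : ℕ) (p : Polynomial ℝ) :
    gaussPairing (rodriguesPoly (n + 1)) p =
      -gaussPairing (rodriguesPoly n) (Polynomial.derivative p) := by
  have h := integral_eq_zero_of_hasDerivAt_of_integrable
    (fun x => (hasDerivAt_polyGauss (rodriguesPoly n) x).mul (hasDerivAt_polyGauss p x))
    ((integrable_polyGauss_mul _ _).add (integrable_polyGauss_mul _ _))
    (integrable_polyGauss_mul _ _)
  rw [eq_neg_iff_add_eq_zero, ← h, gaussPairing, gaussPairing,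
    ← integral_add (integrable_polyGauss_mul _ _) (integrable_polyGauss_mul _ _)]
  congr 1; ext x
  simp only [polyGauss, rodriguesPoly_succ, Polynomial.eval_sub, Polynomial.eval_mul,
    Polynomial.eval_X, Polynomial.eval_ofNat]
  ring

theorem gaussPairing_rodrigues (n m : ℕ) :
    gaussPairing (rodriguesPoly n) (rodriguesPoly m) =
      if n = m then √Real.pi * (n.factorial : ℝ) * 2 ^ n else 0 := by
  have h0 (k : ℕ) : gaussPairing (rodriguesPoly (k + 1)) (rodriguesPoly 0) = 0 := by
    rw [gaussPairing_rodrigues_succ]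
    simp [rodriguesPoly, gaussPairing, polyGauss]
  induction n generalizing m with
  | zero =>
    rcases m with _ | m
    · have := integral_gaussian 1
      simp only [neg_mul, one_mul, div_one] at this
      simp only [gaussPairing, polyGauss, rodriguesPoly, Polynomial.eval_one, one_mul,
        ← Real.exp_add, if_true, Nat.factorial_zero, Nat.cast_one, pow_zero, mul_one]
      rw [← this]
      congr 1; ext x; congr 1; ring
    · rw [gaussPairing_comm, h0]; simp
  | succ n ih =>
    rcases m with _ | m
    · rw [h0]; simp
    · rw [gaussPairing_rodrigues_succ, derivative_rodriguesPoly, gaussPairing_C_mul,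
        Nat.add_sub_cancel, ih]
      by_cases h : n = m
      · subst h
        simp only [if_true, Nat.factorial_succ]
        push_cast; ring
      · simp [h]

theorem hermiteConst_sq (n : ℕ) :
    hermiteConst n * hermiteConst n * (√Real.pi * (n.factorial : ℝ) * 2 ^ n) = 1 := by
  have hpos : 0 < √Real.pi * (n.factorial : ℝ) * 2 ^ n := by
    have := Real.pi_pos
    have := Nat.factorial_pos n
    positivity
  rw [hermiteConst, ← Real.rpow_add hpos]
  norm_num
  rw [Real.rpow_neg_one]
  exact inv_mul_cancel₀ hpos.ne'

theorem integral_hermiteFn_mul (n m : ℕ) :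
    ∫ x, hermiteFn n x * hermiteFn m x = if n = m then 1 else 0 := by
  rw [hermiteFn_eq', hermiteFn_eq']
  change gaussPairing _ _ = _
  rw [gaussPairing_C_mul, gaussPairing_comm, gaussPairing_C_mul, gaussPairing_rodrigues]
  by_cases h : m = n
  · subst h
    rw [if_pos rfl, if_pos rfl, ← mul_assoc, hermiteConst_sq]
  · rw [if_neg h, if_neg (Ne.symm h)]; simp

/-- The Hermite differential equation `-h'' + x² h = (2n + 1) h`. -/
theorem hermiteFn_ode (n : ℕ) : ∃ h' : ℝ → ℝ, Continuous h' ∧ (∃ C, ∀ x, |h' x| ≤ C) ∧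
    (∀ x, HasDerivAt (hermiteFn n) (h' x) x) ∧
    (∀ x, HasDerivAt h' ((x ^ 2 - (2 * n + 1)) * hermiteFn n x) x) ∧
    ∃ C, ∀ x, |(x ^ 2 - (2 * n + 1)) * hermiteFn n x| ≤ C := by
  set p := Polynomial.C (hermiteConst n) * rodriguesPoly n with hp
  refine ⟨polyGauss (Polynomial.derivative p - Polynomial.X * p), continuous_polyGauss _,
    exists_abs_polyGauss_le _, ?_, ?_, ?_⟩
  · intro x
    rw [hermiteFn_eq']
    exact hasDerivAt_polyGauss _ x
  · intro x
    refine (hasDerivAt_polyGauss _ x).congr_deriv ?_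
    have key : Polynomial.derivative (Polynomial.derivative p) -
        2 * Polynomial.X * Polynomial.derivative p = Polynomial.C (-2 * (n : ℝ)) * p := by
      have h1 : Polynomial.derivative (rodriguesPoly (n + 1)) =
        Polynomial.derivative (Polynomial.derivative (rodriguesPoly n)) -
          2 * rodriguesPoly n - 2 * Polynomial.X * Polynomial.derivative (rodriguesPoly n) := by
        rw [rodriguesPoly_succ]
        simp
        ring
      rw [derivative_rodriguesPoly, Nat.add_sub_cancel] at h1
      have h2 : Polynomial.derivative p =
        Polynomial.C (hermiteConst n) * Polynomial.derivative (rodriguesPoly n) := by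
        rw [hp]; simp
      have h3 : Polynomial.derivative (Polynomial.derivative p) =
        Polynomial.C (hermiteConst n) *
          Polynomial.derivative (Polynomial.derivative (rodriguesPoly n)) := by
        rw [h2]; simp
      rw [h3, h2, hp]
      simp only [map_mul, map_neg, Nat.cast_add, Nat.cast_one, map_add, map_natCast, map_one,
        Polynomial.C_ofNat] at h1 ⊢
      linear_combination (-Polynomial.C (hermiteConst n)) * h1
    have key2 := congrArg (Polynomial.eval x) key
    rw [hermiteFn_eq, ← hp]
    simp only [polyGauss, Polynomial.eval_sub, Polynomial.eval_mul, Polynomial.eval_X,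
      Polynomial.eval_ofNat, Polynomial.eval_C, Polynomial.derivative_sub,
      Polynomial.derivative_mul, Polynomial.derivative_X, Polynomial.eval_add,
      Polynomial.eval_one] at key2 ⊢
    linear_combination (Real.exp (-x ^ 2 / 2)) * key2
  · obtain ⟨C, hC⟩ := exists_abs_polyGauss_le
      ((Polynomial.X ^ 2 - Polynomial.C (2 * (n : ℝ) + 1)) * p)
    refine ⟨C, fun x => ?_⟩
    convert hC x using 2
    rw [hermiteFn_eq, ← hp]
    simp only [polyGauss, Polynomial.eval_sub, Polynomial.eval_mul, Polynomial.eval_X,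
      Polynomial.eval_pow, Polynomial.eval_C]
    ring

theorem continuous_hermiteFn (n : ℕ) : Continuous (hermiteFn n) := by
  rw [hermiteFn_eq']; exact continuous_polyGauss _

theorem exists_abs_hermiteFn_le (n : ℕ) : ∃ C : ℝ, ∀ x, |hermiteFn n x| ≤ C := by
  rw [hermiteFn_eq']; exact exists_abs_polyGauss_le _

end HermiteFunctions

/-! ### Completeness of the Hermite functions and Parseval's identity -/

section HermiteCompleteness

-- For a test function g, write g = 𝓕(𝓕⁻¹ g) and move the transform to f: ∫ f g = ∫ (𝓕 f)(𝓕⁻¹ g) =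
-- 0.
open FourierTransform in
theorem ae_eq_zero_of_fourier_eq_zero {f : ℝ → ℂ} (hf : Integrable f)
    (h : ∀ w : ℝ, 𝓕 f w = 0) : f =ᵐ[volume] 0 := by
  refine ae_eq_zero_of_integral_contDiff_smul_eq_zero hf.locallyIntegrable fun g hg hgc => ?_
  have hgc' : HasCompactSupport (fun x => (g x : ℂ)) := hgc.comp_left (g := Complex.ofReal) rfl
  have hg' : ContDiff ℝ (↑(⊤ : ℕ∞)) fun x => (g x : ℂ) := Complex.ofRealCLM.contDiff.comp hg
  let φ : 𝓢(ℝ, ℂ) := hgc'.toSchwartzMap hg'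
  have hφ (x : ℝ) : φ x = g x := rfl
  let φ' : 𝓢(ℝ, ℂ) := 𝓕⁻ φ
  have h1 := VectorFourier.integral_fourierIntegral_smul_eq_flip (L := innerₗ ℝ)
    (μ := volume) (ν := volume) Real.continuous_fourierChar continuous_inner hf
    φ'.integrable
  have h2 : (fun x : ℝ => f x • VectorFourier.fourierIntegral Real.fourierChar volume
      (innerₗ ℝ).flip φ' x) = fun x => g x • f x := by
    ext x
    have e : VectorFourier.fourierIntegral Real.fourierChar volume (innerₗ ℝ).flip φ' x =
        (𝓕 φ') x := by
      rw [flip_innerₗ]; rfl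
    rw [e, show 𝓕 φ' = φ from fourier_fourierInv_eq φ, hφ, smul_eq_mul, Complex.real_smul, mul_comm]
  rw [h2] at h1
  rw [← h1]
  have h3 (w : ℝ) : VectorFourier.fourierIntegral Real.fourierChar volume (innerₗ ℝ) f w = 0 := h w
  simp [h3]

/-- Completing the square gives c|x| - x²/2 ≤ c² - x²/4, and the remaining Gaussian is in L². This
is the dominating function for the exponential series. -/
theorem integrable_exp_abs_mul {g : ℝ → ℂ} (hg : MemLp g 2) (c : ℝ) :
    Integrable fun x => ‖g x * (Real.exp (-x ^ 2 / 2) : ℂ)‖ * Real.exp (c * |x|) := by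
  have h1 : MemLp (fun x : ℝ => Real.exp (-(1 / 4) * x ^ 2)) 2 := by
    rw [memLp_two_iff_integrable_sq (by fun_prop)]
    refine (integrable_exp_neg_mul_sq (by norm_num : (0 : ℝ) < 1 / 2)).congr
      (Filter.Eventually.of_forall fun x => ?_)
    simp only
    rw [← Real.exp_nat_mul]; congr 1; push_cast; ring
  have h2 : Integrable fun x : ℝ => Real.exp (-(1 / 4) * x ^ 2) * ‖g x‖ := h1.integrable_mul hg.norm
  refine (h2.const_mul (Real.exp (c ^ 2))).mono' ?_ (Filter.Eventually.of_forall fun x => ?_)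
  · exact (hg.aestronglyMeasurable.mul (by fun_prop)).norm.mul (by fun_prop)
  · have h3 : Real.exp (-x ^ 2 / 2) * Real.exp (c * |x|) ≤
        Real.exp (c ^ 2) * Real.exp (-(1 / 4) * x ^ 2) := by
      rw [← Real.exp_add, ← Real.exp_add, Real.exp_le_exp]
      nlinarith [sq_nonneg (|x| / 2 - c), sq_abs x]
    rw [Real.norm_eq_abs, abs_of_nonneg (by positivity), norm_mul, Complex.norm_real,
      Real.norm_eq_abs, Real.abs_exp]
    nlinarith [mul_le_mul_of_nonneg_left h3 (norm_nonneg (g x))]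

/-- Expanding the exponential in the Fourier transform of g e^{-x²/2} and integrating termwise
produces only moments, so the transform vanishes identically. -/
theorem ae_eq_zero_of_moments_eq_zero {g : ℝ → ℂ} (hg : MemLp g 2)
    (h : ∀ k : ℕ, ∫ x : ℝ, g x * (Real.exp (-x ^ 2 / 2) : ℂ) * (x : ℂ) ^ k = 0) :
    g =ᵐ[volume] 0 := by
  set f : ℝ → ℂ := fun x => g x * (Real.exp (-x ^ 2 / 2) : ℂ) with hf
  have hfm : AEStronglyMeasurable f := hg.aestronglyMeasurable.mul (by fun_prop)
  have hfi : Integrable f := by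
    have := integrable_exp_abs_mul hg 0
    simp only [zero_mul, Real.exp_zero, mul_one] at this
    exact (integrable_norm_iff hfm).1 this
  have hz : f =ᵐ[volume] 0 := by
    refine ae_eq_zero_of_fourier_eq_zero hfi fun w => ?_
    rw [Real.fourier_eq']
    have hs := hasSum_integral_of_dominated_convergence (μ := volume)
      (F := fun (k : ℕ) (x : ℝ) => f x * ((((-2 * Real.pi * w * x : ℝ) : ℂ) * Complex.I) ^ k / k.factorial))
      (f := fun x => f x * Complex.exp (((-2 * Real.pi * w * x : ℝ) : ℂ) * Complex.I))
      (fun k x => ‖f x‖ * ((|2 * Real.pi * w| * |x|) ^ k / k.factorial))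
      (fun k => hfm.mul (by fun_prop))
      (fun k => Filter.Eventually.of_forall fun x => by
        have e : ‖((-2 * Real.pi * w * x : ℝ) : ℂ) * Complex.I‖ = |2 * Real.pi * w| * |x| := by
          rw [norm_mul, Complex.norm_I, mul_one, Complex.norm_real, Real.norm_eq_abs, ← abs_mul,
            ← abs_neg]
          congr 1; ring
        rw [norm_mul (f x), norm_div, norm_pow, e, Complex.norm_natCast])
      (Filter.Eventually.of_forall fun x => (Real.summable_pow_div_factorial _).mul_left _)
      (by
        have e : (fun x : ℝ => ∑' k : ℕ, ‖f x‖ * ((|2 * Real.pi * w| * |x|) ^ k / k.factorial)) =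
            fun x => ‖f x‖ * Real.exp (|2 * Real.pi * w| * |x|) := by
          ext x
          rw [tsum_mul_left, Real.exp_eq_exp_ℝ, NormedSpace.exp_eq_tsum_div]
        rw [e]
        exact integrable_exp_abs_mul hg _)
      (Filter.Eventually.of_forall fun x => by
        refine HasSum.mul_left _ ?_
        rw [Complex.exp_eq_exp_ℂ]
        exact NormedSpace.expSeries_div_hasSum_exp _)
    have hzero (k : ℕ) : ∫ x : ℝ, f x * ((((-2 * Real.pi * w * x : ℝ) : ℂ) * Complex.I) ^ k /
        k.factorial) = 0 := by
      have e : (fun x : ℝ => f x * ((((-2 * Real.pi * w * x : ℝ) : ℂ) * Complex.I) ^ k /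
          k.factorial)) = fun x => ((((-2 * Real.pi * w : ℝ) : ℂ) * Complex.I) ^ k / k.factorial) *
            (f x * (x : ℂ) ^ k) := by
        ext x
        rw [Complex.ofReal_mul _ x, mul_right_comm, mul_pow]; ring
      rw [e, integral_const_mul, h k, mul_zero]
    simp only [hzero] at hs
    rw [← hs.unique hasSum_zero]
    congr 1; ext x
    rw [smul_eq_mul, mul_comm]
    congr 3
    simp only [RCLike.inner_apply, conj_trivial]
    push_cast; ring
  filter_upwards [hz] with x hx
  have : (Real.exp (-x ^ 2 / 2) : ℂ) ≠ 0 := by exact_mod_cast (Real.exp_pos _).ne'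
  simpa [hf, this] using hx

theorem integrable_mul_pow_mul_polyGauss {g : ℝ → ℂ} (hg : MemLp g 2) (p : Polynomial ℝ) :
    Integrable fun x : ℝ => g x * (polyGauss p x : ℂ) := by
  have h : MemLp (fun x => (polyGauss p x : ℂ)) 2 := by
    have h0 : MemLp (polyGauss p) 2 := by
      rw [memLp_two_iff_integrable_sq (continuous_polyGauss p).aestronglyMeasurable]
      simpa only [sq] using integrable_polyGauss_mul p p
    exact h0.ofReal
  exact hg.integrable_mul h

/-- The Hermite functions are complete in `L²(ℝ)`. -/
theorem ae_eq_zero_of_integral_hermiteFn_eq_zero {g : ℝ → ℂ} (hg : MemLp g 2)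
    (h : ∀ n : ℕ, ∫ x : ℝ, g x * (hermiteFn n x : ℂ) = 0) : g =ᵐ[volume] 0 := by
  have h1 (n : ℕ) : ∫ x : ℝ, g x * (polyGauss (rodriguesPoly n) x : ℂ) = 0 := by
    have h2 := h n
    have hc : (hermiteConst n : ℂ) ≠ 0 := by
      intro h0
      have h0' : hermiteConst n = 0 := by exact_mod_cast h0
      have := hermiteConst_sq n
      simp [h0'] at this
    have e : (fun x : ℝ => g x * (hermiteFn n x : ℂ)) = fun x => (hermiteConst n : ℂ) *
        (g x * (polyGauss (rodriguesPoly n) x : ℂ)) := by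
      ext x
      rw [hermiteFn_eq]
      simp only [polyGauss, Polynomial.eval_mul, Polynomial.eval_C]
      push_cast; ring
    rw [e, integral_const_mul] at h2
    exact (mul_eq_zero.1 h2).resolve_left hc
  have h2 (k : ℕ) : ∀ n, ∫ x : ℝ, g x *
      (polyGauss (Polynomial.X ^ k * rodriguesPoly n) x : ℂ) = 0 := by
    induction k with
    | zero => simpa using h1
    | succ k ih =>
      intro n
      -- The three-term recurrence x qₙ = -n qₙ₋₁ - qₙ₊₁/2 lowers the power of x at the cost of
      -- shifting n, which is why the induction on k runs over all n at once.
      have e : (fun x : ℝ => g x * (polyGauss (Polynomial.X ^ (k + 1) * rodriguesPoly n) x : ℂ)) =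
          fun x => (-(n : ℂ)) * (g x *
              (polyGauss (Polynomial.X ^ k * rodriguesPoly (n - 1)) x : ℂ)) -
            (1 / 2 : ℂ) * (g x *
              (polyGauss (Polynomial.X ^ k * rodriguesPoly (n + 1)) x : ℂ)) := by
        ext x
        rw [rodriguesPoly_succ, derivative_rodriguesPoly]
        simp only [polyGauss, Polynomial.eval_mul, Polynomial.eval_sub, Polynomial.eval_X,
          Polynomial.eval_C, Polynomial.eval_pow, Polynomial.eval_ofNat]
        push_cast; ring
      rw [e, integral_sub ((integrable_mul_pow_mul_polyGauss hg _).const_mul _)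
        ((integrable_mul_pow_mul_polyGauss hg _).const_mul _), integral_const_mul,
        integral_const_mul, ih, ih]
      simp
  refine ae_eq_zero_of_moments_eq_zero hg fun k => ?_
  rw [← h2 k 0]
  congr 1; ext x
  simp only [polyGauss, rodriguesPoly, Polynomial.eval_mul, Polynomial.eval_pow, Polynomial.eval_X,
    Polynomial.eval_one]
  push_cast; ring

theorem memLp_hermiteFn (n : ℕ) : MemLp (fun x => (hermiteFn n x : ℂ)) 2 := by
  have h0 : MemLp (hermiteFn n) 2 := by
    rw [memLp_two_iff_integrable_sq (continuous_hermiteFn n).aestronglyMeasurable]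
    have := integrable_polyGauss_mul (Polynomial.C (hermiteConst n) * rodriguesPoly n)
      (Polynomial.C (hermiteConst n) * rodriguesPoly n)
    simpa only [sq, hermiteFn_eq'] using this
  exact h0.ofReal

theorem inner_hermite_toLp {g : ℝ → ℂ} (hg : MemLp g 2) (n : ℕ) :
    inner ℂ ((memLp_hermiteFn n).toLp _) (hg.toLp _) = ∫ x : ℝ, g x * (hermiteFn n x : ℂ) := by
  rw [L2.inner_def]
  refine integral_congr_ae ?_
  filter_upwards [hg.coeFn_toLp, (memLp_hermiteFn n).coeFn_toLp] with x h1 h2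
  rw [h1, h2]
  simp

theorem orthonormal_hermite : Orthonormal ℂ fun n : ℕ => (memLp_hermiteFn n).toLp _ := by
  rw [orthonormal_iff_ite]
  intro n m
  rw [inner_hermite_toLp]
  have := integral_hermiteFn_mul m n
  simp only [← Complex.ofReal_mul]
  rw [integral_complex_ofReal, this]
  by_cases h : n = m
  · simp [h]
  · simp [h, Ne.symm h]

/-- The Hilbert basis of `L²(ℝ)` of Hermite functions. -/
noncomputable def hermiteBasis : HilbertBasis ℕ ℂ (Lp ℂ 2 (volume : Measure ℝ)) :=
  HilbertBasis.mkOfOrthogonalEqBot orthonormal_hermite (by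
    rw [Submodule.eq_bot_iff]
    intro g hg
    rw [Submodule.mem_orthogonal] at hg
    have h := ae_eq_zero_of_integral_hermiteFn_eq_zero (Lp.memLp g) fun n => by
      rw [← inner_hermite_toLp (Lp.memLp g), Lp.toLp_coeFn]
      exact hg _ (Submodule.subset_span ⟨n, rfl⟩)
    exact Lp.ext (h.trans (Lp.coeFn_zero ℂ 2 volume).symm))

theorem tsum_enorm_sq_hermite {g : ℝ → ℂ} (hg : MemLp g 2) :
    ∑' n : ℕ, ‖∫ x : ℝ, g x * (hermiteFn n x : ℂ)‖ₑ ^ 2 = ∫⁻ x, ‖g x‖ₑ ^ 2 := by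
  have h1 := hermiteBasis.hasSum_inner_mul_inner (hg.toLp _) (hg.toLp _)
  have h2 (n : ℕ) : inner ℂ (hg.toLp _) (hermiteBasis n) * inner ℂ (hermiteBasis n) (hg.toLp _) =
      ((‖∫ x : ℝ, g x * (hermiteFn n x : ℂ)‖ ^ 2 : ℝ) : ℂ) := by
    rw [← inner_conj_symm, Complex.conj_mul']
    have : hermiteBasis n = (memLp_hermiteFn n).toLp _ := by
      rw [hermiteBasis, HilbertBasis.coe_mkOfOrthogonalEqBot]
    rw [this, inner_hermite_toLp]
    norm_cast
  simp only [h2, inner_self_eq_norm_sq_to_K] at h1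
  have h3 : HasSum (fun n : ℕ => ‖∫ x : ℝ, g x * (hermiteFn n x : ℂ)‖ ^ 2) (‖hg.toLp g‖ ^ 2) := by
    refine Complex.hasSum_ofReal.mp ?_
    rw [Complex.ofReal_pow]
    exact h1
  have h4 : ∑' n : ℕ, ‖∫ x : ℝ, g x * (hermiteFn n x : ℂ)‖ₑ ^ 2 =
      ENNReal.ofReal (‖hg.toLp g‖ ^ 2) := by
    rw [← h3.tsum_eq, ENNReal.ofReal_tsum_of_nonneg (fun n => by positivity) h3.summable]
    congr 1; ext n
    rw [ENNReal.ofReal_pow (norm_nonneg _), ofReal_norm]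
  rw [h4]
  have h5 := norm_mulLp_indicator_sq MeasurableSet.univ (hg.toLp g)
  rw [mulLp_univ, Measure.restrict_univ] at h5
  rw [one_apply_eq_self] at h5
  rw [h5]
  refine lintegral_congr_ae ?_
  filter_upwards [hg.coeFn_toLp] with x hx
  rw [hx]

end HermiteCompleteness

/-! ### Generalized eigenfunctions and the coefficient transform -/

section Kernel

/-- The σ-algebra of the units is pulled back from ℤ, hence discrete; with it every function of (ε,
n) is measurable. -/
instance : DiscreteMeasurableSpace ℤˣ :=
  ⟨fun s => ⟨Units.val '' s, MeasurableSet.of_discrete, Set.preimage_image_eq _ Units.val_injective⟩⟩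

theorem signVal_mul_self (ε : ℤˣ) : signVal ε * signVal ε = 1 := by
  rcases Int.units_eq_one_or ε with rfl | rfl <;> simp [signVal]

theorem abs_signVal (ε : ℤˣ) : |signVal ε| = 1 := by
  rcases Int.units_eq_one_or ε with rfl | rfl <;> simp [signVal]

/-- The generalized joint eigenfunctions `λ^{1/4} (2π)^{-1/2} e^{-iελu} hₙ(λ^{1/2} x)`,
with `i = (ε, n)` and `p = (x, u)`. -/
noncomputable def rayWave (i : ℤˣ × ℕ) (l : ℝ) (p : ℝ × ℝ) : ℂ :=
  ((√(√l) / √(2 * Real.pi) : ℝ) : ℂ) * Complex.exp (-(Complex.I * ((signVal i.1 * l * p.2 : ℝ) : ℂ))) *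
    ((hermiteFn i.2 (√l * p.1) : ℝ) : ℂ)

attribute [irreducible] rayWave

/-- The parameter measure: counting measure in `(ε, n)`, Lebesgue measure in `λ > 0`. -/
noncomputable def rayMeasure : Measure ((ℤˣ × ℕ) × ℝ) :=
  Measure.count.prod (volume.restrict (Ioi 0))

instance : SFinite rayMeasure := by unfold rayMeasure; infer_instance

/-- The kernel has rank one, so P_{λ,n,ε} f is a coefficient of f times an eigenfunction. -/
theorem rayKernel_eq (l : ℝ) (n : ℕ) (ε : ℤˣ) (q p : ℝ × ℝ) :
    rayKernel l n ε q p = rayWave (ε, n) l p * starRingEnd ℂ (rayWave (ε, n) l q) := by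
  have h1 : ((√l / (2 * Real.pi) : ℝ) : ℂ) =
      ((√(√l) / √(2 * Real.pi) : ℝ) : ℂ) * ((√(√l) / √(2 * Real.pi) : ℝ) : ℂ) := by
    rw [← Complex.ofReal_mul, div_mul_div_comm, Real.mul_self_sqrt (Real.sqrt_nonneg l),
      Real.mul_self_sqrt (by positivity)]
  have h2 : Complex.exp (-(Complex.I * ((signVal ε * l * (p.2 - q.2) : ℝ) : ℂ))) =
      Complex.exp (-(Complex.I * ((signVal ε * l * p.2 : ℝ) : ℂ))) *
        Complex.exp (Complex.I * ((signVal ε * l * q.2 : ℝ) : ℂ)) := by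
    rw [← Complex.exp_add]; congr 1; push_cast; ring
  simp only [rayKernel, rayWave, h1, h2, map_mul, Complex.conj_ofReal, ← Complex.exp_conj, map_neg,
    Complex.conj_I]
  push_cast
  ring_nf

theorem norm_rayWave (i : ℤˣ × ℕ) (l : ℝ) (p : ℝ × ℝ) :
    ‖rayWave i l p‖ = √(√l) / √(2 * Real.pi) * |hermiteFn i.2 (√l * p.1)| := by
  rw [rayWave, norm_mul, norm_mul, Complex.norm_real, Complex.norm_real, ← mul_neg,
    ← Complex.ofReal_neg, mul_comm Complex.I, Complex.norm_exp_ofReal_mul_I, mul_one,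
    Real.norm_eq_abs, Real.norm_eq_abs, abs_of_nonneg (by positivity)]

theorem continuous_rayWave (i : ℤˣ × ℕ) : Continuous fun q : ℝ × (ℝ × ℝ) => rayWave i q.1 q.2 := by
  have := continuous_hermiteFn i.2
  unfold rayWave
  fun_prop

theorem continuous_rayWave_right (i : ℤˣ × ℕ) (l : ℝ) : Continuous (rayWave i l) :=
  (continuous_rayWave i).comp (Continuous.prodMk_right l)

theorem measurable_rayWave :
    Measurable fun q : ((ℤˣ × ℕ) × ℝ) × (ℝ × ℝ) => rayWave q.1.1 q.1.2 q.2 := by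
  have h : Measurable fun q : (ℤˣ × ℕ) × (ℝ × (ℝ × ℝ)) => rayWave q.1 q.2.1 q.2.2 :=
    measurable_from_prod_countable_right
      (f := fun q : (ℤˣ × ℕ) × (ℝ × (ℝ × ℝ)) => rayWave q.1 q.2.1 q.2.2)
      fun i => (continuous_rayWave i).measurable
  have h2 : Measurable fun q : ((ℤˣ × ℕ) × ℝ) × (ℝ × ℝ) => (q.1.1, (q.1.2, q.2)) := by fun_prop
  exact h.comp h2

theorem exists_norm_rayWave_le (i : ℤˣ × ℕ) :
    ∃ C : ℝ, 0 ≤ C ∧ ∀ l p, ‖rayWave i l p‖ ≤ C * √(√l) := by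
  obtain ⟨C, hC⟩ := exists_abs_hermiteFn_le i.2
  have h0 : 0 ≤ C := (abs_nonneg _).trans (hC 0)
  refine ⟨C / √(2 * Real.pi), by positivity, fun l p => ?_⟩
  rw [norm_rayWave, div_mul_eq_mul_div, div_mul_eq_mul_div, mul_comm]
  gcongr
  exact hC _

/-- The coefficient `∫ conj(rayWave) f`. -/
noncomputable def rayCoeff (f : ℝ × ℝ → ℂ) (i : ℤˣ × ℕ) (l : ℝ) : ℂ :=
  ∫ q, starRingEnd ℂ (rayWave i l q) * f q

theorem rayOp_eq (l : ℝ) (n : ℕ) (ε : ℤˣ) (f : 𝓢(ℝ × ℝ, ℂ)) (p : ℝ × ℝ) :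
    rayOp l n ε f p = rayCoeff f (ε, n) l * rayWave (ε, n) l p := by
  rw [rayOp, rayCoeff, ← integral_mul_const]
  congr 1; ext q
  rw [rayKernel_eq]; ring

theorem integrable_conj_rayWave_mul (i : ℤˣ × ℕ) (l : ℝ) {f : ℝ × ℝ → ℂ} (hf : Integrable f) :
    Integrable fun q => starRingEnd ℂ (rayWave i l q) * f q := by
  obtain ⟨C, -, hC⟩ := exists_norm_rayWave_le i
  refine hf.bdd_mul (c := C * √(√l))
    (Complex.continuous_conj.comp (continuous_rayWave_right i l)).aestronglyMeasurable
    (Filter.Eventually.of_forall fun q => ?_)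
  rw [RCLike.norm_conj]
  exact hC l q

theorem stronglyMeasurable_rayCoeff (f : 𝓢(ℝ × ℝ, ℂ)) :
    StronglyMeasurable fun k : (ℤˣ × ℕ) × ℝ => rayCoeff f k.1 k.2 := by
  have h : StronglyMeasurable fun q : ((ℤˣ × ℕ) × ℝ) × (ℝ × ℝ) =>
      starRingEnd ℂ (rayWave q.1.1 q.1.2 q.2) * f q.2 :=
    ((Complex.continuous_conj.measurable.comp measurable_rayWave).mul
      (f.continuous.measurable.comp measurable_snd)).stronglyMeasurable
  exact h.integral_prod_right (ν := volume)

theorem lineDerivOp_hasLineDerivAt (f : 𝓢(ℝ × ℝ, ℂ)) (v p : ℝ × ℝ) :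
    HasLineDerivAt ℝ f (∂_{v} f p) p v := by
  rw [SchwartzMap.lineDerivOp_apply_eq_fderiv]
  exact (f.hasFDerivAt p).hasLineDerivAt v

/-- The eigenfunctions are bounded but not integrable on the plane; the Schwartz factor makes every
product integrable, and no boundary terms appear. -/
theorem integral_mul_lineDerivOp {w w' : ℝ × ℝ → ℂ} {C C' : ℝ} (hw : Continuous w)
    (hw' : Continuous w') (hC : ∀ p, ‖w p‖ ≤ C) (hC' : ∀ p, ‖w' p‖ ≤ C') {v : ℝ × ℝ}
    (hd : ∀ p, HasLineDerivAt ℝ w (w' p) p v) (f : 𝓢(ℝ × ℝ, ℂ)) :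
    ∫ p, w p * ∂_{v} f p = -∫ p, w' p * f p := by
  have hi {w : ℝ × ℝ → ℂ} {C : ℝ} (hw : Continuous w) (hC : ∀ p, ‖w p‖ ≤ C) (f : 𝓢(ℝ × ℝ, ℂ)) :
      Integrable fun p => w p * f p :=
    f.integrable.bdd_mul hw.aestronglyMeasurable (Filter.Eventually.of_forall hC)
  exact integral_bilinear_hasLineDerivAt_right_eq_neg_left_of_integrable
    (B := ContinuousLinearMap.mul ℝ ℂ) (hi hw' hC' f) (hi hw hC _) (hi hw hC f)
    (fun p _ => hd p) (fun p _ => lineDerivOp_hasLineDerivAt f v p)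

theorem hasLineDerivAt_conj_rayWave_snd (i : ℤˣ × ℕ) (l : ℝ) (p : ℝ × ℝ) :
    HasLineDerivAt ℝ (fun q => starRingEnd ℂ (rayWave i l q))
      (Complex.I * ((signVal i.1 * l : ℝ) : ℂ) * starRingEnd ℂ (rayWave i l p)) p (0, 1) := by
  have e (q : ℝ × ℝ) : starRingEnd ℂ (rayWave i l q) =
      ((√(√l) / √(2 * Real.pi) : ℝ) : ℂ) *
        Complex.exp (Complex.I * ((signVal i.1 * l : ℝ) : ℂ) * (q.2 : ℂ)) *
        ((hermiteFn i.2 (√l * q.1) : ℝ) : ℂ) := by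
    simp only [rayWave, map_mul, Complex.conj_ofReal, ← Complex.exp_conj, map_neg, Complex.conj_I]
    push_cast
    ring_nf
  simp only [HasLineDerivAt, e]
  have h1 : HasDerivAt (fun t : ℝ => ((p + t • ((0 : ℝ), (1 : ℝ))).2 : ℂ)) 1 0 := by
    have : HasDerivAt (fun t : ℝ => p.2 + t) 1 0 := (hasDerivAt_id 0).const_add p.2
    simpa using this.ofReal_comp
  have h2 := ((h1.const_mul (Complex.I * ((signVal i.1 * l : ℝ) : ℂ))).cexp.const_mul
    ((√(√l) / √(2 * Real.pi) : ℝ) : ℂ)).mul_const ((hermiteFn i.2 (√l * p.1) : ℝ) : ℂ)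
  have h3 : (fun t : ℝ => ((√(√l) / √(2 * Real.pi) : ℝ) : ℂ) *
        Complex.exp (Complex.I * ((signVal i.1 * l : ℝ) : ℂ) *
          ((p + t • ((0 : ℝ), (1 : ℝ))).2 : ℂ)) *
        ((hermiteFn i.2 (√l * (p + t • ((0 : ℝ), (1 : ℝ))).1) : ℝ) : ℂ)) =
      fun t : ℝ => ((√(√l) / √(2 * Real.pi) : ℝ) : ℂ) *
        Complex.exp (Complex.I * ((signVal i.1 * l : ℝ) : ℂ) *
          ((p + t • ((0 : ℝ), (1 : ℝ))).2 : ℂ)) * ((hermiteFn i.2 (√l * p.1) : ℝ) : ℂ) := by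
    ext t; simp
  rw [h3]
  refine h2.congr_deriv ?_
  simp
  ring

theorem rayCoeff_partialU (f : 𝓢(ℝ × ℝ, ℂ)) (i : ℤˣ × ℕ) (l : ℝ) :
    rayCoeff (partialU f) i l = -(Complex.I * ((signVal i.1 * l : ℝ) : ℂ)) * rayCoeff f i l := by
  obtain ⟨C, -, hC⟩ := exists_norm_rayWave_le i
  have hc : Continuous fun q => starRingEnd ℂ (rayWave i l q) :=
    Complex.continuous_conj.comp (continuous_rayWave_right i l)
  have h := integral_mul_lineDerivOp (w' := fun q =>
      Complex.I * ((signVal i.1 * l : ℝ) : ℂ) * starRingEnd ℂ (rayWave i l q))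
    hc (continuous_const.mul hc) (fun p => by rw [RCLike.norm_conj]; exact hC l p)
    (fun p => by
      rw [norm_mul, RCLike.norm_conj]
      exact mul_le_mul_of_nonneg_left (hC l p) (norm_nonneg _))
    (hasLineDerivAt_conj_rayWave_snd i l) f
  change ∫ q, starRingEnd ℂ (rayWave i l q) * ∂_{((0 : ℝ), (1 : ℝ))} f q = _
  rw [h, rayCoeff, ← integral_const_mul, ← integral_neg]
  congr 1; ext q; ring

/-- Two integrations by parts put both derivatives on hₙ(√λ x), where the rescaled Hermite equation
gives the factor λ²x² - (2n+1)λ. The x² is then moved onto f. -/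
theorem rayCoeff_partialX_partialX (f : 𝓢(ℝ × ℝ, ℂ)) (i : ℤˣ × ℕ) {l : ℝ} (hl : 0 ≤ l) :
    rayCoeff (partialX (partialX f)) i l = ((l ^ 2 : ℝ) : ℂ) * rayCoeff (mulXSq f) i l -
      (((2 * i.2 + 1) * l : ℝ) : ℂ) * rayCoeff f i l := by
  obtain ⟨h', hc', ⟨C', hC'⟩, hd, hd', C'', hC''⟩ := hermiteFn_ode i.2
  obtain ⟨C, hC⟩ := exists_abs_hermiteFn_le i.2
  have hch := continuous_hermiteFn i.2
  let a : ℝ × ℝ → ℂ := fun q => ((√(√l) / √(2 * Real.pi) : ℝ) : ℂ) *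
    Complex.exp (((signVal i.1 * l * q.2 : ℝ) : ℂ) * Complex.I)
  have ha : Continuous a := by simp only [a]; fun_prop
  have han (q : ℝ × ℝ) : ‖a q‖ = √(√l) / √(2 * Real.pi) := by
    simp only [a]
    rw [norm_mul, Complex.norm_exp_ofReal_mul_I, mul_one, Complex.norm_real, Real.norm_eq_abs,
      abs_of_nonneg (by positivity)]
  have e (q : ℝ × ℝ) : starRingEnd ℂ (rayWave i l q) = a q * (hermiteFn i.2 (√l * q.1) : ℝ) := by
    simp only [a, rayWave, map_mul, Complex.conj_ofReal, ← Complex.exp_conj, map_neg,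
      Complex.conj_I]
    push_cast
    ring_nf
  have hline {φ φ' : ℝ → ℝ} (hφ : ∀ x, HasDerivAt φ (φ' x) x) (p : ℝ × ℝ) :
      HasLineDerivAt ℝ (fun q : ℝ × ℝ => a q * (φ (√l * q.1) : ℂ))
        (a p * ((√l * φ' (√l * p.1) : ℝ) : ℂ)) p (1, 0) := by
    simp only [HasLineDerivAt]
    have h0 : HasDerivAt (fun t : ℝ => √l * (p.1 + t)) (√l) 0 := by
      simpa using ((hasDerivAt_id (0 : ℝ)).const_add p.1).const_mul (√l)
    have h1 := ((hφ (√l * (p.1 + 0))).comp 0 h0).ofReal_comp.const_mul (a p)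
    have h3 : (fun t : ℝ => a (p + t • ((1 : ℝ), (0 : ℝ))) *
        (φ (√l * (p + t • ((1 : ℝ), (0 : ℝ))).1) : ℂ)) =
        fun t : ℝ => a p * ((φ (√l * (p.1 + t)) : ℝ) : ℂ) := by
      ext t; simp [a]
    rw [h3]
    refine h1.congr_deriv ?_
    rw [add_zero, mul_comm (φ' _)]
  have hb {φ : ℝ → ℝ} {D : ℝ} (hφ : ∀ x, |φ x| ≤ D) (q : ℝ × ℝ) :
      ‖a q * (φ (√l * q.1) : ℂ)‖ ≤ √(√l) / √(2 * Real.pi) * D := by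
    rw [norm_mul, han, Complex.norm_real, Real.norm_eq_abs]
    gcongr
    exact hφ _
  have hs {φ : ℝ → ℝ} {D : ℝ} (hφ : ∀ x, |φ x| ≤ D) (x : ℝ) : |√l * φ x| ≤ √l * D := by
    rw [abs_mul, abs_of_nonneg (Real.sqrt_nonneg l)]
    gcongr
    exact hφ _
  have s1 := integral_mul_lineDerivOp (w := fun q : ℝ × ℝ => a q * (hermiteFn i.2 (√l * q.1) : ℂ))
    (w' := fun q : ℝ × ℝ => a q * ((√l * h' (√l * q.1) : ℝ) : ℂ)) (by fun_prop) (by fun_prop)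
    (hb hC) (hb (φ := fun x => √l * h' x) (hs hC')) (hline hd) (partialX f)
  have s2 := integral_mul_lineDerivOp (w := fun q : ℝ × ℝ => a q * ((√l * h' (√l * q.1) : ℝ) : ℂ))
    (w' := fun q : ℝ × ℝ => a q * ((√l * (√l * (((√l * q.1) ^ 2 - (2 * i.2 + 1)) *
      hermiteFn i.2 (√l * q.1))) : ℝ) : ℂ)) (by fun_prop) (by fun_prop)
    (hb (φ := fun x => √l * h' x) (hs hC'))
    (hb (φ := fun x => √l * (√l * ((x ^ 2 - (2 * i.2 + 1)) * hermiteFn i.2 x))) (hs (hs hC'')))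
    (hline (φ := fun x => √l * h' x) fun x => (hd' x).const_mul (√l)) f
  have i1 := (integrable_conj_rayWave_mul i l (mulXSq f).integrable).const_mul ((l ^ 2 : ℝ) : ℂ)
  have i2 := (integrable_conj_rayWave_mul i l f.integrable).const_mul (((2 * i.2 + 1) * l : ℝ) : ℂ)
  simp only [rayCoeff]
  rw [← integral_const_mul, ← integral_const_mul, ← integral_sub i1 i2]
  simp only [e]
  change ∫ q, (a q * (hermiteFn i.2 (√l * q.1) : ℂ)) * ∂_{((1 : ℝ), (0 : ℝ))} (partialX f) q = _
  rw [s1]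
  change -∫ q, (a q * ((√l * h' (√l * q.1) : ℝ) : ℂ)) * ∂_{((1 : ℝ), (0 : ℝ))} f q = _
  rw [s2, neg_neg]
  congr 1; ext q
  have hl2 : (√l : ℂ) * (√l : ℂ) = (l : ℂ) := by
    rw [← Complex.ofReal_mul, Real.mul_self_sqrt hl]
  rw [mulXSq_apply]
  push_cast
  linear_combination (a q * f q * (hermiteFn i.2 (√l * q.1) : ℂ) *
    ((q.1 : ℂ) ^ 2 * ((√l : ℂ) * (√l : ℂ) + l) - (2 * (i.2 : ℂ) + 1))) * hl2

theorem mulXSq_partialU (f : 𝓢(ℝ × ℝ, ℂ)) : mulXSq (partialU f) = partialU (mulXSq f) := by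
  ext p
  rw [mulXSq_apply]
  have h1 := lineDerivOp_hasLineDerivAt f (0, 1) p
  have h2 := lineDerivOp_hasLineDerivAt (mulXSq f) (0, 1) p
  have h3 : HasLineDerivAt ℝ (mulXSq f)
      (((p.1 ^ 2 : ℝ) : ℂ) * ∂_{((0 : ℝ), (1 : ℝ))} f p) p (0, 1) := by
    simp only [HasLineDerivAt, mulXSq_apply] at h1 ⊢
    have := h1.const_mul ((p.1 ^ 2 : ℝ) : ℂ)
    refine this.congr_of_eventuallyEq (Filter.Eventually.of_forall fun t => ?_)
    simp
  exact h3.unique h2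

/-- The Grušin operator on Schwartz functions. -/
noncomputable def grushinSchwartz : 𝓢(ℝ × ℝ, ℂ) →ₗ[ℂ] 𝓢(ℝ × ℝ, ℂ) :=
  -(partialX ∘ₗ partialX + mulXSq ∘ₗ partialU ∘ₗ partialU)

theorem rayCoeff_neg (f : 𝓢(ℝ × ℝ, ℂ)) (i : ℤˣ × ℕ) (l : ℝ) :
    rayCoeff (-f : 𝓢(ℝ × ℝ, ℂ)) i l = -rayCoeff f i l := by
  rw [rayCoeff, rayCoeff, ← integral_neg]
  congr 1; ext q; simp

theorem rayCoeff_add (f g : 𝓢(ℝ × ℝ, ℂ)) (i : ℤˣ × ℕ) (l : ℝ) :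
    rayCoeff (f + g : 𝓢(ℝ × ℝ, ℂ)) i l = rayCoeff f i l + rayCoeff g i l := by
  rw [rayCoeff, rayCoeff, rayCoeff, ← integral_add (integrable_conj_rayWave_mul i l f.integrable)
    (integrable_conj_rayWave_mul i l g.integrable)]
  congr 1; ext q; simp [mul_add]

theorem rayCoeff_smul (c : ℂ) (f : 𝓢(ℝ × ℝ, ℂ)) (i : ℤˣ × ℕ) (l : ℝ) :
    rayCoeff (c • f : 𝓢(ℝ × ℝ, ℂ)) i l = c * rayCoeff f i l := by
  rw [rayCoeff, rayCoeff, ← integral_const_mul]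
  congr 1; ext q; simp; ring

/-- The term λ²x² from ∂ₓ² cancels against x²∂ᵤ², since ∂ᵤ² contributes (-iελ)² = -λ². Only (2n+1)λ
survives. -/
theorem rayCoeff_grushin (f : 𝓢(ℝ × ℝ, ℂ)) (i : ℤˣ × ℕ) {l : ℝ} (hl : 0 ≤ l) :
    rayCoeff (grushinSchwartz f) i l = (((2 * i.2 + 1) * l : ℝ) : ℂ) * rayCoeff f i l := by
  have h1 : grushinSchwartz f = -(partialX (partialX f) + partialU (partialU (mulXSq f))) := by
    rw [← mulXSq_partialU, ← mulXSq_partialU]; rfl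
  have h2 : ((signVal i.1 : ℝ) : ℂ) * ((signVal i.1 : ℝ) : ℂ) = 1 := by
    rw [← Complex.ofReal_mul, signVal_mul_self, Complex.ofReal_one]
  rw [h1, rayCoeff_neg, rayCoeff_add, rayCoeff_partialX_partialX f i hl, rayCoeff_partialU,
    rayCoeff_partialU]
  push_cast
  linear_combination (-(l : ℂ) ^ 2 * rayCoeff (mulXSq f) i l) *
    (((signVal i.1 : ℝ) : ℂ) * ((signVal i.1 : ℝ) : ℂ) * Complex.I_sq - h2)

theorem rayCoeff_iU (f : 𝓢(ℝ × ℝ, ℂ)) (i : ℤˣ × ℕ) (l : ℝ) :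
    rayCoeff ((Complex.I • partialU) f) i l = ((signVal i.1 * l : ℝ) : ℂ) * rayCoeff f i l := by
  rw [LinearMap.smul_apply, rayCoeff_smul, rayCoeff_partialU]
  linear_combination (-((signVal i.1 * l : ℝ) : ℂ) * rayCoeff f i l) * Complex.I_sq

end Kernel

/-! ### Plancherel formula for the coefficient transform -/

section Plancherel

theorem lintegral_rayMeasure {g : (ℤˣ × ℕ) × ℝ → ℝ≥0∞} (hg : Measurable g) :
    ∫⁻ k, g k ∂rayMeasure = ∑' i : ℤˣ × ℕ, ∫⁻ l in Ioi (0 : ℝ), g (i, l) := by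
  rw [rayMeasure, lintegral_prod _ hg.aemeasurable, lintegral_count]

theorem SchwartzMap.exists_norm_le_prod (f : 𝓢(ℝ × ℝ, ℂ)) :
    ∃ C : ℝ, 0 ≤ C ∧ ∀ p : ℝ × ℝ, ‖f p‖ ≤ C * ((1 + p.1 ^ 2)⁻¹ * (1 + p.2 ^ 2)⁻¹) := by
  set C := 2 ^ 4 * ((Finset.Iic (4, 0)).sup fun m : ℕ × ℕ => SchwartzMap.seminorm ℝ m.1 m.2) f with hC
  have h (p : ℝ × ℝ) : (1 + ‖p‖) ^ 4 * ‖f p‖ ≤ C := by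
    have := SchwartzMap.one_add_le_sup_seminorm_apply (𝕜 := ℝ) (m := (4, 0)) (k := 4) (n := 0)
      le_rfl le_rfl f p
    simpa using this
  refine ⟨C, (by positivity : (0 : ℝ) ≤ _).trans (h 0), fun p => ?_⟩
  have h1 : |p.1| ≤ ‖p‖ := norm_fst_le p
  have h2 : |p.2| ≤ ‖p‖ := norm_snd_le p
  have h3 : 1 + p.1 ^ 2 ≤ (1 + ‖p‖) ^ 2 := by
    nlinarith [sq_abs p.1, abs_nonneg p.1, norm_nonneg p]
  have h4 : 1 + p.2 ^ 2 ≤ (1 + ‖p‖) ^ 2 := by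
    nlinarith [sq_abs p.2, abs_nonneg p.2, norm_nonneg p]
  have h5 : (1 + p.1 ^ 2) * (1 + p.2 ^ 2) ≤ (1 + ‖p‖) ^ 4 := by
    calc _ ≤ (1 + ‖p‖) ^ 2 * (1 + ‖p‖) ^ 2 := by gcongr
      _ = _ := by ring
  rw [← mul_inv, ← div_eq_mul_inv, le_div_iff₀ (by positivity), mul_comm]
  exact (mul_le_mul_of_nonneg_right h5 (norm_nonneg _)).trans (h p)

/-- The restriction of a Schwartz function to a vertical line. -/
noncomputable def verticalSlice (f : 𝓢(ℝ × ℝ, ℂ)) (x : ℝ) : 𝓢(ℝ, ℂ) :=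
  SchwartzMap.compCLM ℂ (g := fun u : ℝ => (x, u))
    (by
      have h1 : (fun _ : ℝ => ((x, 0) : ℝ × ℝ)).HasTemperateGrowth :=
        Function.HasTemperateGrowth.const _
      have h2 := h1.add (ContinuousLinearMap.inr ℝ ℝ ℝ).hasTemperateGrowth
      convert h2 using 1
      ext u <;> simp)
    ⟨1, 1, fun u => by
      have : ‖u‖ ≤ ‖((x, u) : ℝ × ℝ)‖ := norm_snd_le (x, u)
      linarith⟩ f

theorem verticalSlice_apply (f : 𝓢(ℝ × ℝ, ℂ)) (x u : ℝ) : verticalSlice f x u = f (x, u) := rfl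

/-- The partial Fourier transform `∫ e^{iελu} f(x, u) du`. -/
noncomputable def partialFourier (f : ℝ × ℝ → ℂ) (ε : ℤˣ) (l x : ℝ) : ℂ :=
  ∫ u : ℝ, Complex.exp (Complex.I * ((signVal ε * l * u : ℝ) : ℂ)) * f (x, u)

open FourierTransform in
theorem partialFourier_eq (f : 𝓢(ℝ × ℝ, ℂ)) (ε : ℤˣ) (l x : ℝ) :
    partialFourier f ε l x = 𝓕 (verticalSlice f x) (-(signVal ε * ((2 * Real.pi)⁻¹ * l))) := by
  rw [SchwartzMap.fourier_coe, Real.fourier_eq']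
  simp only [partialFourier]
  congr 1; ext u
  rw [smul_eq_mul, verticalSlice_apply]
  congr 2
  have hpi := Real.pi_ne_zero
  simp only [RCLike.inner_apply, conj_trivial]
  rw [mul_comm Complex.I]
  congr 2
  field_simp

theorem norm_exp_I_mul (r : ℝ) : ‖Complex.exp (Complex.I * (r : ℂ))‖ = 1 := by
  rw [mul_comm, Complex.norm_exp_ofReal_mul_I]

theorem exists_norm_partialFourier_le (f : 𝓢(ℝ × ℝ, ℂ)) :
    ∃ C : ℝ, 0 ≤ C ∧ ∀ ε l x, ‖partialFourier f ε l x‖ ≤ C * (1 + x ^ 2)⁻¹ := by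
  obtain ⟨C, hC0, hC⟩ := f.exists_norm_le_prod
  refine ⟨C * Real.pi, by positivity, fun ε l x => ?_⟩
  have h1 : ‖partialFourier f ε l x‖ ≤ ∫ u : ℝ, C * (1 + x ^ 2)⁻¹ * (1 + u ^ 2)⁻¹ := by
    refine norm_integral_le_of_norm_le (integrable_inv_one_add_sq.const_mul _)
      (Filter.Eventually.of_forall fun u => ?_)
    rw [norm_mul, norm_exp_I_mul, one_mul, mul_assoc]
    exact hC (x, u)
  rw [integral_const_mul, integral_univ_inv_one_add_sq] at h1
  linarith

theorem continuous_partialFourier_integrand (f : 𝓢(ℝ × ℝ, ℂ)) (ε : ℤˣ) :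
    Continuous fun q : (ℝ × ℝ) × ℝ =>
      Complex.exp (Complex.I * ((signVal ε * q.1.1 * q.2 : ℝ) : ℂ)) * f (q.1.2, q.2) := by
  have := f.continuous
  fun_prop

theorem stronglyMeasurable_partialFourier (f : 𝓢(ℝ × ℝ, ℂ)) (ε : ℤˣ) :
    StronglyMeasurable fun q : ℝ × ℝ => partialFourier f ε q.1 q.2 :=
  (continuous_partialFourier_integrand f ε).stronglyMeasurable.integral_prod_right (ν := volume)

theorem stronglyMeasurable_partialFourier_right (f : 𝓢(ℝ × ℝ, ℂ)) (ε : ℤˣ) (l : ℝ) :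
    StronglyMeasurable (partialFourier f ε l) :=
  (stronglyMeasurable_partialFourier f ε).comp_measurable (measurable_prodMk_left (x := l))

theorem integrable_inv_one_add_sq_sq (C : ℝ) :
    Integrable fun x : ℝ => (C * (1 + x ^ 2)⁻¹) ^ 2 := by
  refine (integrable_inv_one_add_sq.const_mul (C ^ 2)).mono' (by fun_prop)
    (Filter.Eventually.of_forall fun x => ?_)
  have h : (1 + x ^ 2)⁻¹ ≤ 1 := inv_le_one_of_one_le₀ (by nlinarith [sq_nonneg x])
  have h0 : 0 ≤ (1 + x ^ 2)⁻¹ := by positivity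
  rw [Real.norm_eq_abs, abs_of_nonneg (by positivity), mul_pow]
  gcongr
  nlinarith

theorem integrable_partialFourier_sq (f : 𝓢(ℝ × ℝ, ℂ)) (ε : ℤˣ) (l : ℝ) :
    Integrable fun x => ‖partialFourier f ε l x‖ ^ 2 := by
  obtain ⟨C, hC0, hC⟩ := exists_norm_partialFourier_le f
  refine (integrable_inv_one_add_sq_sq C).mono'
    ((stronglyMeasurable_partialFourier_right f ε l).norm.pow 2).aestronglyMeasurable
    (Filter.Eventually.of_forall fun x => ?_)
  rw [Real.norm_eq_abs, abs_of_nonneg (by positivity)]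
  exact pow_le_pow_left₀ (norm_nonneg _) (hC ε l x) 2

theorem rayCoeff_eq_integral (f : 𝓢(ℝ × ℝ, ℂ)) (i : ℤˣ × ℕ) (l : ℝ) :
    rayCoeff f i l = ((√(√l) / √(2 * Real.pi) : ℝ) : ℂ) *
      ∫ x, (hermiteFn i.2 (√l * x) : ℂ) * partialFourier f i.1 l x := by
  have h := integrable_conj_rayWave_mul i l f.integrable
  rw [Measure.volume_eq_prod] at h
  rw [rayCoeff, Measure.volume_eq_prod, integral_prod _ h, ← integral_const_mul]
  congr 1; ext x
  rw [partialFourier, ← integral_const_mul, ← integral_const_mul]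
  congr 1; ext u
  simp only [rayWave, map_mul, Complex.conj_ofReal, ← Complex.exp_conj, map_neg, Complex.conj_I,
    neg_mul, neg_neg]
  ring

theorem lintegral_enorm_sq_eq {α : Type*} [MeasurableSpace α] {μ : Measure α} {g : α → ℂ}
    (hg : Integrable (fun x => ‖g x‖ ^ 2) μ) :
    ∫⁻ x, ‖g x‖ₑ ^ 2 ∂μ = ENNReal.ofReal (∫ x, ‖g x‖ ^ 2 ∂μ) := by
  rw [ofReal_integral_eq_lintegral_ofReal hg (Filter.Eventually.of_forall fun x => by positivity)]
  congr 1; ext x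
  rw [ENNReal.ofReal_pow (norm_nonneg _), ofReal_norm]

/-- After y = √λ x the coefficients are Hermite coefficients of a dilated partial Fourier transform.
Parseval applies, and the powers of λ from the normalization and from the dilation cancel. -/
theorem tsum_enorm_sq_rayCoeff (f : 𝓢(ℝ × ℝ, ℂ)) (ε : ℤˣ) {l : ℝ} (hl : 0 < l) :
    ∑' n : ℕ, ‖rayCoeff f (ε, n) l‖ₑ ^ 2 =
      ENNReal.ofReal (2 * Real.pi)⁻¹ * ∫⁻ x, ‖partialFourier f ε l x‖ₑ ^ 2 := by
  have hs : 0 < √l := Real.sqrt_pos.2 hl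
  set g : ℝ → ℂ := fun y => partialFourier f ε l ((√l)⁻¹ * y) with hg
  have hgi : Integrable fun y => ‖g y‖ ^ 2 :=
    (integrable_partialFourier_sq f ε l).comp_mul_left' (inv_ne_zero hs.ne')
  have hgm : AEStronglyMeasurable g := ((stronglyMeasurable_partialFourier_right f ε l).comp_measurable
    (measurable_const_mul (√l)⁻¹)).aestronglyMeasurable
  have hgL : MemLp g 2 := (memLp_two_iff_integrable_sq_norm hgm).2 hgi
  have h1 (n : ℕ) : rayCoeff f (ε, n) l =
      ((√(√l) / √(2 * Real.pi) * (√l)⁻¹ : ℝ) : ℂ) * ∫ y, g y * (hermiteFn n y : ℂ) := by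
    have h2 := Measure.integral_comp_mul_left (fun y => g y * (hermiteFn n y : ℂ)) (√l)
    rw [abs_of_pos (inv_pos.2 hs)] at h2
    rw [rayCoeff_eq_integral, Complex.ofReal_mul, mul_assoc, ← Complex.real_smul (x := (√l)⁻¹), ← h2]
    congr 2; ext x
    simp only [hg]
    rw [inv_mul_cancel_left₀ hs.ne', mul_comm]
  have h3 : ∫ y, ‖g y‖ ^ 2 = √l * ∫ x, ‖partialFourier f ε l x‖ ^ 2 := by
    have := Measure.integral_comp_mul_left (fun x => ‖partialFourier f ε l x‖ ^ 2) (√l)⁻¹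
    rw [inv_inv, abs_of_pos hs, smul_eq_mul] at this
    exact this
  simp only [h1, enorm_mul, mul_pow]
  rw [ENNReal.tsum_mul_left, tsum_enorm_sq_hermite hgL, lintegral_enorm_sq_eq hgi, h3,
    lintegral_enorm_sq_eq (integrable_partialFourier_sq f ε l), ← ofReal_norm, Complex.norm_real,
    Real.norm_eq_abs, ← ENNReal.ofReal_pow (abs_nonneg _), sq_abs, ENNReal.ofReal_mul hs.le,
    ← mul_assoc, ← ENNReal.ofReal_mul (by positivity)]
  congr 2
  have e1 : √(√l) ^ 2 = √l := Real.sq_sqrt hs.le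
  have e2 : √(2 * Real.pi) ^ 2 = 2 * Real.pi := Real.sq_sqrt (by positivity)
  rw [mul_pow, div_pow, e1, e2]
  field_simp

/-- The bound is uniform in λ, so a weight that is integrable in λ alone will suffice later. -/
theorem exists_tsum_enorm_sq_rayCoeff_le (f : 𝓢(ℝ × ℝ, ℂ)) :
    ∃ C : ℝ, 0 ≤ C ∧ ∀ (ε : ℤˣ) (l : ℝ), 0 < l →
      ∑' n : ℕ, ‖rayCoeff f (ε, n) l‖ₑ ^ 2 ≤ ENNReal.ofReal C := by
  obtain ⟨C, hC0, hC⟩ := exists_norm_partialFourier_le f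
  refine ⟨(2 * Real.pi)⁻¹ * ∫ x : ℝ, (C * (1 + x ^ 2)⁻¹) ^ 2,
    mul_nonneg (by positivity) (integral_nonneg fun x => by positivity), fun ε l hl => ?_⟩
  rw [tsum_enorm_sq_rayCoeff f ε hl, lintegral_enorm_sq_eq (integrable_partialFourier_sq f ε l),
    ← ENNReal.ofReal_mul (by positivity)]
  refine ENNReal.ofReal_le_ofReal (mul_le_mul_of_nonneg_left ?_ (by positivity))
  exact integral_mono (integrable_partialFourier_sq f ε l) (integrable_inv_one_add_sq_sq C)
    fun x => pow_le_pow_left₀ (norm_nonneg _) (hC ε l x) 2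

theorem sum_units_int {M : Type*} [AddCommMonoid M] (g : ℤˣ → M) : ∑ ε, g ε = g 1 + g (-1) := by
  have : (Finset.univ : Finset ℤˣ) = {1, -1} := rfl
  rw [this, Finset.sum_pair (by decide)]

-- The signs ε = ±1 cover the two half-lines of frequencies -ελ/(2π); the substitution produces the
-- factor 2π and Plancherel on ℝ does the rest.
open FourierTransform in
theorem tsum_lintegral_fourier_half_lines (φ : 𝓢(ℝ, ℂ)) :
    ∑' ε : ℤˣ, ∫⁻ l in Ioi (0 : ℝ), ‖𝓕 φ (-(signVal ε * ((2 * Real.pi)⁻¹ * l)))‖ₑ ^ 2 =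
      ENNReal.ofReal (2 * Real.pi) * ∫⁻ u, ‖φ u‖ₑ ^ 2 := by
  set b := (2 * Real.pi)⁻¹ with hb
  have hb0 : 0 < b := by positivity
  have hsq (ψ : 𝓢(ℝ, ℂ)) : Integrable fun w => ‖ψ w‖ ^ 2 :=
    (memLp_two_iff_integrable_sq_norm ψ.continuous.aestronglyMeasurable).1 (ψ.memLp 2)
  have hi := hsq (𝓕 φ)
  have hin : Integrable fun w => ‖𝓕 φ (-w)‖ ^ 2 := hi.comp_neg
  have h1 : ∫ l in Ioi (0 : ℝ), ‖𝓕 φ (b * l)‖ ^ 2 = b⁻¹ * ∫ w in Ioi (0 : ℝ), ‖𝓕 φ w‖ ^ 2 := by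
    have := integral_comp_mul_left_Ioi (fun w => ‖𝓕 φ w‖ ^ 2) 0 hb0
    rwa [mul_zero, smul_eq_mul] at this
  have h2 : ∫ l in Ioi (0 : ℝ), ‖𝓕 φ (-(b * l))‖ ^ 2 =
      b⁻¹ * ∫ w in Iic (0 : ℝ), ‖𝓕 φ w‖ ^ 2 := by
    have := integral_comp_mul_left_Ioi (fun w => ‖𝓕 φ (-w)‖ ^ 2) 0 hb0
    rw [mul_zero, smul_eq_mul] at this
    rw [this, integral_comp_neg_Ioi 0 (fun w => ‖𝓕 φ w‖ ^ 2), neg_zero]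
  have i1 : IntegrableOn (fun l => ‖𝓕 φ (b * l)‖ ^ 2) (Ioi 0) :=
    (hi.comp_mul_left' hb0.ne').integrableOn
  have i2 : IntegrableOn (fun l => ‖𝓕 φ (-(b * l))‖ ^ 2) (Ioi 0) :=
    (hin.comp_mul_left' hb0.ne').integrableOn
  rw [tsum_fintype, sum_units_int]
  have e1 : signVal 1 = 1 := by simp [signVal]
  have e2 : signVal (-1) = -1 := by simp [signVal]
  simp only [e1, e2, one_mul, neg_mul, neg_neg]
  rw [lintegral_enorm_sq_eq i2, lintegral_enorm_sq_eq i1, lintegral_enorm_sq_eq (hsq φ), h1, h2,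
    ← ENNReal.ofReal_add, ← ENNReal.ofReal_mul (by positivity), ← mul_add]
  · rw [intervalIntegral.integral_Iic_add_Ioi hi.integrableOn hi.integrableOn,
      SchwartzMap.integral_norm_sq_fourier, hb, inv_inv]
  · exact mul_nonneg (inv_nonneg.2 hb0.le) (integral_nonneg fun w => by positivity)
  · exact mul_nonneg (inv_nonneg.2 hb0.le) (integral_nonneg fun w => by positivity)

theorem measurable_enorm_sq_rayCoeff (f : 𝓢(ℝ × ℝ, ℂ)) :
    Measurable fun k : (ℤˣ × ℕ) × ℝ => ‖rayCoeff f k.1 k.2‖ₑ ^ 2 :=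
  (stronglyMeasurable_rayCoeff f).measurable.enorm.pow_const 2

theorem measurable_rayCoeff_right (f : 𝓢(ℝ × ℝ, ℂ)) (i : ℤˣ × ℕ) :
    Measurable fun l : ℝ => rayCoeff f i l :=
  (stronglyMeasurable_rayCoeff f).measurable.comp measurable_prodMk_left

/-- The Plancherel formula. -/
theorem lintegral_enorm_sq_rayCoeff (f : 𝓢(ℝ × ℝ, ℂ)) :
    ∫⁻ k, ‖rayCoeff f k.1 k.2‖ₑ ^ 2 ∂rayMeasure = ∫⁻ p, ‖f p‖ₑ ^ 2 := by
  have hm (ε : ℤˣ) : Measurable fun q : ℝ × ℝ => ‖partialFourier f ε q.1 q.2‖ₑ ^ 2 :=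
    (stronglyMeasurable_partialFourier f ε).measurable.enorm.pow_const 2
  have h1 (ε : ℤˣ) : ∑' n : ℕ, ∫⁻ l in Ioi (0 : ℝ), ‖rayCoeff f (ε, n) l‖ₑ ^ 2 =
      ENNReal.ofReal (2 * Real.pi)⁻¹ *
        ∫⁻ x, ∫⁻ l in Ioi (0 : ℝ), ‖partialFourier f ε l x‖ₑ ^ 2 := by
    rw [← lintegral_tsum fun n => ((measurable_rayCoeff_right f _).enorm.pow_const 2).aemeasurable,
      setLIntegral_congr_fun measurableSet_Ioi fun l hl => tsum_enorm_sq_rayCoeff f ε hl,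
      lintegral_const_mul _ (hm ε).lintegral_prod_right',
      lintegral_lintegral_swap (hm ε).aemeasurable]
  rw [lintegral_rayMeasure (measurable_enorm_sq_rayCoeff f), ENNReal.tsum_prod']
  simp only [h1]
  rw [ENNReal.tsum_mul_left, ← lintegral_tsum fun ε =>
    ((hm ε).lintegral_prod_left' (μ := volume.restrict (Ioi 0))).aemeasurable]
  simp only [partialFourier_eq, tsum_lintegral_fourier_half_lines, verticalSlice_apply]
  have hf2 : Measurable fun p : ℝ × ℝ => ‖f p‖ₑ ^ 2 := f.continuous.measurable.enorm.pow_const 2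
  rw [lintegral_const_mul _ (hf2.lintegral_prod_right' (ν := volume)), ← mul_assoc,
    ← ENNReal.ofReal_mul (by positivity), inv_mul_cancel₀ (by positivity), ENNReal.ofReal_one,
    one_mul, Measure.volume_eq_prod, lintegral_prod _ hf2.aemeasurable]

end Plancherel

/-! ### Integrability of the coefficients over all parameters -/

section Summability

/-- `1 + G` on Schwartz functions. -/
noncomputable def oneAddGrushin : 𝓢(ℝ × ℝ, ℂ) →ₗ[ℂ] 𝓢(ℝ × ℝ, ℂ) := LinearMap.id + grushinSchwartz

theorem rayCoeff_oneAddGrushin (f : 𝓢(ℝ × ℝ, ℂ)) (i : ℤˣ × ℕ) {l : ℝ} (hl : 0 ≤ l) :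
    rayCoeff (oneAddGrushin f) i l = ((1 + (2 * i.2 + 1) * l : ℝ) : ℂ) * rayCoeff f i l := by
  change rayCoeff (f + grushinSchwartz f : 𝓢(ℝ × ℝ, ℂ)) i l = _
  rw [rayCoeff_add, rayCoeff_grushin f i hl]
  push_cast
  ring

theorem integrableOn_inv_sqrt_mul_inv_one_add :
    IntegrableOn (fun l : ℝ => (√l)⁻¹ * (1 + l)⁻¹) (Ioi 0) := by
  -- The antiderivative is 2 arctan √λ, with finite limit π.
  refine integrableOn_Ioi_deriv_of_nonneg (g := fun l => 2 * Real.arctan (√l))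
    (l := 2 * (Real.pi / 2)) (by fun_prop) (fun l hl => ?_) (fun l hl => ?_) ?_
  · have hl : 0 < l := hl
    have hs := Real.sqrt_pos.2 hl
    refine ((Real.hasDerivAt_sqrt hl.ne').arctan.const_mul 2).congr_deriv ?_
    rw [Real.sq_sqrt hl.le]
    field_simp
  · have hl : 0 < l := hl
    positivity
  · exact ((Real.tendsto_arctan_atTop.mono_right nhdsWithin_le_nhds).comp
      Real.tendsto_sqrt_atTop).const_mul 2

/-- The inequality 2xy ≤ x² + y² for c = a w⁻², with a free parameter s to balance the two terms. -/
theorem mul_le_of_weights {a w s c : ℝ} (hs : 0 < s) (hw : 0 < w) (h : a = w ^ 2 * c) (hc : 0 ≤ c) :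
    c ≤ s⁻¹ * w⁻¹ * a ^ 2 + s * (w ^ 3)⁻¹ := by
  have h1 : s⁻¹ * w⁻¹ * a ^ 2 + s * (w ^ 3)⁻¹ - 2 * c = s⁻¹ * w⁻¹ * (a - s * w⁻¹) ^ 2 := by
    subst h; field_simp; ring
  have h2 : 0 ≤ s⁻¹ * w⁻¹ * (a - s * w⁻¹) ^ 2 := by positivity
  linarith

theorem sqrt_mul_inv_le {l N : ℝ} (hl : 0 < l) (hN : 0 < N) :
    √l * ((1 + N * l) ^ 3)⁻¹ ≤ (√N)⁻¹ * (1 + (N * l) ^ 2)⁻¹ := by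
  have hN' := Real.sqrt_pos.2 hN
  have ht : 0 < N * l := by positivity
  have h1 : √N * √l = √(N * l) := (Real.sqrt_mul hN.le l).symm
  have h2 : √(N * l) ≤ 1 + N * l := Real.sqrt_le_iff.2 ⟨by positivity, by nlinarith⟩
  rw [← div_eq_mul_inv, ← mul_inv, ← one_div, div_le_div_iff₀ (by positivity) (by positivity),
    one_mul, ← mul_assoc, mul_comm √l, h1]
  calc √(N * l) * (1 + (N * l) ^ 2) ≤ (1 + N * l) * (1 + N * l) ^ 2 := by
        gcongr; nlinarith
    _ = _ := by ring

/-- Here a is the coefficient of (1+G)² f, w = 1 + (2n+1)λ and s = √λ. The first term can be summed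
over n by Plancherel with an integrable weight in λ; the second integrates to at most a multiple of
(2n+1)^{-3/2}, which is summable. -/
theorem enorm_rayCoeff_le (f : 𝓢(ℝ × ℝ, ℂ)) (i : ℤˣ × ℕ) {l : ℝ} (hl : 0 < l) :
    ‖rayCoeff f i l‖ₑ ≤ ENNReal.ofReal ((√l)⁻¹ * (1 + l)⁻¹) *
        ‖rayCoeff (oneAddGrushin (oneAddGrushin f)) i l‖ₑ ^ 2 +
      ENNReal.ofReal ((√(2 * i.2 + 1))⁻¹ * (1 + ((2 * i.2 + 1) * l) ^ 2)⁻¹) := by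
  set w : ℝ := 1 + (2 * i.2 + 1) * l with hw
  have hw1 : 1 + l ≤ w := by
    have : 0 ≤ (i.2 : ℝ) * l := by positivity
    rw [hw]; nlinarith
  have hw0 : 0 < w := by linarith
  have hs := Real.sqrt_pos.2 hl
  have h0 : ‖rayCoeff (oneAddGrushin (oneAddGrushin f)) i l‖ = w ^ 2 * ‖rayCoeff f i l‖ := by
    rw [rayCoeff_oneAddGrushin _ _ hl.le, rayCoeff_oneAddGrushin _ _ hl.le, norm_mul, norm_mul,
      Complex.norm_real, Real.norm_eq_abs, abs_of_pos hw0]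
    ring
  have h1 := mul_le_of_weights hs hw0 h0 (norm_nonneg _)
  have h2 := sqrt_mul_inv_le hl (N := 2 * i.2 + 1) (by positivity)
  have h3 : (√l)⁻¹ * w⁻¹ * ‖rayCoeff (oneAddGrushin (oneAddGrushin f)) i l‖ ^ 2 ≤
      (√l)⁻¹ * (1 + l)⁻¹ * ‖rayCoeff (oneAddGrushin (oneAddGrushin f)) i l‖ ^ 2 := by gcongr
  rw [← ofReal_norm, ← ofReal_norm, ← ENNReal.ofReal_pow (norm_nonneg _),
    ← ENNReal.ofReal_mul (by positivity), ← ENNReal.ofReal_add (by positivity) (by positivity)]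
  exact ENNReal.ofReal_le_ofReal (h1.trans (add_le_add h3 h2))

theorem summable_inv_sqrt_mul : Summable fun n : ℕ => (√(2 * n + 1))⁻¹ * ((2 * n + 1 : ℝ)⁻¹ * Real.pi) := by
  have h : Summable fun n : ℕ => 1 / ((n + 1 : ℕ) : ℝ) ^ (3 / 2 : ℝ) :=
    (summable_nat_add_iff 1).2 (Real.summable_one_div_nat_rpow.2 (by norm_num))
  refine (h.mul_left Real.pi).of_nonneg_of_le (fun n => by positivity) fun n => ?_
  have e : ((n + 1 : ℕ) : ℝ) ^ (3 / 2 : ℝ) = √((n + 1 : ℕ) : ℝ) * ((n + 1 : ℕ) : ℝ) := by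
    rw [Real.sqrt_eq_rpow, ← Real.rpow_add_one (by positivity)]; norm_num
  rw [e, one_div, mul_inv, ← mul_assoc, mul_comm _ Real.pi]
  push_cast
  have : (n : ℝ) + 1 ≤ 2 * n + 1 := by linarith [(Nat.cast_nonneg n : (0 : ℝ) ≤ n)]
  gcongr

theorem lintegral_enorm_rayCoeff_lt_top (f : 𝓢(ℝ × ℝ, ℂ)) :
    ∫⁻ k, ‖rayCoeff f k.1 k.2‖ₑ ∂rayMeasure < ∞ := by
  set A : ℝ → ℝ≥0∞ := fun l => ENNReal.ofReal ((√l)⁻¹ * (1 + l)⁻¹) with hA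
  set B : ℕ → ℝ → ℝ≥0∞ := fun n l =>
    ENNReal.ofReal ((√(2 * n + 1))⁻¹ * (1 + ((2 * n + 1) * l) ^ 2)⁻¹) with hB
  set F := oneAddGrushin (oneAddGrushin f) with hF
  have hAm : Measurable A := by simp only [hA]; fun_prop
  have hFm (i : ℤˣ × ℕ) : Measurable fun l => ‖rayCoeff F i l‖ₑ ^ 2 :=
    (measurable_rayCoeff_right F i).enorm.pow_const 2
  have hAF (i : ℤˣ × ℕ) : Measurable fun l => A l * ‖rayCoeff F i l‖ₑ ^ 2 := hAm.mul (hFm i)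
  obtain ⟨C, hC0, hC⟩ := exists_tsum_enorm_sq_rayCoeff_le F
  have h1 (ε : ℤˣ) : ∑' n : ℕ, ∫⁻ l in Ioi (0 : ℝ), A l * ‖rayCoeff F (ε, n) l‖ₑ ^ 2 < ∞ := by
    rw [← lintegral_tsum fun n => (hAF _).aemeasurable]
    simp only [ENNReal.tsum_mul_left]
    calc ∫⁻ l in Ioi (0 : ℝ), A l * ∑' n : ℕ, ‖rayCoeff F (ε, n) l‖ₑ ^ 2
        ≤ ∫⁻ l in Ioi (0 : ℝ), A l * ENNReal.ofReal C :=
          setLIntegral_mono' measurableSet_Ioi fun l hl => by gcongr; exact hC ε l hl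
      _ < ∞ := by
        rw [lintegral_mul_const _ hAm]
        refine ENNReal.mul_lt_top ?_ ENNReal.ofReal_lt_top
        exact (hasFiniteIntegral_iff_ofReal (ae_restrict_of_forall_mem measurableSet_Ioi
          fun l hl => by have hl : 0 < l := hl; positivity)).1
          integrableOn_inv_sqrt_mul_inv_one_add.hasFiniteIntegral
  have h2 : ∑' n : ℕ, ∫⁻ l in Ioi (0 : ℝ), B n l < ∞ := by
    refine lt_of_le_of_lt (ENNReal.tsum_le_tsum fun n => ?_)
      summable_inv_sqrt_mul.tsum_ofReal_lt_top
    have hi : Integrable fun l : ℝ => (1 + ((2 * n + 1 : ℝ) * l) ^ 2)⁻¹ :=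
      integrable_inv_one_add_sq.comp_mul_left' (by positivity)
    have hv := Measure.integral_comp_mul_left (fun x : ℝ => (1 + x ^ 2)⁻¹) (2 * n + 1 : ℝ)
    rw [integral_univ_inv_one_add_sq, abs_of_pos (by positivity), smul_eq_mul] at hv
    refine (setLIntegral_le_lintegral _ _).trans_eq ?_
    rw [← hv, ← integral_const_mul, ofReal_integral_eq_lintegral_ofReal (hi.const_mul _)
      (Filter.Eventually.of_forall fun x => by positivity)]
  have h3 (i : ℤˣ × ℕ) : ∫⁻ l in Ioi (0 : ℝ), ‖rayCoeff f i l‖ₑ ≤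
      (∫⁻ l in Ioi (0 : ℝ), A l * ‖rayCoeff F i l‖ₑ ^ 2) + ∫⁻ l in Ioi (0 : ℝ), B i.2 l := by
    rw [← lintegral_add_left (hAF i)]
    exact setLIntegral_mono' measurableSet_Ioi fun l hl => enorm_rayCoeff_le f i hl
  rw [lintegral_rayMeasure (stronglyMeasurable_rayCoeff f).measurable.enorm]
  refine lt_of_le_of_lt (ENNReal.tsum_le_tsum h3) ?_
  rw [ENNReal.tsum_add, ENNReal.tsum_prod', ENNReal.tsum_prod', ENNReal.add_lt_top]
  simp only [tsum_fintype]
  exact ⟨ENNReal.sum_lt_top.2 fun ε _ => h1 ε, ENNReal.sum_lt_top.2 fun ε _ => h2⟩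

theorem integrable_rayCoeff (f : 𝓢(ℝ × ℝ, ℂ)) :
    Integrable (fun k : (ℤˣ × ℕ) × ℝ => rayCoeff f k.1 k.2) rayMeasure :=
  ⟨(stronglyMeasurable_rayCoeff f).aestronglyMeasurable, lintegral_enorm_rayCoeff_lt_top f⟩

theorem integrableOn_rayCoeff (f : 𝓢(ℝ × ℝ, ℂ)) (i : ℤˣ × ℕ) :
    IntegrableOn (rayCoeff f i) (Ioi 0) := by
  refine ⟨(measurable_rayCoeff_right f i).aestronglyMeasurable, ?_⟩
  have h := lintegral_enorm_rayCoeff_lt_top f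
  rw [lintegral_rayMeasure (stronglyMeasurable_rayCoeff f).measurable.enorm] at h
  exact (ENNReal.le_tsum i).trans_lt h

theorem integrableOn_rayOp (f : 𝓢(ℝ × ℝ, ℂ)) (ε : ℤˣ) (n : ℕ) (p : ℝ × ℝ) :
    IntegrableOn (fun l => rayOp l n ε f p) (Ioi 0) := by
  obtain ⟨C, hC0, hC⟩ := exists_norm_rayWave_le (ε, n)
  refine ((integrableOn_rayCoeff (oneAddGrushin f) (ε, n)).norm.const_mul C).mono'
    ?_ (ae_restrict_of_forall_mem measurableSet_Ioi fun l hl => ?_)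
  · simp only [rayOp_eq]
    exact ((measurable_rayCoeff_right f _).mul
      ((continuous_rayWave (ε, n)).comp (Continuous.prodMk_left p)).measurable).aestronglyMeasurable
  · have hl : 0 < l := hl
    -- The eigenfunction grows at most like λ^{1/4}, for every fixed point p. One factor 1 + G
    -- acting on f pays for this growth, so convergence holds for every p.
    have hs : √(√l) ≤ 1 + (2 * n + 1) * l := by
      have : 0 ≤ (n : ℝ) * l := by positivity
      refine Real.sqrt_le_iff.2 ⟨by positivity, Real.sqrt_le_iff.2 ⟨by positivity, ?_⟩⟩
      have h1 : 1 ≤ 1 + (2 * n + 1) * l := by nlinarith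
      calc l ≤ 1 + (2 * n + 1) * l := by nlinarith
        _ ≤ ((1 + (2 * n + 1) * l) ^ 2) ^ 2 := by
          rw [← pow_mul]; exact le_self_pow₀ h1 (by norm_num)
    rw [rayOp_eq, norm_mul, rayCoeff_oneAddGrushin _ _ hl.le, norm_mul, Complex.norm_real,
      Real.norm_eq_abs, abs_of_nonneg (by positivity)]
    calc ‖rayCoeff f (ε, n) l‖ * ‖rayWave (ε, n) l p‖
        ≤ ‖rayCoeff f (ε, n) l‖ * (C * (1 + (2 * n + 1) * l)) := by
          gcongr
          exact (hC l p).trans (by gcongr)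
      _ = _ := by ring

end Summability

/-! ### A criterion for Schwartz functions -/

section SchwartzCriterion

/-- A family of bounded functions closed under partial derivatives and multiplication by the
coordinates consists of Schwartz functions. -/
theorem exists_schwartzMap_of_closed (A : Set (ℝ × ℝ → ℂ))
    (hb : ∀ f ∈ A, ∃ C, ∀ p, ‖f p‖ ≤ C)
    (hd : ∀ f ∈ A, ∃ g ∈ A, ∃ h ∈ A, ∀ p, HasFDerivAt f
      ((ContinuousLinearMap.fst ℝ ℝ ℝ).smulRight (g p) +
        (ContinuousLinearMap.snd ℝ ℝ ℝ).smulRight (h p)) p)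
    (hx : ∀ f ∈ A, (fun p => (p.1 : ℂ) * f p) ∈ A)
    (hu : ∀ f ∈ A, (fun p => (p.2 : ℂ) * f p) ∈ A) {f : ℝ × ℝ → ℂ} (hf : f ∈ A) :
    ∃ F : 𝓢(ℝ × ℝ, ℂ), ⇑F = f := by
  let X : ℂ →L[ℝ] (ℝ × ℝ →L[ℝ] ℂ) :=
    ContinuousLinearMap.smulRightL ℝ (ℝ × ℝ) ℂ (ContinuousLinearMap.fst ℝ ℝ ℝ)
  let Y : ℂ →L[ℝ] (ℝ × ℝ →L[ℝ] ℂ) :=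
    ContinuousLinearMap.smulRightL ℝ (ℝ × ℝ) ℂ (ContinuousLinearMap.snd ℝ ℝ ℝ)
  have hd' : ∀ f ∈ A, ∃ g ∈ A, ∃ h ∈ A, ∀ p, HasFDerivAt f (X (g p) + Y (h p)) p := hd
  have hsm (n : ℕ) : ∀ f ∈ A, ContDiff ℝ n f := by
    induction n with
    | zero =>
      intro f hf
      obtain ⟨g, -, h, -, hD⟩ := hd' f hf
      exact contDiff_zero.2 (continuous_iff_continuousAt.2 fun p => (hD p).continuousAt)
    | succ n ih =>
      intro f hf
      obtain ⟨g, hg, h, hh, hD⟩ := hd' f hf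
      rw [Nat.cast_succ, contDiff_succ_iff_hasFDerivAt]
      exact ⟨_, (X.contDiff.comp (ih g hg)).add (Y.contDiff.comp (ih h hh)), hD⟩
  have hpow (k : ℕ) : ∀ f ∈ A, ∃ C, ∀ p : ℝ × ℝ, ‖p‖ ^ k * ‖f p‖ ≤ C := by
    -- Powers of each coordinate are bounded separately; in the maximum norm, ‖p‖ᵏ is one of |x|ᵏ,
    -- |u|ᵏ.
    have aux (v : ℝ × ℝ → ℝ) (hv : ∀ f ∈ A, (fun p => (v p : ℂ) * f p) ∈ A) :
        ∀ f ∈ A, (fun p => (v p : ℂ) ^ k * f p) ∈ A := by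
      induction k with
      | zero => intro f hf; simpa using hf
      | succ k ih =>
        intro f hf
        have := ih _ (hv f hf)
        convert this using 2 with p
        ring
    intro f hf
    obtain ⟨C, hC⟩ := hb _ (aux (fun p => p.1) hx f hf)
    obtain ⟨D, hD⟩ := hb _ (aux (fun p => p.2) hu f hf)
    refine ⟨max C D, fun p => ?_⟩
    have h1 := hC p
    have h2 := hD p
    simp only [norm_mul, norm_pow, Complex.norm_real] at h1 h2
    rw [Prod.norm_def]
    rcases max_cases ‖p.1‖ ‖p.2‖ with ⟨e, -⟩ | ⟨e, -⟩ <;> rw [e]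
    · exact h1.trans (le_max_left _ _)
    · exact h2.trans (le_max_right _ _)
  have hdec (n : ℕ) : ∀ f ∈ A, ∀ k : ℕ, ∃ C, ∀ p : ℝ × ℝ,
      ‖p‖ ^ k * ‖iteratedFDeriv ℝ n f p‖ ≤ C := by
    induction n with
    | zero => intro f hf k; simpa using hpow k f hf
    | succ n ih =>
      intro f hf k
      obtain ⟨g, hg, h, hh, hD⟩ := hd' f hf
      obtain ⟨C, hC⟩ := ih g hg k
      obtain ⟨D, hD'⟩ := ih h hh k
      refine ⟨‖X‖ * C + ‖Y‖ * D, fun p => ?_⟩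
      have e : fderiv ℝ f = (⇑X ∘ g) + (⇑Y ∘ h) := funext fun p => (hD p).fderiv
      have e1 : ‖iteratedFDeriv ℝ n (⇑X ∘ g) p‖ ≤ ‖X‖ * ‖iteratedFDeriv ℝ n g p‖ :=
        X.norm_iteratedFDeriv_comp_left (hsm n g hg).contDiffAt le_rfl
      have e2 : ‖iteratedFDeriv ℝ n (⇑Y ∘ h) p‖ ≤ ‖Y‖ * ‖iteratedFDeriv ℝ n h p‖ :=
        Y.norm_iteratedFDeriv_comp_left (hsm n h hh).contDiffAt le_rfl
      rw [← norm_iteratedFDeriv_fderiv, e, iteratedFDeriv_add_apply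
        (X.contDiff.comp (hsm n g hg)).contDiffAt (Y.contDiff.comp (hsm n h hh)).contDiffAt]
      calc ‖p‖ ^ k * ‖iteratedFDeriv ℝ n (⇑X ∘ g) p + iteratedFDeriv ℝ n (⇑Y ∘ h) p‖
          ≤ ‖p‖ ^ k * (‖X‖ * ‖iteratedFDeriv ℝ n g p‖ + ‖Y‖ * ‖iteratedFDeriv ℝ n h p‖) := by
            gcongr
            exact (norm_add_le _ _).trans (add_le_add e1 e2)
        _ = ‖X‖ * (‖p‖ ^ k * ‖iteratedFDeriv ℝ n g p‖) +
            ‖Y‖ * (‖p‖ ^ k * ‖iteratedFDeriv ℝ n h p‖) := by ring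
        _ ≤ _ := by
            gcongr
            · exact hC p
            · exact hD' p
  exact ⟨⟨f, contDiff_infty.2 fun n => hsm n f hf, fun k n => hdec n f hf k⟩, rfl⟩

end SchwartzCriterion

/-! ### Amplitudes supported in (0, ∞) and their Laplace transforms -/

section Laplace

/-- Smooth functions with compact support in `(0, ∞)`. -/
structure IsRayTest (ψ : ℝ → ℂ) : Prop where
  contDiff : ContDiff ℝ (⊤ : ℕ∞) ψ
  hasCompactSupport : HasCompactSupport ψ
  tsupport_subset : tsupport ψ ⊆ Ioi 0

theorem IsRayTest.eq_zero {ψ : ℝ → ℂ} (hψ : IsRayTest ψ) {l : ℝ} (hl : l ≤ 0) : ψ l = 0 :=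
  image_eq_zero_of_notMem_tsupport fun h => not_lt.2 hl (hψ.tsupport_subset h)

/-- The factor may be singular at 0, such as √λ or 1/λ, because the support of ψ stays away from 0.
-/
theorem IsRayTest.mul {ψ φ : ℝ → ℂ} (hψ : IsRayTest ψ) (hφ : ContDiffOn ℝ (⊤ : ℕ∞) φ (Ioi 0)) :
    IsRayTest fun l => ψ l * φ l where
  contDiff := by
    refine contDiff_iff_contDiffAt.2 fun l => ?_
    by_cases hl : l ∈ tsupport ψ
    · exact hψ.contDiff.contDiffAt.mul
        (hφ.contDiffAt (isOpen_Ioi.mem_nhds (hψ.tsupport_subset hl)))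
    · have h := notMem_tsupport_iff_eventuallyEq.1 hl
      refine (contDiffAt_const (c := (0 : ℂ))).congr_of_eventuallyEq (h.mono fun x hx => ?_)
      simp only [Pi.zero_apply] at hx
      simp only [hx, zero_mul]
  hasCompactSupport := hψ.hasCompactSupport.mul_right
  tsupport_subset := (tsupport_mul_subset_left (f := ψ) (g := φ)).trans hψ.tsupport_subset

theorem IsRayTest.isRayTest_deriv {ψ : ℝ → ℂ} (hψ : IsRayTest ψ) : IsRayTest (deriv ψ) where
  contDiff := (contDiff_infty_iff_deriv.1 hψ.contDiff).2
  hasCompactSupport := hψ.hasCompactSupport.deriv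
  tsupport_subset := (tsupport_deriv_subset (f := ψ)).trans hψ.tsupport_subset

theorem IsRayTest.exists_le {ψ : ℝ → ℂ} (hψ : IsRayTest ψ) :
    ∃ a : ℝ, 0 < a ∧ ∀ l, ψ l ≠ 0 → a ≤ l := by
  by_cases h : (tsupport ψ).Nonempty
  · obtain ⟨a, ha, hmin⟩ := hψ.hasCompactSupport.exists_isLeast h
    exact ⟨a, hψ.tsupport_subset ha, fun l hl => hmin (subset_tsupport _ hl)⟩
  · refine ⟨1, one_pos, fun l hl => absurd ⟨l, subset_tsupport _ hl⟩ h⟩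

theorem IsRayTest.integrable_mul {ψ φ : ℝ → ℂ} (hψ : IsRayTest ψ) (hφ : Continuous φ) :
    Integrable fun l => ψ l * φ l :=
  (hψ.contDiff.continuous.mul hφ).integrable_of_hasCompactSupport hψ.hasCompactSupport.mul_right

/-- The Laplace transform. -/
noncomputable def laplaceInt (ψ : ℝ → ℂ) (z : ℂ) : ℂ := ∫ l : ℝ, ψ l * Complex.exp (-(l * z))

theorem IsRayTest.hasDerivAt_laplaceInt {ψ : ℝ → ℂ} (hψ : IsRayTest ψ) (z : ℂ) :
    HasDerivAt (laplaceInt ψ) (laplaceInt (fun l => ψ l * (-(l : ℂ))) z) z := by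
  have hc : Continuous ψ := hψ.contDiff.continuous
  have hbd : Integrable fun l : ℝ => ‖ψ l‖ * (|l| * Real.exp (|l| * (‖z‖ + 1))) := by
    refine Continuous.integrable_of_hasCompactSupport (by fun_prop) ?_
    exact hψ.hasCompactSupport.norm.mul_right
  have := hasDerivAt_integral_of_dominated_loc_of_deriv_le (𝕜 := ℂ)
    (F := fun z l => ψ l * Complex.exp (-((l : ℝ) * z)))
    (F' := fun z l => ψ l * (-(l : ℂ)) * Complex.exp (-((l : ℝ) * z))) (x₀ := z)
    (bound := fun l : ℝ => ‖ψ l‖ * (|l| * Real.exp (|l| * (‖z‖ + 1))))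
    (Metric.ball_mem_nhds z one_pos)
    (Filter.Eventually.of_forall fun z => Continuous.aestronglyMeasurable (by fun_prop))
    (hψ.integrable_mul (by fun_prop)) (Continuous.aestronglyMeasurable (by fun_prop))
    (Filter.Eventually.of_forall fun l w hw => ?_) hbd
    (Filter.Eventually.of_forall fun l w hw => ?_)
  · exact this.2
  · rw [norm_mul, norm_mul, norm_neg, Complex.norm_real, Real.norm_eq_abs, mul_assoc]
    gcongr
    refine (Complex.norm_exp_le_exp_norm _).trans (Real.exp_le_exp.2 ?_)
    rw [norm_neg, norm_mul, Complex.norm_real, Real.norm_eq_abs]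
    gcongr
    have : ‖w‖ ≤ ‖z‖ + ‖w - z‖ := by simpa using norm_add_le z (w - z)
    have h2 : ‖w - z‖ < 1 := by simpa [dist_eq_norm] using hw
    linarith
  · have h1 : HasDerivAt (fun w : ℂ => -((l : ℂ) * w)) (-(l : ℂ)) w := by
      simpa using ((hasDerivAt_id w).const_mul (l : ℂ)).fun_neg
    refine (h1.cexp.const_mul (ψ l)).congr_deriv ?_
    ring

/-- Integration by parts: multiplication by z becomes differentiation of the amplitude, which is
again admissible. -/
theorem IsRayTest.mul_laplaceInt {ψ : ℝ → ℂ} (hψ : IsRayTest ψ) (z : ℂ) :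
    z * laplaceInt ψ z = laplaceInt (deriv ψ) z := by
  have h1 (l : ℝ) : HasDerivAt (fun l : ℝ => Complex.exp (-(l * z)))
      (Complex.exp (-(l * z)) * (-z)) l := by
    have : HasDerivAt (fun l : ℝ => -((l : ℂ) * z)) (-z) l := by
      simpa using ((Complex.ofRealCLM.hasDerivAt (x := l)).mul_const z).fun_neg
    exact this.cexp
  have h2 (l : ℝ) : HasDerivAt ψ (deriv ψ l) l :=
    (hψ.contDiff.differentiable (by simp) l).hasDerivAt
  have := integral_mul_deriv_eq_deriv_mul_of_integrable (fun l _ => h2 l) (fun l _ => h1 l)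
    (hψ.integrable_mul (by fun_prop)) (hψ.isRayTest_deriv.integrable_mul (by fun_prop))
    (hψ.integrable_mul (by fun_prop))
  rw [laplaceInt, laplaceInt, ← integral_const_mul, ← neg_neg (∫ l, deriv ψ l * _), ← this,
    ← integral_neg]
  congr 1; ext l; ring

end Laplace

/-! ### Superpositions of Gaussian waves are Schwartz functions -/

section Packets

/-- The functions `x^j ∫ ψ(λ) e^{-λx²/2} e^{-iελu} dλ`. -/
noncomputable def rayPacket (ε : ℤˣ) (j : ℕ) (ψ : ℝ → ℂ) (p : ℝ × ℝ) : ℂ :=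
  (p.1 : ℂ) ^ j * laplaceInt ψ ((p.1 : ℂ) ^ 2 / 2 + Complex.I * (signVal ε : ℂ) * p.2)

/-- The linear span of all `rayPacket`s. -/
def rayPacketSpan (ε : ℤˣ) : Submodule ℂ (ℝ × ℝ → ℂ) :=
  Submodule.span ℂ {f | ∃ j ψ, IsRayTest ψ ∧ f = rayPacket ε j ψ}

theorem IsRayTest.rayPacket_mem {ψ : ℝ → ℂ} (hψ : IsRayTest ψ) (ε : ℤˣ) (j : ℕ) :
    rayPacket ε j ψ ∈ rayPacketSpan ε := Submodule.subset_span ⟨j, ψ, hψ, rfl⟩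

/-- On the support of ψ one has λ ≥ a > 0, so e^{-λx²/2} ≤ e^{-ax²/2} absorbs |x|ʲ uniformly. -/
theorem IsRayTest.exists_norm_rayPacket_le {ψ : ℝ → ℂ} (hψ : IsRayTest ψ) (ε : ℤˣ) (j : ℕ) :
    ∃ C, ∀ p, ‖rayPacket ε j ψ p‖ ≤ C := by
  obtain ⟨a, ha, hsupp⟩ := hψ.exists_le
  set M : ℝ := 1 + j.factorial / (a / 2) ^ j
  have hi : Integrable fun l => ‖ψ l‖ * M :=
    ((hψ.contDiff.continuous.integrable_of_hasCompactSupport hψ.hasCompactSupport).norm).mul_const M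
  refine ⟨∫ l, ‖ψ l‖ * M, fun p => ?_⟩
  rw [rayPacket, laplaceInt, ← integral_const_mul]
  refine norm_integral_le_of_norm_le hi (Filter.Eventually.of_forall fun l => ?_)
  have e : (-(l * ((p.1 : ℂ) ^ 2 / 2 + Complex.I * (signVal ε : ℂ) * p.2))).re =
      -(l / 2) * p.1 ^ 2 := by
    have : -(l * ((p.1 : ℂ) ^ 2 / 2 + Complex.I * (signVal ε : ℂ) * p.2)) =
      ((-(l / 2) * p.1 ^ 2 : ℝ) : ℂ) + ((-(l * signVal ε * p.2) : ℝ) : ℂ) * Complex.I := by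
      push_cast; ring
    rw [this, Complex.add_re, Complex.ofReal_re, Complex.re_ofReal_mul, Complex.I_re, mul_zero,
      add_zero]
  by_cases h0 : ψ l = 0
  · simp [h0]
  rw [norm_mul, norm_mul, norm_pow, Complex.norm_real, Real.norm_eq_abs, Complex.norm_exp, e,
    mul_left_comm]
  gcongr
  have hl := hsupp l h0
  refine le_trans ?_ (abs_pow_mul_exp_le (b := a / 2) (by positivity) j p.1)
  gcongr

/-- With z = x²/2 + iεu one has u = -iεz + iεx²/2. Multiplication by z differentiates ψ, so the span
is stable under multiplication by u. -/
theorem IsRayTest.mul_snd_rayPacket {ψ : ℝ → ℂ} (hψ : IsRayTest ψ) (ε : ℤˣ) (j : ℕ) :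
    (fun p => (p.2 : ℂ) * rayPacket ε j ψ p) =
      (-(Complex.I * (signVal ε : ℂ))) • rayPacket ε j (deriv ψ) +
        (Complex.I * (signVal ε : ℂ) / 2) • rayPacket ε (j + 2) ψ := by
  ext p
  have h2 : ((signVal ε : ℝ) : ℂ) * ((signVal ε : ℝ) : ℂ) = 1 := by
    rw [← Complex.ofReal_mul, signVal_mul_self, Complex.ofReal_one]
  simp only [Pi.add_apply, Pi.smul_apply, smul_eq_mul, rayPacket, ← hψ.mul_laplaceInt]
  linear_combination ((p.1 : ℂ) ^ j * p.2 *
    laplaceInt ψ ((p.1 : ℂ) ^ 2 / 2 + Complex.I * (signVal ε : ℂ) * p.2)) *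
    (((signVal ε : ℝ) : ℂ) * ((signVal ε : ℝ) : ℂ) * Complex.I_sq - h2)

theorem IsRayTest.hasFDerivAt_rayPacket {ψ : ℝ → ℂ} (hψ : IsRayTest ψ) (ε : ℤˣ) (j : ℕ)
    (p : ℝ × ℝ) :
    HasFDerivAt (rayPacket ε j ψ)
      ((ContinuousLinearMap.fst ℝ ℝ ℝ).smulRight
          (((j : ℂ) • rayPacket ε (j - 1) ψ + rayPacket ε (j + 1) fun l => ψ l * (-(l : ℂ))) p) +
        (ContinuousLinearMap.snd ℝ ℝ ℝ).smulRight
          (((Complex.I * (signVal ε : ℂ)) • rayPacket ε j fun l => ψ l * (-(l : ℂ))) p)) p := by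
  have h1 : HasFDerivAt (fun q : ℝ × ℝ => (q.1 : ℂ))
      (Complex.ofRealCLM.comp (ContinuousLinearMap.fst ℝ ℝ ℝ)) p :=
    (Complex.ofRealCLM.comp (ContinuousLinearMap.fst ℝ ℝ ℝ)).hasFDerivAt
  have h2 : HasFDerivAt (fun q : ℝ × ℝ => (q.2 : ℂ))
      (Complex.ofRealCLM.comp (ContinuousLinearMap.snd ℝ ℝ ℝ)) p :=
    (Complex.ofRealCLM.comp (ContinuousLinearMap.snd ℝ ℝ ℝ)).hasFDerivAt
  have h3 := ((h1.pow 2).mul_const (1 / 2 : ℂ)).add (h2.const_mul (Complex.I * (signVal ε : ℂ)))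
  have h4 := (h1.pow j).mul (((hψ.hasDerivAt_laplaceInt
    ((p.1 : ℂ) ^ 2 * (1 / 2) + Complex.I * (signVal ε : ℂ) * p.2)).hasFDerivAt.restrictScalars ℝ).comp
      p h3)
  have e : rayPacket ε j ψ = fun q : ℝ × ℝ => (q.1 : ℂ) ^ j *
      laplaceInt ψ ((q.1 : ℂ) ^ 2 * (1 / 2) + Complex.I * (signVal ε : ℂ) * q.2) := by
    ext q; rw [rayPacket, mul_one_div]
  rw [e]
  refine HasFDerivAt.congr_fderiv h4 ?_
  ext <;> simp [rayPacket, div_eq_mul_inv] <;> ring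

theorem mul_mem_rayPacketSpan {ε : ℤˣ} {v : ℝ × ℝ → ℂ}
    (h : ∀ j ψ, IsRayTest ψ → (fun p => v p * rayPacket ε j ψ p) ∈ rayPacketSpan ε)
    {f : ℝ × ℝ → ℂ} (hf : f ∈ rayPacketSpan ε) : (fun p => v p * f p) ∈ rayPacketSpan ε := by
  have : rayPacketSpan ε ≤ (rayPacketSpan ε).comap (LinearMap.mulLeft ℂ v) := by
    refine Submodule.span_le.2 ?_
    rintro _ ⟨j, ψ, hψ, rfl⟩
    exact h j ψ hψ
  exact this hf

theorem exists_schwartzMap_rayPacketSpan {ε : ℤˣ} {f : ℝ × ℝ → ℂ} (hf : f ∈ rayPacketSpan ε) :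
    ∃ F : 𝓢(ℝ × ℝ, ℂ), ⇑F = f := by
  refine exists_schwartzMap_of_closed (rayPacketSpan ε : Set (ℝ × ℝ → ℂ)) (fun f hf => ?_)
    (fun f hf => ?_) (fun f hf => ?_) (fun f hf => ?_) hf
  · induction hf using Submodule.span_induction with
    | mem f hf => obtain ⟨j, ψ, hψ, rfl⟩ := hf; exact hψ.exists_norm_rayPacket_le ε j
    | zero => exact ⟨0, fun p => by simp⟩
    | add f g _ _ hf hg =>
      obtain ⟨C, hC⟩ := hf
      obtain ⟨D, hD⟩ := hg
      exact ⟨C + D, fun p => (norm_add_le _ _).trans (add_le_add (hC p) (hD p))⟩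
    | smul c f _ hf =>
      obtain ⟨C, hC⟩ := hf
      refine ⟨‖c‖ * C, fun p => ?_⟩
      rw [Pi.smul_apply, norm_smul]
      exact mul_le_mul_of_nonneg_left (hC p) (norm_nonneg _)
  · induction hf using Submodule.span_induction with
    | mem f hf =>
      obtain ⟨j, ψ, hψ, rfl⟩ := hf
      have hψ' : IsRayTest fun l => ψ l * (-(l : ℂ)) :=
        hψ.mul (Complex.ofRealCLM.contDiff.neg.contDiffOn)
      exact ⟨_, add_mem (Submodule.smul_mem _ _ (hψ.rayPacket_mem ε (j - 1)))
        (hψ'.rayPacket_mem ε (j + 1)), _, Submodule.smul_mem _ _ (hψ'.rayPacket_mem ε j),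
        hψ.hasFDerivAt_rayPacket ε j⟩
    | zero =>
      exact ⟨0, zero_mem _, 0, zero_mem _, fun p => by
        
        refine (hasFDerivAt_const (𝕜 := ℝ) (0 : ℂ) p).congr_fderiv ?_
        ext <;> simp⟩
    | add f g _ _ hf hg =>
      obtain ⟨f₁, hf₁, f₂, hf₂, hf⟩ := hf
      obtain ⟨g₁, hg₁, g₂, hg₂, hg⟩ := hg
      refine ⟨f₁ + g₁, add_mem hf₁ hg₁, f₂ + g₂, add_mem hf₂ hg₂, fun p => ?_⟩
      refine ((hf p).add (hg p)).congr_fderiv ?_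
      ext <;> simp
    | smul c f _ hf =>
      obtain ⟨f₁, hf₁, f₂, hf₂, hf⟩ := hf
      refine ⟨c • f₁, Submodule.smul_mem _ _ hf₁, c • f₂, Submodule.smul_mem _ _ hf₂, fun p => ?_⟩
      refine ((hf p).const_smul c).congr_fderiv ?_
      ext <;> simp
  · refine mul_mem_rayPacketSpan (fun j ψ hψ => ?_) hf
    convert hψ.rayPacket_mem ε (j + 1) using 2 with p
    simp only [rayPacket]; ring
  · refine mul_mem_rayPacketSpan (fun j ψ hψ => ?_) hf
    rw [hψ.mul_snd_rayPacket]
    exact add_mem (Submodule.smul_mem _ _ (hψ.isRayTest_deriv.rayPacket_mem ε j))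
      (Submodule.smul_mem _ _ (hψ.rayPacket_mem ε (j + 2)))

end Packets

/-! ### Wave packets and their coefficients -/

section WavePackets

theorem contDiffOn_sqrt_ofReal_mul (b : ℝ) (n : ℕ) :
    ContDiffOn ℝ (⊤ : ℕ∞) (fun l : ℝ => ((√(√l) / √(2 * Real.pi) * (b * √l ^ n) : ℝ) : ℂ))
      (Ioi 0) := by
  refine Complex.ofRealCLM.contDiff.comp_contDiffOn ?_
  have h1 : ContDiffOn ℝ (⊤ : ℕ∞) (fun l : ℝ => √l) (Ioi 0) :=
    contDiffOn_id.sqrt fun l hl => ne_of_gt hl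
  have h2 : ContDiffOn ℝ (⊤ : ℕ∞) (fun l : ℝ => √(√l)) (Ioi 0) :=
    h1.sqrt fun l hl => (Real.sqrt_pos.2 hl).ne'
  exact (h2.div_const _).mul (contDiffOn_const.mul (h1.pow n))

theorem contDiffOn_rayWave_amplitude (n : ℕ) (x : ℝ) :
    ContDiffOn ℝ (⊤ : ℕ∞)
      (fun l : ℝ => ((√(√l) / √(2 * Real.pi) * hermiteFn n (√l * x) : ℝ) : ℂ)) (Ioi 0) := by
  refine Complex.ofRealCLM.contDiff.comp_contDiffOn ?_
  have h1 : ContDiffOn ℝ (⊤ : ℕ∞) (fun l : ℝ => √l) (Ioi 0) :=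
    contDiffOn_id.sqrt fun l hl => ne_of_gt hl
  have h2 : ContDiffOn ℝ (⊤ : ℕ∞) (fun l : ℝ => √(√l)) (Ioi 0) :=
    h1.sqrt fun l hl => (Real.sqrt_pos.2 hl).ne'
  have h3 : ContDiff ℝ (⊤ : ℕ∞) (hermiteFn n) := by
    rw [hermiteFn_eq']
    have : ContDiff ℝ (⊤ : ℕ∞) fun x => (Polynomial.C (hermiteConst n) * rodriguesPoly n).eval x :=
      by simpa [Polynomial.coe_aeval_eq_eval] using
        Polynomial.contDiff_aeval (𝕜 := ℝ) (Polynomial.C (hermiteConst n) * rodriguesPoly n) (⊤ : ℕ∞)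
    exact this.mul ((contDiff_id.pow 2).neg.div_const 2).exp
  exact (h2.div_const _).mul (h3.comp_contDiffOn (h1.mul contDiffOn_const))

/-- Expanding the Hermite polynomial into monomials reduces every wave packet to the packets already
treated; the powers of √λ go into the amplitude. For λ ≤ 0 both sides vanish with ψ. -/
theorem IsRayTest.mul_rayWave_eq {ψ : ℝ → ℂ} (hψ : IsRayTest ψ) (i : ℤˣ × ℕ) (l : ℝ) (p : ℝ × ℝ) :
    ψ l * rayWave i l p =
      ∑ j ∈ Finset.range ((Polynomial.C (hermiteConst i.2) * rodriguesPoly i.2).natDegree + 1),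
        (p.1 : ℂ) ^ j * (ψ l * ((√(√l) / √(2 * Real.pi) *
          ((Polynomial.C (hermiteConst i.2) * rodriguesPoly i.2).coeff j * √l ^ j) : ℝ) : ℂ) *
          Complex.exp (-(l * ((p.1 : ℂ) ^ 2 / 2 + Complex.I * (signVal i.1 : ℂ) * p.2)))) := by
  rcases le_or_gt l 0 with hl | hl
  · simp [hψ.eq_zero hl]
  have e : Complex.exp (-(l * ((p.1 : ℂ) ^ 2 / 2 + Complex.I * (signVal i.1 : ℂ) * p.2))) =
      Complex.exp (-(Complex.I * ((signVal i.1 * l * p.2 : ℝ) : ℂ))) *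
        ((Real.exp (-(√l * p.1) ^ 2 / 2) : ℝ) : ℂ) := by
    rw [mul_pow, Real.sq_sqrt hl.le, Complex.ofReal_exp, ← Complex.exp_add]
    congr 1; push_cast; ring
  rw [rayWave, hermiteFn_eq', polyGauss, Polynomial.eval_eq_sum_range, e]
  push_cast
  rw [Finset.sum_mul, Finset.mul_sum, Finset.mul_sum]
  refine Finset.sum_congr rfl fun j _ => ?_
  ring

theorem IsRayTest.exists_wavePacket {ψ : ℝ → ℂ} (hψ : IsRayTest ψ) (i : ℤˣ × ℕ) :
    ∃ F : 𝓢(ℝ × ℝ, ℂ), ∀ p, F p = ∫ l : ℝ, ψ l * rayWave i l p := by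
  set Q := Polynomial.C (hermiteConst i.2) * rodriguesPoly i.2 with hQ
  set φ : ℕ → ℝ → ℂ := fun j l => ψ l * ((√(√l) / √(2 * Real.pi) * (Q.coeff j * √l ^ j) : ℝ) : ℂ)
    with hφ
  have hφt (j : ℕ) : IsRayTest (φ j) := hψ.mul (contDiffOn_sqrt_ofReal_mul _ _)
  obtain ⟨F, hF⟩ := exists_schwartzMap_rayPacketSpan (sum_mem (t := Finset.range (Q.natDegree + 1))
    fun j _ => (hφt j).rayPacket_mem i.1 j)
  refine ⟨F, fun p => ?_⟩
  simp only [hψ.mul_rayWave_eq]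
  rw [integral_finsetSum _ fun j _ => ((hφt j).integrable_mul (by fun_prop)).const_mul _, hF,
    Finset.sum_apply]
  refine Finset.sum_congr rfl fun j _ => ?_
  rw [integral_const_mul]
  rfl

theorem integral_hermiteFn_scaled_mul {l : ℝ} (hl : 0 < l) (m n : ℕ) :
    ∫ x, hermiteFn m (√l * x) * hermiteFn n (√l * x) = (√l)⁻¹ * if m = n then 1 else 0 := by
  have := Measure.integral_comp_mul_left (fun x => hermiteFn m x * hermiteFn n x) (√l)
  rw [integral_hermiteFn_mul, abs_of_pos (inv_pos.2 (Real.sqrt_pos.2 hl)), smul_eq_mul] at this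
  exact this

-- For fixed x a wave packet is, up to a dilation in u, the Fourier transform of a smooth compactly
-- supported function of λ, so Fourier inversion recovers that function.
open FourierTransform in
theorem IsRayTest.partialFourier_wavePacket {ψ : ℝ → ℂ} (hψ : IsRayTest ψ) {i : ℤˣ × ℕ}
    {F : ℝ × ℝ → ℂ} (hF : ∀ p, F p = ∫ l : ℝ, ψ l * rayWave i l p) (ε : ℤˣ) {l : ℝ} (hl : 0 < l)
    (x : ℝ) : partialFourier F ε l x = if ε = i.1 then
      ((2 * Real.pi : ℝ) : ℂ) *
        (ψ l * ((√(√l) / √(2 * Real.pi) * hermiteFn i.2 (√l * x) : ℝ) : ℂ)) else 0 := by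
  have hg := hψ.mul (contDiffOn_rayWave_amplitude i.2 x)
  set g : ℝ → ℂ := fun l => ψ l * ((√(√l) / √(2 * Real.pi) * hermiteFn i.2 (√l * x) : ℝ) : ℂ)
    with hgdef
  set S : 𝓢(ℝ, ℂ) := hg.hasCompactSupport.toSchwartzMap hg.contDiff with hS
  have hSg (s : ℝ) : S s = g s := rfl
  set b : ℝ := signVal i.1 * (2 * Real.pi)⁻¹ with hb
  have hbabs : |b⁻¹| = 2 * Real.pi := by
    rw [hb, abs_inv, abs_mul, abs_signVal, one_mul, abs_of_pos (by positivity), inv_inv]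
  have h1 (u : ℝ) : F (x, u) = 𝓕 S (b * u) := by
    rw [hF, SchwartzMap.fourier_coe, Real.fourier_eq']
    congr 1; ext s
    rw [smul_eq_mul, hSg, hgdef, rayWave]
    have e : Complex.exp (((-2 * Real.pi * inner ℝ s (b * u) : ℝ) : ℂ) * Complex.I) =
        Complex.exp (-(Complex.I * ((signVal i.1 * s * (x, u).2 : ℝ) : ℂ))) := by
      congr 1
      simp only [RCLike.inner_apply, conj_trivial, hb]
      have hpi : (Real.pi : ℂ) ≠ 0 := by exact_mod_cast Real.pi_ne_zero
      push_cast
      field_simp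
    rw [e]
    push_cast
    ring
  have h2 : partialFourier F ε l x = ((2 * Real.pi : ℝ) : ℂ) * g (signVal ε * signVal i.1 * l) := by
    have h3 := Measure.integral_comp_mul_left (fun w : ℝ =>
      Complex.exp (((2 * Real.pi * (w * (signVal ε * signVal i.1 * l)) : ℝ) : ℂ) * Complex.I) *
        𝓕 S w) b
    rw [hbabs, Complex.real_smul] at h3
    have h4 : g (signVal ε * signVal i.1 * l) = ∫ w : ℝ, Complex.exp
        (((2 * Real.pi * (w * (signVal ε * signVal i.1 * l)) : ℝ) : ℂ) * Complex.I) * 𝓕 S w := by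
      have h5 : S (signVal ε * signVal i.1 * l) = 𝓕⁻ (𝓕 S) (signVal ε * signVal i.1 * l) := by
        rw [FourierTransform.fourierInv_fourier_eq (E := 𝓢(ℝ, ℂ)) (F := 𝓢(ℝ, ℂ)) S]
      rw [← hSg, h5, SchwartzMap.fourierInv_coe, Real.fourierInv_eq']
      congr 1; ext w
      simp only [RCLike.inner_apply, conj_trivial, smul_eq_mul]
      rw [mul_comm w]
    rw [h4, ← h3, partialFourier]
    congr 1; ext u
    rw [h1]
    congr 2
    have hpi : (Real.pi : ℂ) ≠ 0 := by exact_mod_cast Real.pi_ne_zero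
    have hs2 : ((signVal i.1 : ℝ) : ℂ) * ((signVal i.1 : ℝ) : ℂ) = 1 := by
      rw [← Complex.ofReal_mul, signVal_mul_self, Complex.ofReal_one]
    rw [hb]
    push_cast
    field_simp
    linear_combination (-(u : ℂ) * (signVal ε : ℂ) * l) * hs2
  rw [h2]
  split_ifs with h
  · rw [h, signVal_mul_self, one_mul]
  · have h3 : signVal ε * signVal i.1 = -1 := by
      obtain ⟨j, n⟩ := i
      rcases Int.units_eq_one_or ε with rfl | rfl <;>
        rcases Int.units_eq_one_or j with rfl | rfl <;> simp_all [signVal]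
    rw [h3, hgdef]
    simp only
    rw [hψ.eq_zero (by linarith), zero_mul, mul_zero]

/-- Fourier inversion in u separates the signs and recovers ψ(λ); Hermite orthogonality at the
common scale √λ separates the indices n. -/
theorem IsRayTest.rayCoeff_wavePacket {ψ : ℝ → ℂ} (hψ : IsRayTest ψ) {i : ℤˣ × ℕ}
    {F : 𝓢(ℝ × ℝ, ℂ)} (hF : ∀ p, F p = ∫ l : ℝ, ψ l * rayWave i l p) (j : ℤˣ × ℕ) {l : ℝ}
    (hl : 0 < l) : rayCoeff F j l = if j = i then ψ l else 0 := by
  rw [rayCoeff_eq_integral]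
  simp only [hψ.partialFourier_wavePacket hF j.1 hl]
  by_cases h : j.1 = i.1
  · simp only [h, if_true]
    have e (x : ℝ) : (hermiteFn j.2 (√l * x) : ℂ) * (((2 * Real.pi : ℝ) : ℂ) *
        (ψ l * ((√(√l) / √(2 * Real.pi) * hermiteFn i.2 (√l * x) : ℝ) : ℂ))) =
        (((2 * Real.pi : ℝ) : ℂ) * ψ l * ((√(√l) / √(2 * Real.pi) : ℝ) : ℂ)) *
          ((hermiteFn j.2 (√l * x) * hermiteFn i.2 (√l * x) : ℝ) : ℂ) := by
      push_cast; ring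
    simp only [e]
    rw [integral_const_mul, integral_complex_ofReal, integral_hermiteFn_scaled_mul hl]
    by_cases h2 : j.2 = i.2
    · rw [if_pos h2, if_pos (Prod.ext h h2), mul_one]
      have hs := Real.sqrt_pos.2 hl
      have e1 : √(√l) * √(√l) = √l := Real.mul_self_sqrt hs.le
      have e2 : √(2 * Real.pi) * √(2 * Real.pi) = 2 * Real.pi := Real.mul_self_sqrt (by positivity)
      have e3 : √(√l) / √(2 * Real.pi) * ((2 * Real.pi) * (√(√l) / √(2 * Real.pi)) * (√l)⁻¹) = 1 := by
        have : √(√l) / √(2 * Real.pi) * ((2 * Real.pi) * (√(√l) / √(2 * Real.pi)) * (√l)⁻¹) =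
          (√(√l) * √(√l)) * (2 * Real.pi) / (√(2 * Real.pi) * √(2 * Real.pi)) * (√l)⁻¹ := by ring
        rw [this, e1, e2]
        field_simp
      have e4 := congrArg (fun r : ℝ => (r : ℂ)) e3
      simp only [Complex.ofReal_mul, Complex.ofReal_one] at e4 ⊢
      linear_combination ψ l * e4
    · rw [if_neg h2, if_neg fun h3 => h2 (congrArg Prod.snd h3)]
      simp
  · simp only [h, if_false, mul_zero, integral_zero]
    rw [if_neg fun h3 => h (congrArg Prod.fst h3)]

end WavePackets

/-! ### The unitary spectral transform -/

section SpectralTransform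

theorem ae_rayMeasure_pos : ∀ᵐ k ∂rayMeasure, 0 < k.2 :=
  Measure.quasiMeasurePreserving_snd.ae (ae_restrict_mem measurableSet_Ioi)

/-- Fubini, plus the fact that integrability for counting measure is absolute, hence unconditional,
summability. -/
theorem hasSum_integral_rayMeasure {g : (ℤˣ × ℕ) × ℝ → ℂ} (hg : Integrable g rayMeasure) :
    HasSum (fun i => ∫ l in Ioi (0 : ℝ), g (i, l)) (∫ k, g k ∂rayMeasure) := by
  have h1 : Integrable (fun i => ∫ l in Ioi (0 : ℝ), g (i, l)) Measure.count := hg.integral_prod_left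
  have h2 := integral_countable h1
  have h3 : ∫ k, g k ∂rayMeasure = ∑' i, ∫ l in Ioi (0 : ℝ), g (i, l) := by
    rw [rayMeasure, integral_prod _ hg, h2]
    simp [Measure.real]
  rw [h3]
  exact (integrable_count_iff.1 h1).of_norm.hasSum

/-- On each ray the slice is in L², hence locally integrable, and the fundamental lemma of the
calculus of variations applies. There are only countably many rays. -/
theorem ae_eq_zero_of_forall_rayTest {g : (ℤˣ × ℕ) × ℝ → ℂ} (hm : StronglyMeasurable g)
    (hg : MemLp g 2 rayMeasure)
    (h : ∀ i ψ, IsRayTest ψ → ∫ l in Ioi (0 : ℝ), ψ l * g (i, l) = 0) : g =ᵐ[rayMeasure] 0 := by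
  have hm' (i : ℤˣ × ℕ) : StronglyMeasurable fun l => g (i, l) :=
    hm.comp_measurable measurable_prodMk_left
  have hlt : ∫⁻ k, ‖g k‖ₑ ^ 2 ∂rayMeasure < ∞ := by
    have := hg.2
    rw [eLpNorm_lt_top_iff_lintegral_rpow_enorm_lt_top (by simp) (by simp)] at this
    simpa using this
  have hi (i : ℤˣ × ℕ) : MemLp (fun l => g (i, l)) 2 (volume.restrict (Ioi 0)) := by
    refine ⟨(hm' i).aestronglyMeasurable, ?_⟩
    rw [eLpNorm_lt_top_iff_lintegral_rpow_enorm_lt_top (by simp) (by simp)]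
    rw [lintegral_rayMeasure (hm.measurable.enorm.pow_const 2)] at hlt
    simpa using (ENNReal.le_tsum i).trans_lt hlt
  have hz (i : ℤˣ × ℕ) : ∀ᵐ l, l ∈ Ioi (0 : ℝ) → g (i, l) = 0 := by
    refine isOpen_Ioi.ae_eq_zero_of_integral_contDiff_smul_eq_zero
      (locallyIntegrableOn_of_locallyIntegrable_restrict
        ((hi i).locallyIntegrable (by norm_num))) fun χ hχ hχc hχs => ?_
    have hψ : IsRayTest fun l => (χ l : ℂ) :=
      ⟨Complex.ofRealCLM.contDiff.comp hχ, hχc.comp_left Complex.ofReal_zero,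
        (tsupport_comp_subset Complex.ofReal_zero χ).trans hχs⟩
    rw [← h i _ hψ, setIntegral_eq_integral_of_forall_compl_eq_zero]
    · simp only [Complex.real_smul]
    · intro l hl
      rw [hψ.eq_zero (not_lt.1 hl), zero_mul]
  have h0 : ∫⁻ k, ‖g k‖ₑ ∂rayMeasure = 0 := by
    rw [lintegral_rayMeasure hm.measurable.enorm, ENNReal.tsum_eq_zero]
    intro i
    rw [lintegral_eq_zero_iff (hm' i).measurable.enorm]
    filter_upwards [(ae_restrict_iff' measurableSet_Ioi).2 (hz i)] with l hl
    simp [hl]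
  rw [lintegral_eq_zero_iff hm.measurable.enorm] at h0
  filter_upwards [h0] with k hk
  simpa using hk

theorem eLpNorm_rayCoeff (f : 𝓢(ℝ × ℝ, ℂ)) :
    eLpNorm (fun k : (ℤˣ × ℕ) × ℝ => rayCoeff f k.1 k.2) 2 rayMeasure = eLpNorm f 2 := by
  rw [eLpNorm_eq_lintegral_rpow_enorm_toReal (by simp) (by simp),
    eLpNorm_eq_lintegral_rpow_enorm_toReal (by simp) (by simp)]
  simp only [ENNReal.toReal_ofNat, ENNReal.rpow_ofNat]
  rw [lintegral_enorm_sq_rayCoeff]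

theorem memLp_rayCoeff (f : 𝓢(ℝ × ℝ, ℂ)) :
    MemLp (fun k : (ℤˣ × ℕ) × ℝ => rayCoeff f k.1 k.2) 2 rayMeasure := by
  refine ⟨(stronglyMeasurable_rayCoeff f).aestronglyMeasurable, ?_⟩
  have h : eLpNorm f 2 (volume : Measure (ℝ × ℝ)) < ∞ :=
    (f.memLp 2 (volume : Measure (ℝ × ℝ))).eLpNorm_lt_top
  exact (eLpNorm_rayCoeff f).trans_lt h

/-- The coefficient map on Schwartz functions. -/
noncomputable def rayCoeffLp : 𝓢(ℝ × ℝ, ℂ) →ₗ[ℂ] Lp ℂ 2 rayMeasure where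
  toFun f := (memLp_rayCoeff f).toLp
  map_add' f g := by
    refine Lp.ext ?_
    filter_upwards [(memLp_rayCoeff (f + g)).coeFn_toLp, (memLp_rayCoeff f).coeFn_toLp,
      (memLp_rayCoeff g).coeFn_toLp,
      Lp.coeFn_add (memLp_rayCoeff f).toLp (memLp_rayCoeff g).toLp] with k h1 h2 h3 h4
    rw [h1, h4, Pi.add_apply, h2, h3]
    exact rayCoeff_add f g k.1 k.2
  map_smul' c f := by
    refine Lp.ext ?_
    filter_upwards [(memLp_rayCoeff (c • f)).coeFn_toLp, (memLp_rayCoeff f).coeFn_toLp,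
      Lp.coeFn_smul c (memLp_rayCoeff f).toLp] with k h1 h2 h3
    rw [h1, RingHom.id_apply, h3, Pi.smul_apply, h2]
    exact rayCoeff_smul c f k.1 k.2

theorem coeFn_rayCoeffLp (f : 𝓢(ℝ × ℝ, ℂ)) :
    rayCoeffLp f =ᵐ[rayMeasure] fun k => rayCoeff f k.1 k.2 := (memLp_rayCoeff f).coeFn_toLp

theorem norm_rayCoeffLp (f : 𝓢(ℝ × ℝ, ℂ)) : ‖rayCoeffLp f‖ = ‖f.toLp 2‖ := by
  rw [SchwartzMap.norm_toLp, Lp.norm_def, eLpNorm_congr_ae (coeFn_rayCoeffLp f), eLpNorm_rayCoeff]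

/-- `F` is the wave packet with amplitude `ψ` on the ray `i`. -/
def IsWavePacket (ψ : ℝ → ℂ) (i : ℤˣ × ℕ) (F : 𝓢(ℝ × ℝ, ℂ)) : Prop :=
  IsRayTest ψ ∧ ∀ p, F p = ∫ l : ℝ, ψ l * rayWave i l p

/-- Wave packets probe one ray at a time, so orthogonality to all of them kills every slice. This
makes the transform surjective and later yields the density of ranges. -/
theorem eq_zero_of_inner_rayCoeffLp {g : Lp ℂ 2 rayMeasure}
    (h : ∀ ψ i F, IsWavePacket ψ i F → inner ℂ g (rayCoeffLp F) = 0) : g = 0 := by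
  have hgm := Lp.stronglyMeasurable g
  have hgm' : StronglyMeasurable fun k => starRingEnd ℂ (g k) :=
    Complex.continuous_conj.comp_stronglyMeasurable hgm
  have key := ae_eq_zero_of_forall_rayTest hgm'
    ((memLp_congr_norm hgm'.aestronglyMeasurable hgm.aestronglyMeasurable
      (Filter.Eventually.of_forall fun k => RCLike.norm_conj _)).2 (Lp.memLp g)) fun i ψ hψ => by
    obtain ⟨F, hF⟩ := hψ.exists_wavePacket i
    have h1 := h ψ i F ⟨hψ, hF⟩
    rw [L2.inner_def] at h1
    have h2 := hasSum_integral_rayMeasure (L2.integrable_inner (𝕜 := ℂ) g (rayCoeffLp F))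
    rw [h1] at h2
    have h3 : (fun k => inner ℂ (g k) (rayCoeffLp F k)) =ᵐ[rayMeasure]
        fun k => if k.1 = i then ψ k.2 * starRingEnd ℂ (g k) else 0 := by
      filter_upwards [coeFn_rayCoeffLp F, ae_rayMeasure_pos] with k hk hk0
      rw [hk, hψ.rayCoeff_wavePacket hF k.1 hk0, RCLike.inner_apply]
      split_ifs <;> simp
    have h4 := hasSum_integral_rayMeasure
      ((integrable_congr h3).1 (L2.integrable_inner (𝕜 := ℂ) g (rayCoeffLp F)))
    rw [← integral_congr_ae h3, h1] at h4
    have h5 := hasSum_single (f := fun j => ∫ l in Ioi (0 : ℝ),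
      if j = i then ψ l * starRingEnd ℂ (g (j, l)) else 0) i fun j hj => by simp [hj]
    have h6 := h5.unique h4
    simpa using h6
  refine Lp.ext ?_
  filter_upwards [key, Lp.coeFn_zero ℂ 2 rayMeasure] with k h1 h2
  rw [h2]
  simpa using h1

theorem denseRange_rayCoeffLp : DenseRange rayCoeffLp := by
  have h : (LinearMap.range rayCoeffLp).topologicalClosure = ⊤ := by
    rw [Submodule.topologicalClosure_eq_top_iff, Submodule.eq_bot_iff]
    intro g hg
    exact eq_zero_of_inner_rayCoeffLp fun ψ i F _ =>
      Submodule.inner_left_of_mem_orthogonal (LinearMap.mem_range_self rayCoeffLp F) hg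
  have h2 := (Submodule.dense_iff_topologicalClosure_eq_top).2 h
  rwa [LinearMap.coe_range] at h2

theorem denseRange_schwartz_toLp :
    DenseRange (SchwartzMap.toLpCLM ℂ ℂ 2 (volume : Measure (ℝ × ℝ))).toLinearMap :=
  SchwartzMap.denseRange_toLpCLM (F := ℂ) (μ := (volume : Measure (ℝ × ℝ))) ENNReal.ofNat_ne_top

/-- The joint spectral representation of `iU` and `G`. -/
noncomputable def rayTransform : GrushinL2 ≃ₗᵢ[ℂ] Lp ℂ 2 rayMeasure :=
  (LinearEquiv.refl ℂ 𝓢(ℝ × ℝ, ℂ)).extendOfIsometry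
    (SchwartzMap.toLpCLM ℂ ℂ 2 (volume : Measure (ℝ × ℝ))).toLinearMap rayCoeffLp
    denseRange_schwartz_toLp denseRange_rayCoeffLp norm_rayCoeffLp

theorem rayTransform_toLp (f : 𝓢(ℝ × ℝ, ℂ)) : rayTransform (f.toLp 2) = rayCoeffLp f :=
  LinearEquiv.extendOfIsometry_eq (LinearEquiv.refl ℂ 𝓢(ℝ × ℝ, ℂ))
    (SchwartzMap.toLpCLM ℂ ℂ 2 (volume : Measure (ℝ × ℝ))).toLinearMap rayCoeffLp
    denseRange_schwartz_toLp denseRange_rayCoeffLp norm_rayCoeffLp f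

theorem coeFn_rayTransform_toLp (f : 𝓢(ℝ × ℝ, ℂ)) :
    rayTransform (f.toLp 2) =ᵐ[rayMeasure] fun k => rayCoeff f k.1 k.2 := by
  rw [rayTransform_toLp]; exact coeFn_rayCoeffLp f

theorem eq_zero_of_inner_wavePacket {g : GrushinL2}
    (h : ∀ ψ i F, IsWavePacket ψ i F → inner ℂ g (F.toLp 2) = 0) : g = 0 := by
  apply rayTransform.injective
  rw [map_zero]
  refine eq_zero_of_inner_rayCoeffLp fun ψ i F hF => ?_
  rw [← rayTransform_toLp, LinearIsometryEquiv.inner_map_map]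
  exact h ψ i F hF

end SpectralTransform

/-! ### Density of test functions in the Schwartz topology -/

section Cutoff

/-- Dilates of one bump function: scaling by 1/(N+1) ≤ 1 does not increase any derivative, so the
bounds M are independent of N. -/
theorem exists_cutoff : ∃ χ : ℕ → ℝ × ℝ → ℝ, ∃ M : ℕ → ℝ, (∀ i, 0 ≤ M i) ∧
    (∀ N, ContDiff ℝ (⊤ : ℕ∞) (χ N)) ∧ (∀ N, HasCompactSupport (χ N)) ∧
    (∀ (N : ℕ) (p : ℝ × ℝ), ‖p‖ < N + 1 → χ N p = 1) ∧ ∀ N i p, ‖iteratedFDeriv ℝ i (χ N) p‖ ≤ M i := by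
  let b : ContDiffBump (0 : ℝ × ℝ) := ⟨1, 2, one_pos, one_lt_two⟩
  have hb : ContDiff ℝ (⊤ : ℕ∞) b := b.contDiff
  have hM (i : ℕ) : ∃ C, ∀ p, ‖iteratedFDeriv ℝ i b p‖ ≤ C :=
    (b.hasCompactSupport.iteratedFDeriv i).exists_bound_of_continuous
      (hb.continuous_iteratedFDeriv (by exact_mod_cast le_top))
  choose M hM using hM
  have hM0 (i : ℕ) : 0 ≤ M i := (norm_nonneg _).trans (hM i 0)
  let L (N : ℕ) : ℝ × ℝ →L[ℝ] ℝ × ℝ := ((N : ℝ) + 1)⁻¹ • ContinuousLinearMap.id ℝ (ℝ × ℝ)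
  have hLn (N : ℕ) : ‖L N‖ ≤ 1 := by
    refine ContinuousLinearMap.opNorm_le_bound _ zero_le_one fun p => ?_
    change ‖((N : ℝ) + 1)⁻¹ • p‖ ≤ 1 * ‖p‖
    rw [norm_smul, Real.norm_eq_abs, abs_of_pos (by positivity)]
    gcongr
    exact inv_le_one_of_one_le₀ (by linarith [(Nat.cast_nonneg N : (0 : ℝ) ≤ N)])
  refine ⟨fun N p => b (L N p), M, hM0, fun N => hb.comp (L N).contDiff, fun N => ?_,
    fun N p hp => ?_, fun N i p => ?_⟩
  · exact b.hasCompactSupport.comp_homeomorph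
      (Homeomorph.smulOfNeZero ((N : ℝ) + 1)⁻¹ (by positivity))
  · refine b.one_of_mem_closedBall ?_
    rw [mem_closedBall_zero_iff]
    change ‖((N : ℝ) + 1)⁻¹ • p‖ ≤ 1
    rw [norm_smul, Real.norm_eq_abs, abs_of_pos (by positivity), inv_mul_le_iff₀ (by positivity)]
    linarith
  · change ‖iteratedFDeriv ℝ i (⇑b ∘ ⇑(L N)) p‖ ≤ M i
    rw [(L N).iteratedFDeriv_comp_right hb p (i := i) (by exact_mod_cast le_top)]
    refine (ContinuousMultilinearMap.norm_compContinuousLinearMap_le _ _).trans ?_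
    rw [Finset.prod_const]
    calc _ ≤ M i * 1 := by
          gcongr
          · exact hM0 i
          · exact hM i _
          · exact pow_le_one₀ (norm_nonneg _) (hLn N)
      _ = M i := mul_one _

/-- The error vanishes where ‖p‖ < N + 1. Elsewhere one extra power of ‖p‖, paid by a higher
seminorm of f, gains the factor 1/(N+1). -/
theorem exists_tendsto_testSpace (f : 𝓢(ℝ × ℝ, ℂ)) :
    ∃ s : ℕ → testSpace, Filter.Tendsto (fun n => (s n : 𝓢(ℝ × ℝ, ℂ))) Filter.atTop (nhds f) := by
  obtain ⟨χ, M, hM0, hχ, hχc, hχ1, hχM⟩ := exists_cutoff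
  have hc (N : ℕ) : HasCompactSupport fun p => χ N p • f p := (hχc N).smul_right
  have hs (N : ℕ) : ContDiff ℝ (⊤ : ℕ∞) fun p => χ N p • f p := (hχ N).smul f.smooth'
  let F (N : ℕ) : 𝓢(ℝ × ℝ, ℂ) := (hc N).toSchwartzMap (hs N)
  have hF (N : ℕ) : ⇑(F N) = fun p => χ N p • f p := rfl
  refine ⟨fun N => ⟨F N, hc N⟩, ?_⟩
  rw [(schwartz_withSeminorms ℝ (ℝ × ℝ) ℂ).tendsto_nhds]
  rintro ⟨k, n⟩ ε hε
  set C : ℝ := SchwartzMap.seminorm ℝ (k + 1) n f + ∑ i ∈ Finset.range (n + 1),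
    (n.choose i : ℝ) * M i * SchwartzMap.seminorm ℝ (k + 1) (n - i) f with hC
  have hC0 : 0 ≤ C := add_nonneg (apply_nonneg _ _) (Finset.sum_nonneg fun i _ =>
    mul_nonneg (mul_nonneg (by positivity) (hM0 i)) (apply_nonneg _ _))
  have key (N : ℕ) : SchwartzMap.seminorm ℝ k n (F N - f) ≤ C / (N + 1) := by
    refine SchwartzMap.seminorm_le_bound _ _ _ _ (by positivity) fun p => ?_
    by_cases hp : ‖p‖ < N + 1
    · have h0 : ⇑(F N - f) =ᶠ[nhds p] fun _ => 0 := by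
        filter_upwards [(isOpen_lt continuous_norm continuous_const).mem_nhds hp] with q hq
        rw [sub_apply, hF]
        simp only
        rw [hχ1 N q hq, one_smul, sub_self]
      rw [(Filter.EventuallyEq.iteratedFDeriv ℝ h0 n).eq_of_nhds]
      have h1 : iteratedFDeriv ℝ n (fun _ : ℝ × ℝ => (0 : ℂ)) p = 0 := by
        simp
      rw [h1, norm_zero, mul_zero]
      positivity
    · have hp' : (N : ℝ) + 1 ≤ ‖p‖ := not_lt.1 hp
      have e : iteratedFDeriv ℝ n (⇑(F N - f)) p =
          iteratedFDeriv ℝ n (F N) p - iteratedFDeriv ℝ n f p := by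
        have : ⇑(F N - f) = ⇑(F N) - ⇑f := rfl
        rw [this, iteratedFDeriv_sub_apply ((F N).smooth n).contDiffAt (f.smooth n).contDiffAt]
      have h1 : ‖iteratedFDeriv ℝ n (F N) p‖ ≤ ∑ i ∈ Finset.range (n + 1),
          (n.choose i : ℝ) * ‖iteratedFDeriv ℝ i (χ N) p‖ * ‖iteratedFDeriv ℝ (n - i) f p‖ :=
        norm_iteratedFDeriv_smul_le (hχ N) f.smooth' p (by exact_mod_cast le_top)
      rw [le_div_iff₀ (by positivity)]
      calc ‖p‖ ^ k * ‖iteratedFDeriv ℝ n (⇑(F N - f)) p‖ * (N + 1)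
          ≤ ‖p‖ ^ k * ‖iteratedFDeriv ℝ n (⇑(F N - f)) p‖ * ‖p‖ := by gcongr
        _ = ‖p‖ ^ (k + 1) * ‖iteratedFDeriv ℝ n (⇑(F N - f)) p‖ := by ring
        _ ≤ ‖p‖ ^ (k + 1) * (‖iteratedFDeriv ℝ n f p‖ + ∑ i ∈ Finset.range (n + 1),
              (n.choose i : ℝ) * M i * ‖iteratedFDeriv ℝ (n - i) f p‖) := by
            gcongr
            rw [e, add_comm]
            refine (norm_sub_le _ _).trans (add_le_add (h1.trans ?_) le_rfl)
            refine Finset.sum_le_sum fun i _ => ?_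
            gcongr
            exact hχM N i p
        _ = ‖p‖ ^ (k + 1) * ‖iteratedFDeriv ℝ n f p‖ + ∑ i ∈ Finset.range (n + 1),
              (n.choose i : ℝ) * M i * (‖p‖ ^ (k + 1) * ‖iteratedFDeriv ℝ (n - i) f p‖) := by
            rw [mul_add, Finset.mul_sum]
            congr 1
            exact Finset.sum_congr rfl fun i _ => by ring
        _ ≤ C := by
            refine add_le_add (SchwartzMap.le_seminorm ℝ _ _ _ _) (Finset.sum_le_sum fun i _ => ?_)
            exact mul_le_mul_of_nonneg_left (SchwartzMap.le_seminorm ℝ _ _ _ _)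
              (mul_nonneg (by positivity) (hM0 i))
  have hlim : Filter.Tendsto (fun N : ℕ => C / ((N : ℝ) + 1)) Filter.atTop (nhds 0) :=
    tendsto_const_div_atTop_nhds_zero_nat C |>.comp (Filter.tendsto_add_atTop_nat 1) |>.congr
      fun N => by simp
  filter_upwards [hlim.eventually (gt_mem_nhds hε)] with N hN
  exact (key N).trans_lt hN

end Cutoff

/-! ### The three operators as multiplication operators -/

section Cores

theorem mem_graph_minimalOperator (D : 𝓢(ℝ × ℝ, ℂ) →ₗ[ℂ] 𝓢(ℝ × ℝ, ℂ)) {v w : GrushinL2} :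
    (v, w) ∈ (minimalOperator D).graph ↔
      ∃ φ : testSpace, v = (φ : 𝓢(ℝ × ℝ, ℂ)).toLp 2 ∧ w = (D φ).toLp 2 := by
  have h (φ : testSpace) (hφ : testEmbedding φ ∈ (minimalOperator D).domain) :
      minimalOperator D ⟨testEmbedding φ, hφ⟩ = (D φ).toLp 2 := by
    have e : (⟨testEmbedding φ, hφ⟩ : (minimalOperator D).domain) =
      LinearEquiv.ofInjective testEmbedding testEmbedding_injective φ := rfl
    change (D (((LinearEquiv.ofInjective testEmbedding testEmbedding_injective).symm
      ⟨testEmbedding φ, hφ⟩ : testSpace) : 𝓢(ℝ × ℝ, ℂ))).toLp 2 = _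
    erw [e, LinearEquiv.symm_apply_apply]
  rw [LinearPMap.mem_graph_iff]
  constructor
  · rintro ⟨⟨x, φ, rfl⟩, hx, hw⟩
    exact ⟨φ, hx.symm, hw.symm.trans (h φ _)⟩
  · rintro ⟨φ, rfl, rfl⟩
    exact ⟨⟨testEmbedding φ, φ, rfl⟩, rfl, h φ _⟩

/-- Wave packets are only known to be Schwartz functions, not test functions, so they enter the
domain through the closure. -/
theorem toLp_mem_closure_graph {D : 𝓢(ℝ × ℝ, ℂ) →ₗ[ℂ] 𝓢(ℝ × ℝ, ℂ)} (hD : Continuous D)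
    (f : 𝓢(ℝ × ℝ, ℂ)) :
    ((f.toLp 2, (D f).toLp 2) : GrushinL2 × GrushinL2) ∈
      (minimalOperator D).graph.topologicalClosure := by
  obtain ⟨s, hs⟩ := exists_tendsto_testSpace f
  have hc : Continuous fun f : 𝓢(ℝ × ℝ, ℂ) => (f.toLp 2 : GrushinL2) := SchwartzMap.continuous_toLp
  have h1 := (hc.tendsto f).comp hs
  have h2 := ((hc.comp hD).tendsto f).comp hs
  refine mem_closure_of_tendsto (h1.prodMk_nhds h2) (Filter.Eventually.of_forall fun n => ?_)
  exact (mem_graph_minimalOperator D).2 ⟨s n, rfl, rfl⟩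

theorem continuous_grushinSchwartz : Continuous grushinSchwartz := by
  have hx : Continuous partialX :=
    (LineDeriv.lineDerivOpCLM ℂ 𝓢(ℝ × ℝ, ℂ) ((1, 0) : ℝ × ℝ)).continuous
  have hu : Continuous partialU :=
    (LineDeriv.lineDerivOpCLM ℂ 𝓢(ℝ × ℝ, ℂ) ((0, 1) : ℝ × ℝ)).continuous
  have hm : Continuous mulXSq :=
    (SchwartzMap.smulLeftCLM ℂ (fun p : ℝ × ℝ => ((p.1 ^ 2 : ℝ) : ℂ))).continuous
  exact ((hx.comp hx).add (hm.comp (hu.comp hu))).neg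

theorem continuous_I_smul_partialU : Continuous (Complex.I • partialU) := by
  have hu : Continuous partialU :=
    (LineDeriv.lineDerivOpCLM ℂ 𝓢(ℝ × ℝ, ℂ) ((0, 1) : ℝ × ℝ)).continuous
  exact hu.const_smul Complex.I

theorem toLp_mem_multiplicationGraph {c : (ℤˣ × ℕ) × ℝ → ℝ} {f g : 𝓢(ℝ × ℝ, ℂ)}
    (h : ∀ i l, 0 < l → rayCoeff g i l = c (i, l) * rayCoeff f i l) :
    ((f.toLp 2, g.toLp 2) : GrushinL2 × GrushinL2) ∈ multiplicationGraph rayTransform c := by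
  rw [mem_multiplicationGraph]
  filter_upwards [coeFn_rayTransform_toLp f, coeFn_rayTransform_toLp g, ae_rayMeasure_pos]
    with k h1 h2 h3
  rw [h1, h2]
  exact h k.1 k.2 h3

theorem ofReal_sub_I_ne_zero (r : ℝ) : (r : ℂ) - Complex.I ≠ 0 := fun h => by
  have := congrArg Complex.im h
  simp at this

theorem toLp_eq_of_rayCoeff {f : 𝓢(ℝ × ℝ, ℂ)} {g : GrushinL2}
    (h : rayTransform g =ᵐ[rayMeasure] fun k => rayCoeff f k.1 k.2) : g = f.toLp 2 := by
  apply rayTransform.injective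
  refine Lp.ext ?_
  filter_upwards [h, coeFn_rayTransform_toLp f] with k h1 h2
  rw [h1, h2]

/-- A criterion for the totality hypothesis of `isMultiplication_closure`. -/
theorem eq_zero_of_inner_sub_I {c : (ℤˣ × ℕ) × ℝ → ℝ} (a b : ℤˣ × ℕ → ℝ)
    (hc : ∀ i l, c (i, l) = a i * l + b i) {Γ : Submodule ℂ (GrushinL2 × GrushinL2)}
    (hΓ : Γ ≤ multiplicationGraph rayTransform c)
    (hmem : ∀ ψ i H, IsWavePacket ψ i H → ∃ w, ((H.toLp 2 : GrushinL2), w) ∈ Γ)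
    (g : GrushinL2) (hg : ∀ v w, (v, w) ∈ Γ → inner ℂ g (w - Complex.I • v) = 0) : g = 0 := by
  refine eq_zero_of_inner_wavePacket fun ψ i F hF => ?_
  -- The resolvent of the multiplier is smooth in λ because c is real, so the packet F equals
  -- (closure - i)H for another packet H.
  have hψ' : IsRayTest fun l => ψ l * (((a i * l + b i : ℝ) : ℂ) - Complex.I)⁻¹ := by
    refine hF.1.mul (ContDiff.contDiffOn ?_)
    exact ((Complex.ofRealCLM.contDiff.comp
      ((contDiff_const.mul contDiff_id).add contDiff_const)).sub contDiff_const).inv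
      fun l => ofReal_sub_I_ne_zero _
  obtain ⟨H, hH⟩ := hψ'.exists_wavePacket i
  obtain ⟨w, hw⟩ := hmem _ i H ⟨hψ', hH⟩
  have h2 : w - Complex.I • (H.toLp 2 : GrushinL2) = F.toLp 2 := by
    refine toLp_eq_of_rayCoeff ?_
    rw [map_sub, map_smul]
    filter_upwards [mem_multiplicationGraph.1 (hΓ hw), coeFn_rayTransform_toLp H,
      Lp.coeFn_sub (rayTransform w) (Complex.I • rayTransform (H.toLp 2)),
      Lp.coeFn_smul Complex.I (rayTransform (H.toLp 2)), ae_rayMeasure_pos] with k h1 h2 h3 h4 h5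
    rw [h3, Pi.sub_apply, h4, Pi.smul_apply, h1, h2, hψ'.rayCoeff_wavePacket hH k.1 h5,
      hF.1.rayCoeff_wavePacket hF.2 k.1 h5]
    split_ifs with hk
    · have e : c k = a i * k.2 + b i := by rw [← hk]; exact hc k.1 k.2
      rw [e, smul_eq_mul, ← sub_mul, mul_comm, inv_mul_cancel_right₀ (ofReal_sub_I_ne_zero _)]
    · simp
  rw [← h2]
  exact hg _ w hw

theorem isMultiplication_closure_minimalOperator {D : 𝓢(ℝ × ℝ, ℂ) →ₗ[ℂ] 𝓢(ℝ × ℝ, ℂ)}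
    (hD : Continuous D) (a : ℤˣ × ℕ → ℝ)
    (h : ∀ f i l, 0 < l → rayCoeff (D f) i l = ((a i * l : ℝ) : ℂ) * rayCoeff f i l) :
    IsMultiplication rayTransform (fun k => a k.1 * k.2) (minimalOperator D).closure := by
  have hm : Measurable fun k : (ℤˣ × ℕ) × ℝ => a k.1 * k.2 :=
    ((measurable_of_countable a).comp measurable_fst).mul measurable_snd
  have hle : (minimalOperator D).graph ≤ multiplicationGraph rayTransform fun k => a k.1 * k.2 := by
    rintro ⟨v, w⟩ hvw
    obtain ⟨φ, rfl, rfl⟩ := (mem_graph_minimalOperator D).1 hvw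
    exact toLp_mem_multiplicationGraph (h φ)
  refine isMultiplication_closure hm hle
    (eq_zero_of_inner_sub_I a 0 (fun i l => by simp)
      (Submodule.topologicalClosure_minimal _ hle (isClosed_multiplicationGraph hm))
      fun ψ i H _ => ⟨_, toLp_mem_closure_graph hD H⟩)

theorem isMultiplication_iUOperator :
    IsMultiplication rayTransform (fun k => signVal k.1.1 * k.2) iUOperator :=
  isMultiplication_closure_minimalOperator continuous_I_smul_partialU (fun i => signVal i.1)
    fun f i l _ => rayCoeff_iU f i l

theorem isMultiplication_grushinOperator :
    IsMultiplication rayTransform (fun k => (2 * k.1.2 + 1) * k.2) grushinOperator :=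
  isMultiplication_closure_minimalOperator continuous_grushinSchwartz (fun i => 2 * i.2 + 1)
    fun f i _ hl => rayCoeff_grushin f i hl.le

theorem signVal_ne_zero (ε : ℤˣ) : signVal ε ≠ 0 := fun h => by
  have := signVal_mul_self ε
  simp [h] at this

theorem isMultiplication_grushinQuotient :
    IsMultiplication rayTransform (fun k => signVal k.1.1 * (2 * k.1.2 + 1)) grushinQuotient := by
  have hb : ∀ᵐ k ∂rayMeasure, signVal k.1.1 * k.2 ≠ 0 := by
    filter_upwards [ae_rayMeasure_pos] with k hk
    exact mul_ne_zero (signVal_ne_zero _) hk.ne'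
  have hm : Measurable fun k : (ℤˣ × ℕ) × ℝ => signVal k.1.1 * (2 * k.1.2 + 1) :=
    (measurable_of_countable fun i : ℤˣ × ℕ => signVal i.1 * (2 * i.2 + 1)).comp measurable_fst
  have hle := isMultiplication_grushinOperator.graph_mulNat_inverse_le isMultiplication_iUOperator hb
    (c := fun k => signVal k.1.1 * (2 * k.1.2 + 1)) fun k => by
      linear_combination (-(2 * (k.1.2 : ℝ) + 1) * k.2) * signVal_mul_self k.1.1
  refine isMultiplication_closure hm hle
    (eq_zero_of_inner_sub_I 0 (fun i => signVal i.1 * (2 * i.2 + 1)) (fun i l => by simp)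
      (Submodule.topologicalClosure_minimal _ hle (isClosed_multiplicationGraph hm))
      fun ψ i H hH => ?_)
  -- Dividing the amplitude by ελ gives the packet V = (iU)⁻¹H, to which G applies. Hence H already
  -- lies in the natural domain of the product.
  have hinv : IsRayTest fun l => ψ l * ((signVal i.1 * l : ℝ) : ℂ)⁻¹ := by
    refine hH.1.mul ?_
    have h1 : ContDiffOn ℝ (⊤ : ℕ∞) (fun l : ℝ => (signVal i.1 * l)⁻¹) (Ioi 0) :=
      (contDiffOn_const.mul contDiffOn_id).inv fun l hl =>
        mul_ne_zero (signVal_ne_zero _) (ne_of_gt hl)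
    refine (Complex.ofRealCLM.contDiff.comp_contDiffOn h1).congr fun l _ => ?_
    simp
  obtain ⟨V, hV⟩ := hinv.exists_wavePacket i
  refine ⟨(grushinSchwartz V).toLp 2, Submodule.le_topologicalClosure _ ?_⟩
  rw [LinearPMap.mem_graph_mulNat]
  refine ⟨V.toLp 2, ?_, ?_⟩
  · rw [isMultiplication_iUOperator.mem_graph_inverse hb, isMultiplication_iUOperator,
      ← mem_multiplicationGraph]
    refine toLp_mem_multiplicationGraph fun j l hl => ?_
    rw [hH.1.rayCoeff_wavePacket hH.2 j hl, hinv.rayCoeff_wavePacket hV j hl]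
    split_ifs with hj
    · subst hj
      have : ((signVal j.1 * l : ℝ) : ℂ) ≠ 0 :=
        Complex.ofReal_ne_zero.2 (mul_ne_zero (signVal_ne_zero _) hl.ne')
      rw [mul_comm, inv_mul_cancel_right₀ this]
    · rw [mul_zero]
  · rw [isMultiplication_grushinOperator, ← mem_multiplicationGraph]
    exact toLp_mem_multiplicationGraph fun j l hl => rayCoeff_grushin V j hl.le

end Cores

/-! ### Pointwise inversion formula -/

section Inversion

theorem integrable_rayWave_bound (i : ℤˣ × ℕ) {l : ℝ} (hl : 0 < l) :
    Integrable (fun p : ℝ × ℝ =>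
        (√l * hermiteFn i.2 (√l * p.1) ^ 2 + (1 + p.1 ^ 2)⁻¹) * (1 + p.2 ^ 2)⁻¹) ∧
      ∫ p : ℝ × ℝ, (√l * hermiteFn i.2 (√l * p.1) ^ 2 + (1 + p.1 ^ 2)⁻¹) * (1 + p.2 ^ 2)⁻¹ =
        (1 + Real.pi) * Real.pi := by
  have hs := Real.sqrt_pos.2 hl
  have h1 : Integrable fun x => hermiteFn i.2 x * hermiteFn i.2 x := by
    rw [hermiteFn_eq']; exact integrable_polyGauss_mul _ _
  have h2 : Integrable fun x => √l * hermiteFn i.2 (√l * x) ^ 2 := by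
    simp only [sq]
    exact (h1.comp_mul_left' hs.ne').const_mul _
  have h3 : ∫ x, √l * hermiteFn i.2 (√l * x) ^ 2 = 1 := by
    simp only [sq]
    rw [integral_const_mul, integral_hermiteFn_scaled_mul hl, if_pos rfl, mul_one,
      mul_inv_cancel₀ hs.ne']
  have h4 := h2.add integrable_inv_one_add_sq
  refine ⟨h4.mul_prod integrable_inv_one_add_sq, ?_⟩
  rw [Measure.volume_eq_prod, integral_prod_mul
    (fun x : ℝ => √l * hermiteFn i.2 (√l * x) ^ 2 + (1 + x ^ 2)⁻¹) (fun u : ℝ => (1 + u ^ 2)⁻¹),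
    integral_add h2 integrable_inv_one_add_sq, h3, integral_univ_inv_one_add_sq]

/-- Estimating |w| v by |w|² + v² with v = 1/(1+x²) uses only the L² normalization of hₙ. The
resulting weighted L¹ bound is the same for all (ε, n, λ), with no pointwise bounds uniform in n. -/
theorem norm_rayWave_mul_le (i : ℤˣ × ℕ) {l : ℝ} (hl : 0 < l) (p : ℝ × ℝ) :
    ‖rayWave i l p‖ * ((1 + p.1 ^ 2)⁻¹ * (1 + p.2 ^ 2)⁻¹) ≤
      (√l * hermiteFn i.2 (√l * p.1) ^ 2 + (1 + p.1 ^ 2)⁻¹) * (1 + p.2 ^ 2)⁻¹ := by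
  rw [← mul_assoc]
  gcongr
  have hs := Real.sqrt_pos.2 hl
  have h1 : ‖rayWave i l p‖ ^ 2 ≤ √l * hermiteFn i.2 (√l * p.1) ^ 2 := by
    rw [norm_rayWave, mul_pow, sq_abs, div_pow, Real.sq_sqrt hs.le, Real.sq_sqrt (by positivity)]
    gcongr
    exact div_le_self hs.le (by linarith [Real.pi_gt_three])
  have h2 : (1 + p.1 ^ 2)⁻¹ ≤ 1 := inv_le_one_of_one_le₀ (by nlinarith [sq_nonneg p.1])
  have h3 : 0 ≤ (1 + p.1 ^ 2)⁻¹ := by positivity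
  nlinarith [sq_nonneg (‖rayWave i l p‖ - (1 + p.1 ^ 2)⁻¹), norm_nonneg (rayWave i l p),
    mul_nonneg (norm_nonneg (rayWave i l p)) h3]

/-- The weight `1 / ((1 + x²) (1 + u²))`. -/
noncomputable def planeWeight (p : ℝ × ℝ) : ℝ := (1 + p.1 ^ 2)⁻¹ * (1 + p.2 ^ 2)⁻¹

theorem planeWeight_pos (p : ℝ × ℝ) : 0 < planeWeight p := by unfold planeWeight; positivity

theorem continuous_planeWeight : Continuous planeWeight := by
  unfold planeWeight
  exact ((continuous_const.add (continuous_fst.pow 2)).inv₀ fun p =>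
    (by positivity : (1 : ℝ) + p.1 ^ 2 ≠ 0)).mul
    ((continuous_const.add (continuous_snd.pow 2)).inv₀ fun p =>
      (by positivity : (1 : ℝ) + p.2 ^ 2 ≠ 0))

variable {g : (ℤˣ × ℕ) × ℝ → ℂ}

theorem stronglyMeasurable_mul_rayWave (hm : StronglyMeasurable g) :
    StronglyMeasurable fun q : ((ℤˣ × ℕ) × ℝ) × (ℝ × ℝ) => g q.1 * rayWave q.1.1 q.1.2 q.2 :=
  (hm.comp_measurable measurable_fst).mul measurable_rayWave.stronglyMeasurable

theorem integrable_weighted_rayWave (hm : StronglyMeasurable g) (hg : Integrable g rayMeasure) :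
    Integrable (fun q : ((ℤˣ × ℕ) × ℝ) × (ℝ × ℝ) =>
      (planeWeight q.2 : ℂ) * (g q.1 * rayWave q.1.1 q.1.2 q.2)) (rayMeasure.prod volume) := by
  have hw : Continuous fun p => (planeWeight p : ℂ) :=
    Complex.continuous_ofReal.comp continuous_planeWeight
  have hS : StronglyMeasurable fun q : ((ℤˣ × ℕ) × ℝ) × (ℝ × ℝ) =>
      (planeWeight q.2 : ℂ) * (g q.1 * rayWave q.1.1 q.1.2 q.2) :=
    (hw.stronglyMeasurable.comp_measurable measurable_snd).mul (stronglyMeasurable_mul_rayWave hm)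
  have hle (k : (ℤˣ × ℕ) × ℝ) (hk : 0 < k.2) (p : ℝ × ℝ) :
      ‖(planeWeight p : ℂ) * (g k * rayWave k.1 k.2 p)‖ ≤ ‖g k‖ *
        ((√k.2 * hermiteFn k.1.2 (√k.2 * p.1) ^ 2 + (1 + p.1 ^ 2)⁻¹) * (1 + p.2 ^ 2)⁻¹) := by
    rw [norm_mul, norm_mul, Complex.norm_real, Real.norm_eq_abs, abs_of_pos (planeWeight_pos p),
      mul_left_comm, mul_comm (planeWeight p)]
    exact mul_le_mul_of_nonneg_left (norm_rayWave_mul_le k.1 hk p) (norm_nonneg _)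
  rw [integrable_prod_iff hS.aestronglyMeasurable]
  constructor
  · filter_upwards [ae_rayMeasure_pos] with k hk
    exact ((integrable_rayWave_bound k.1 hk).1.const_mul ‖g k‖).mono'
      (hS.comp_measurable measurable_prodMk_left).aestronglyMeasurable
      (Filter.Eventually.of_forall (hle k hk))
  · refine (hg.norm.mul_const ((1 + Real.pi) * Real.pi)).mono'
      hS.norm.integral_prod_right.aestronglyMeasurable ?_
    filter_upwards [ae_rayMeasure_pos] with k hk
    have hi := (integrable_rayWave_bound k.1 hk).1.const_mul ‖g k‖
    rw [Real.norm_eq_abs, abs_of_nonneg (integral_nonneg fun p => norm_nonneg _),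
      ← (integrable_rayWave_bound k.1 hk).2, ← integral_const_mul]
    exact integral_mono_of_nonneg (Filter.Eventually.of_forall fun p => norm_nonneg _) hi
      (Filter.Eventually.of_forall (hle k hk))

theorem ae_integrable_mul_rayWave (hm : StronglyMeasurable g) (hg : Integrable g rayMeasure) :
    ∀ᵐ p : ℝ × ℝ, Integrable (fun k => g k * rayWave k.1 k.2 p) rayMeasure := by
  filter_upwards [(integrable_weighted_rayWave hm hg).prod_left_ae] with p hp
  have := hp.const_mul ((planeWeight p : ℂ)⁻¹)
  have h0 : (planeWeight p : ℂ) ≠ 0 := Complex.ofReal_ne_zero.2 (planeWeight_pos p).ne'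
  simpa only [inv_mul_cancel_left₀ h0] using this

theorem locallyIntegrable_integral_rayWave (hm : StronglyMeasurable g)
    (hg : Integrable g rayMeasure) :
    LocallyIntegrable fun p : ℝ × ℝ => ∫ k, g k * rayWave k.1 k.2 p ∂rayMeasure := by
  have h1 := (integrable_weighted_rayWave hm hg).integral_prod_right.locallyIntegrable
  simp only [integral_const_mul] at h1
  rw [← locallyIntegrableOn_univ] at h1 ⊢
  have hc : Continuous fun p => (planeWeight p : ℂ)⁻¹ :=
    (Complex.continuous_ofReal.comp continuous_planeWeight).inv₀ fun p =>
      Complex.ofReal_ne_zero.2 (planeWeight_pos p).ne'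
  have h2 := h1.continuousOn_mul hc.continuousOn isOpen_univ.isLocallyClosed
  refine h2.congr (Filter.Eventually.of_forall fun p => ?_)
  exact inv_mul_cancel_left₀ (Complex.ofReal_ne_zero.2 (planeWeight_pos p).ne') _

/-- Pairing the inversion integral with a test function turns, by Fubini, into a pairing of
coefficients. The compact support of χ makes division by the weight harmless. -/
theorem integral_test_mul_rayWave (hm : StronglyMeasurable g) (hg : Integrable g rayMeasure)
    {χ : ℝ × ℝ → ℝ} (hχ : Continuous χ) (hχc : HasCompactSupport χ) :
    ∫ p : ℝ × ℝ, (χ p : ℂ) * ∫ k, g k * rayWave k.1 k.2 p ∂rayMeasure =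
      ∫ k, g k * starRingEnd ℂ (rayCoeff (fun p => (χ p : ℂ)) k.1 k.2) ∂rayMeasure := by
  have hq : Continuous fun p => χ p / planeWeight p :=
    hχ.div continuous_planeWeight fun p => (planeWeight_pos p).ne'
  have hqc : HasCompactSupport fun p => χ p / planeWeight p := by
    simp only [div_eq_mul_inv]; exact hχc.mul_right
  obtain ⟨C, hC⟩ := hqc.exists_bound_of_continuous hq
  have hi : Integrable (fun q : ((ℤˣ × ℕ) × ℝ) × (ℝ × ℝ) =>
      (χ q.2 : ℂ) * (g q.1 * rayWave q.1.1 q.1.2 q.2)) (rayMeasure.prod volume) := by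
    have h1 := (integrable_weighted_rayWave hm hg).bdd_mul (c := C)
      (f := fun q : ((ℤˣ × ℕ) × ℝ) × (ℝ × ℝ) => ((χ q.2 / planeWeight q.2 : ℝ) : ℂ))
      ((Complex.continuous_ofReal.comp hq).measurable.comp measurable_snd).aestronglyMeasurable
      (Filter.Eventually.of_forall fun q => by rw [Complex.norm_real]; exact hC q.2)
    refine h1.congr (Filter.Eventually.of_forall fun q => ?_)
    have h0 : (planeWeight q.2 : ℂ) ≠ 0 := Complex.ofReal_ne_zero.2 (planeWeight_pos q.2).ne'
    simp only [Complex.ofReal_div]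
    rw [← mul_assoc, div_mul_cancel₀ _ h0]
  calc ∫ p : ℝ × ℝ, (χ p : ℂ) * ∫ k, g k * rayWave k.1 k.2 p ∂rayMeasure
      = ∫ p : ℝ × ℝ, ∫ k, (χ p : ℂ) * (g k * rayWave k.1 k.2 p) ∂rayMeasure := by
        simp only [integral_const_mul]
    _ = ∫ k, (∫ p : ℝ × ℝ, (χ p : ℂ) * (g k * rayWave k.1 k.2 p)) ∂rayMeasure :=
        (integral_integral_swap (f := fun (k : (ℤˣ × ℕ) × ℝ) (p : ℝ × ℝ) =>
          (χ p : ℂ) * (g k * rayWave k.1 k.2 p)) hi).symm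
    _ = _ := by
        congr 1; ext k
        rw [rayCoeff, ← integral_conj, ← integral_const_mul]
        congr 1; ext p
        rw [map_mul, Complex.conj_conj, Complex.conj_ofReal]
        ring

/-- The inversion formula for `rayTransform`. -/
theorem ae_eq_integral_rayWave (hm : StronglyMeasurable g) (hg : Integrable g rayMeasure)
    {h : GrushinL2} (hW : rayTransform h =ᵐ[rayMeasure] g) :
    ∀ᵐ p : ℝ × ℝ, h p = ∫ k, g k * rayWave k.1 k.2 p ∂rayMeasure := by
  refine ae_eq_of_integral_contDiff_smul_eq ((Lp.memLp h).locallyIntegrable (by norm_num))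
    (locallyIntegrable_integral_rayWave hm hg) fun χ hχ hχc => ?_
  -- Both sides are tested against real χ: unitarity of the transform turns ∫ χ h into the same
  -- pairing of coefficients.
  simp only [Complex.real_smul]
  rw [integral_test_mul_rayWave hm hg hχ.continuous hχc]
  have hc : HasCompactSupport fun p => (χ p : ℂ) := hχc.comp_left Complex.ofReal_zero
  let φ : 𝓢(ℝ × ℝ, ℂ) := hc.toSchwartzMap (Complex.ofRealCLM.contDiff.comp hχ)
  have hφ : ⇑φ = fun p => (χ p : ℂ) := rfl
  have h1 : inner ℂ (φ.toLp 2 : GrushinL2) h = ∫ p : ℝ × ℝ, (χ p : ℂ) * h p := by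
    rw [L2.inner_def]
    refine integral_congr_ae ?_
    filter_upwards [SchwartzMap.coeFn_toLp φ 2 (volume : Measure (ℝ × ℝ))] with p hp
    rw [hp, hφ, RCLike.inner_apply, Complex.conj_ofReal, mul_comm]
  rw [← h1, ← rayTransform.inner_map_map, L2.inner_def]
  refine integral_congr_ae ?_
  filter_upwards [coeFn_rayTransform_toLp φ, hW] with k h2 h3
  rw [h2, h3, RCLike.inner_apply, hφ]

/-- Pointwise formula for a bounded function of the multiplication operators. -/
theorem ae_hasSum_mulOp {b : (ℤˣ × ℕ) × ℝ → ℂ} (hb : Measurable b) {C : ℝ} (hC : ∀ k, ‖b k‖ ≤ C)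
    (f : 𝓢(ℝ × ℝ, ℂ)) : ∀ᵐ p : ℝ × ℝ, HasSum
      (fun i : ℤˣ × ℕ => ∫ l in Ioi (0 : ℝ), b (i, l) * rayOp l i.2 i.1 f p)
      (mulOp rayTransform b (f.toLp 2) p) := by
  have hm : StronglyMeasurable fun k : (ℤˣ × ℕ) × ℝ => b k * rayCoeff f k.1 k.2 :=
    hb.stronglyMeasurable.mul (stronglyMeasurable_rayCoeff f)
  have hg : Integrable (fun k : (ℤˣ × ℕ) × ℝ => b k * rayCoeff f k.1 k.2) rayMeasure :=
    (integrable_rayCoeff f).bdd_mul hb.aestronglyMeasurable (Filter.Eventually.of_forall hC)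
  have hW : rayTransform (mulOp rayTransform b (f.toLp 2)) =ᵐ[rayMeasure]
      fun k => b k * rayCoeff f k.1 k.2 := by
    rw [map_mulOp]
    filter_upwards [coeFn_mulLp hb hC (rayTransform (f.toLp 2)), coeFn_rayTransform_toLp f]
      with k h1 h2
    rw [h1, h2]
  filter_upwards [ae_eq_integral_rayWave hm hg hW, ae_integrable_mul_rayWave hm hg] with p h1 h2
  rw [h1]
  have := hasSum_integral_rayMeasure h2
  simpa only [rayOp_eq, mul_assoc] using this

end Inversion

/-! ### The Grušin fan and the spectral measures -/

section Fan

theorem isClosed_grushinFan : IsClosed grushinFan := isClosed_closure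

theorem mem_grushinFan (ε : ℤˣ) (n : ℕ) {l : ℝ} (hl : 0 < l) :
    (signVal ε * l, (2 * n + 1) * l) ∈ grushinFan :=
  subset_closure (mem_iUnion₂.2 ⟨n, ε, l, hl, rfl⟩)

theorem measurable_fanParam_fst :
    Measurable fun k : (ℤˣ × ℕ) × ℝ => signVal k.1.1 * k.2 :=
  ((measurable_of_countable fun i : ℤˣ × ℕ => signVal i.1).comp measurable_fst).mul measurable_snd

theorem measurable_fanParam_snd :
    Measurable fun k : (ℤˣ × ℕ) × ℝ => (2 * (k.1.2 : ℝ) + 1) * k.2 :=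
  ((measurable_of_countable fun i : ℤˣ × ℕ => 2 * (i.2 : ℝ) + 1).comp measurable_fst).mul
    measurable_snd

theorem measurable_quotientParam :
    Measurable fun k : (ℤˣ × ℕ) × ℝ => signVal k.1.1 * (2 * (k.1.2 : ℝ) + 1) :=
  (measurable_of_countable fun i : ℤˣ × ℕ => signVal i.1 * (2 * (i.2 : ℝ) + 1)).comp measurable_fst

theorem isJointSpectralMeasure_pullbackPVM :
    IsJointSpectralMeasure iUOperator grushinOperator
      (pullbackPVM rayTransform (measurable_fanParam_fst.prodMk measurable_fanParam_snd)) :=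
  ⟨IsMultiplication.isResolution (b := Prod.fst) measurable_fst _ isMultiplication_iUOperator,
    IsMultiplication.isResolution (b := Prod.snd) measurable_snd _ isMultiplication_grushinOperator⟩

theorem isSpectralMeasure_pullbackPVM :
    IsSpectralMeasure grushinQuotient (pullbackPVM rayTransform measurable_quotientParam) :=
  IsMultiplication.isResolution (b := fun t : ℝ => t) measurable_id _
    isMultiplication_grushinQuotient

/-- By uniqueness E is the pulled-back measure, and all parameters with λ > 0 are mapped into the
fan. -/
theorem IsJointSpectralMeasure.proj_grushinFan {E : ProjMeasure (ℝ × ℝ) GrushinL2}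
    (hE : IsJointSpectralMeasure iUOperator grushinOperator E) : E.proj grushinFan = 1 := by
  have hm := measurable_fanParam_fst.prodMk measurable_fanParam_snd
  have hs := hm isClosed_grushinFan.measurableSet
  rw [isMultiplication_iUOperator.jointSpectralMeasure_unique measurable_fanParam_fst
    isMultiplication_grushinOperator measurable_fanParam_snd hE isClosed_grushinFan.measurableSet]
  ext1 f
  apply rayTransform.injective
  change rayTransform (mulOp rayTransform _ f) = _
  rw [map_mulOp, one_apply_eq_self]
  refine Lp.ext ?_
  filter_upwards [coeFn_mulLp_indicator hs (rayTransform f), ae_rayMeasure_pos] with k h1 h2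
  rw [h1, indicator_of_mem]
  exact mem_grushinFan k.1.1 k.1.2 h2

theorem ProjMeasure.IsIntegral.of_proj_eq {X H : Type*} [MeasurableSpace X] [NormedAddCommGroup H]
    [InnerProductSpace ℂ H] [CompleteSpace H] {E F : ProjMeasure X H} {m : X → ℂ} {T : H →L[ℂ] H}
    (h : F.IsIntegral m T) (hEF : ∀ s, MeasurableSet s → E.proj s = F.proj s) :
    E.IsIntegral m T := fun f => by
  rw [E.scalarMeasure_eq_of_proj_eq F hEF]; exact h f

theorem measurable_indicator_of_domRestrict {X : Type*} [MeasurableSpace X] {s : Set X}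
    (hs : MeasurableSet s) {m : X → ℂ} (hm : Measurable (s.domRestrict m)) :
    Measurable (s.indicator m) := by
  refine measurable_of_restrict_of_restrict_compl hs ?_ ?_
  · convert hm using 1
    ext x; simp
  · have : sᶜ.domRestrict (s.indicator m) = fun _ => 0 := by
      ext x
      simp [indicator_of_notMem x.2]
    rw [this]
    exact measurable_const

end Fan

/-! ### The main theorem -/

theorem mainTheorem8 :
    (∃ E : ProjMeasure (ℝ × ℝ) GrushinL2,
      IsJointSpectralMeasure iUOperator grushinOperator E) ∧
    (∃ F : ProjMeasure ℝ GrushinL2, IsSpectralMeasure grushinQuotient F) ∧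
    (∀ E : ProjMeasure (ℝ × ℝ) GrushinL2,
      IsJointSpectralMeasure iUOperator grushinOperator E →
      E.proj grushinFan = 1 ∧
      ∀ m : ℝ × ℝ → ℂ, Measurable (grushinFan.domRestrict m) →
        (∃ C : ℝ, ∀ p ∈ grushinFan, ‖m p‖ ≤ C) →
        ∃ T : GrushinL2 →L[ℂ] GrushinL2, E.IsIntegral (grushinFan.indicator m) T ∧
          ∀ f : 𝓢(ℝ × ℝ, ℂ),
            (∀ (ε : ℤˣ) (n : ℕ) (p : ℝ × ℝ),
              IntegrableOn (fun l : ℝ => m (signVal ε * l, (2 * n + 1) * l) * rayOp l n ε f p)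
                (Ioi 0)) ∧
            ∀ᵐ p : ℝ × ℝ,
              HasSum (fun i : ℤˣ × ℕ => ∫ l in Ioi (0 : ℝ),
                  m (signVal i.1 * l, (2 * i.2 + 1) * l) * rayOp l i.2 i.1 f p)
                (T (f.toLp 2) p)) ∧
    (∀ F : ProjMeasure ℝ GrushinL2, IsSpectralMeasure grushinQuotient F →
      ∀ m : ℝ → ℂ, Measurable m → (∃ C : ℝ, ∀ t, ‖m t‖ ≤ C) →
        ∃ T : GrushinL2 →L[ℂ] GrushinL2, F.IsIntegral m T ∧
          ∀ f : 𝓢(ℝ × ℝ, ℂ),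
            (∀ (ε : ℤˣ) (n : ℕ) (p : ℝ × ℝ),
              IntegrableOn (fun l : ℝ => rayOp l n ε f p) (Ioi 0)) ∧
            ∀ᵐ p : ℝ × ℝ,
              HasSum (fun i : ℤˣ × ℕ => m (signVal i.1 * (2 * i.2 + 1)) * rayProj i.2 i.1 f p)
                (T (f.toLp 2) p)) := by
  refine ⟨⟨_, isJointSpectralMeasure_pullbackPVM⟩, ⟨_, isSpectralMeasure_pullbackPVM⟩,
    fun E hE => ⟨hE.proj_grushinFan, fun m hm ⟨C, hC⟩ => ?_⟩, fun F hF m hm ⟨C, hC⟩ => ?_⟩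
  · have hM := measurable_indicator_of_domRestrict isClosed_grushinFan.measurableSet hm
    -- Off the fan the indicator takes the value 0, so the bound must also be nonnegative.
    have hMC (p : ℝ × ℝ) : ‖grushinFan.indicator m p‖ ≤ max C 0 := by
      by_cases hp : p ∈ grushinFan
      · rw [indicator_of_mem hp]; exact (hC p hp).trans (le_max_left _ _)
      · rw [indicator_of_notMem hp, norm_zero]; exact le_max_right _ _
    have ha := measurable_fanParam_fst.prodMk measurable_fanParam_snd
    have hval (i : ℤˣ × ℕ) {l : ℝ} (hl : l ∈ Ioi (0 : ℝ)) :
        grushinFan.indicator m (signVal i.1 * l, (2 * i.2 + 1) * l) =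
          m (signVal i.1 * l, (2 * i.2 + 1) * l) :=
      indicator_of_mem (mem_grushinFan i.1 i.2 hl) m
    refine ⟨_, (pullbackPVM_isIntegral rayTransform ha hM hMC).of_proj_eq fun s hs =>
      isMultiplication_iUOperator.jointSpectralMeasure_unique measurable_fanParam_fst
        isMultiplication_grushinOperator measurable_fanParam_snd hE hs, fun f => ⟨fun ε n p => ?_, ?_⟩⟩
    · have h1 : IntegrableOn (fun l : ℝ =>
          grushinFan.indicator m (signVal ε * l, (2 * n + 1) * l) * rayOp l n ε f p) (Ioi 0) :=
        (integrableOn_rayOp f ε n p).bdd_mul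
          (hM.comp (ha.comp (measurable_prodMk_left (x := (ε, n))))).aestronglyMeasurable
          (Filter.Eventually.of_forall fun l => hMC _)
      refine h1.congr_fun (fun l hl => ?_) measurableSet_Ioi
      simp only [hval (ε, n) hl]
    · filter_upwards [ae_hasSum_mulOp (hM.comp ha) (fun k => hMC _) f] with p hp
      refine hp.congr_fun fun i => ?_
      refine setIntegral_congr_fun measurableSet_Ioi fun l hl => ?_
      simp only [Function.comp_apply, hval i hl]
  · refine ⟨_, (pullbackPVM_isIntegral rayTransform measurable_quotientParam hm hC).of_proj_eq
      fun s hs => isMultiplication_grushinQuotient.spectralMeasure_unique measurable_quotientParam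
        hF hs, fun f => ⟨fun ε n p => integrableOn_rayOp f ε n p, ?_⟩⟩
    filter_upwards [ae_hasSum_mulOp (hm.comp measurable_quotientParam) (fun k => hC _) f] with p hp
    simpa only [Function.comp_apply, integral_const_mul, rayProj] using hp
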